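/- For real $\varepsilon,\delta$ consider the map $f_{\varepsilon,\delta}:(q,p)\mapsto(\bar q,\bar p)$ (the period-2 reduction of the lattice KdV equation) $$\bar p = p+\frac{2\varepsilon\delta q}{\varepsilon^2-q^2},\qquad \bar q = q-\frac{2\varepsilon\delta\bar p}{\varepsilon^2-\bar p^2},$$ and put $I(q,p)=p^2q^2-\varepsilon^2(p^2+q^2)-2\varepsilon\delta pq$, $T=\varepsilon\log(\varepsilon^2-p^2)$, $V=\varepsilon\log(\varepsilon^2-q^2)$. Hamilton's equations for $G(q,p)$ are $\dot q=\partial_pG$, $\dot p=-\partial_qG$, and $\{F,G\}=F_qG_p-F_pG_q$. **(1)** At every point at which $q^2\neq\varepsilon^2$ and $\bar p^2\neq\varepsilon^2$, the map preserves $dq\wedge dp$, satisfies $\bar p-p=-\partial_qH(q,\bar p)$ and $\bar q-q=\partial_{\bar p}H(q,\bar p)$ with $H(q,\bar p)=\varepsilon\delta\log(\varepsilon^2-\bar p^2)+\varepsilon\delta\log(\varepsilon^2-q^2)$ (where $\log x$ stands for $\log|x|$ if $x<0$), and preserves $I$. **(2)** Let $\varepsilon>0$ and $2\delta^2<\varepsilon^2$.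 Put $P_*=\varepsilon^2\big(|\delta|\sqrt{\delta^2+4\varepsilon^2}-\delta^2-\varepsilon^2\big)\in[-\varepsilon^4,0)$ and $$\Omega=\{(q,p):\ q^2<\varepsilon(\varepsilon-|\delta|),\ p^2<\varepsilon(\varepsilon-|\delta|),\ I(q,p)>P_*\},$$ a neighbourhood of the fixed point $(0,0)$ on which $I\in(P_*,0)$ except at the origin. For $P\in(P_*,0)$ put $D_P(x)=\delta^2\varepsilon^2x^2-(\varepsilon^2-x^2)(\varepsilon^2x^2+P)$, $\bar q_P=\dfrac{2\varepsilon^2\delta\sqrt{-P}}{\varepsilon^4+P}$ and $$\nu(P)=\int_0^{\bar q_P}\frac{dx}{2\sqrt{D_P(x)}},\qquad H^*(P)=4\varepsilon\delta\log\varepsilon+\int_0^P\nu(P')\,dP'.$$ (a) For $P\in(P_*,0)$: $D_P>0$ on the segment between $0$ and $\bar q_P$; there $p(x,P)=\dfrac{\varepsilon\delta x+\sqrt{D_P(x)}}{x^2-\varepsilon^2}$ solves $I(x,p(x,P))=P$ and $\partial p/\partial P=1/(2\sqrt{D_P(x)})$; the map sends $(0,p(0,P))$ to $(\bar q_P,p(\bar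 q_P,P))$; and $\frac{dH^*}{dP}=\nu(P)$. (b) For $z\in\Omega\setminus\{0\}$ there is a solution of Hamilton's equations of $I$, defined and contained in $\Omega$ for all times, that starts at $z$ and is at $f_{\varepsilon,\delta}(z)$ at the time $\nu(I(z))$. (c) $H^*$ is a modified Hamiltonian of the map, and it may be changed by an integration constant: $G=H^*\circ I$ on $U=\Omega$, and $G=K\circ I$ on $U=\Omega\setminus\{0\}$ for every $K$ with $K'=\nu$ on $(P_*,0)$, is $C^1$ on $U$; from every $z\in U$ there starts a solution of Hamilton's equations of $G$ that stays in $U$ for all times; and every such solution $\gamma$ satisfies $\gamma(n)=f_{\varepsilon,\delta}^{\,n}(z)$ for all $n=0,1,2,\dots$. **(3)** Let $\varepsilon>0$. For fixed $P\in(-\varepsilon^4,0)$, as $\delta\to0$, $$H^*(P)=\delta\varepsilon\log(P+\varepsilon^4)+\frac{2\delta^3\varepsilon^3P}{3(P+\varepsilon^4)^2}-\frac{4\delta^5\varepsilon^5P(P-2\varepsilon^4)}{15(P+\varepsilon^4)^4}+O(\delta^7).$$ Let $\delta H_1+\delta^2H_2+\cdots$ be the Yoshida/BCH series of the map, i.e.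 $H_n$ is the homogeneous component of degree $n$ of the Baker–Campbell–Hausdorff series $\log(e^Xe^Y)$ with $X=V$, $Y=T$ and the bracket $[F,G]=\{G,F\}$, so that $H_1=T+V$, $H_2=\tfrac12\{T,V\}$, $H_3=\tfrac1{12}(\{T,\{T,V\}\}+\{V,\{V,T\}\})$, and so on. For every $(q,p)$ with $|q|<\varepsilon$, $|p|<\varepsilon$ this series agrees to all orders with the expansion of the closed form: for all sufficiently small $|\delta|$ one has $(q,p)\in\Omega$ and $$H^*(I(q,p))=\sum_{n\ge1}\delta^nH_n(q,p),$$ with a convergent series (recall that $I$ and $H^*$ depend on $\delta$). Moreover $$H_1=\varepsilon\log(\varepsilon^2-p^2)+\varepsilon\log(\varepsilon^2-q^2),\quad H_2=-\frac{2\varepsilon^2pq}{(\varepsilon^2-p^2)(\varepsilon^2-q^2)},\quad H_3=-\frac{2\varepsilon^3(\varepsilon^2p^2+\varepsilon^2q^2+2p^2q^2)}{3(\varepsilon^2-p^2)^2(\varepsilon^2-q^2)^2},$$ $$H_4=-\frac{4\varepsilon^4pq(\varepsilon^2+p^2)(\varepsilon^2+q^2)}{3(\varepsilon^2-p^2)^3(\varepsilon^2-q^2)^3}.$$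 -/

import Mathlib

open Set Filter Topology Asymptotics

noncomputable section

/-! Phase space is `ℝ × ℝ`; a point is `z = (q, p)`, so `z.1 = q` and `z.2 = p`. -/

/-- The canonical Poisson bracket `{F, G} = F_q G_p - F_p G_q`. -/
def poissonBracket (F G : ℝ × ℝ → ℝ) : ℝ × ℝ → ℝ := fun z =>
  fderiv ℝ F z (1, 0) * fderiv ℝ G z (0, 1) - fderiv ℝ F z (0, 1) * fderiv ℝ G z (1, 0)

/-- The canonical symplectic form `dq ∧ dp`. -/
def symplecticForm (u v : ℝ × ℝ) : ℝ := u.1 * v.2 - u.2 * v.1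

/-- `γ` solves Hamilton's equations `q' = ∂G/∂p`, `p' = -∂G/∂q` for all times. -/
def IsHamiltonianTrajectory (G : ℝ × ℝ → ℝ) (γ : ℝ → ℝ × ℝ) : Prop :=
  ∀ t : ℝ, HasDerivAt γ (fderiv ℝ G (γ t) (0, 1), -fderiv ℝ G (γ t) (1, 0)) t

/-- `G` is a modified (interpolating) Hamiltonian of the map `f` on `U`: it is a `C¹` function on
`U`, its Hamiltonian flow is defined in `U` for all times, and the flow at the integer times
coincides with the iterates of `f`. -/
def IsModifiedHamiltonian (f : ℝ × ℝ → ℝ × ℝ) (U : Set (ℝ × ℝ)) (G : ℝ × ℝ → ℝ) : Prop :=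
  ContDiffOn ℝ 1 G U ∧
    ∀ z ∈ U,
      (∃ γ : ℝ → ℝ × ℝ, IsHamiltonianTrajectory G γ ∧ γ 0 = z ∧ ∀ t, γ t ∈ U) ∧
      (∀ γ : ℝ → ℝ × ℝ, IsHamiltonianTrajectory G γ → γ 0 = z → (∀ t, γ t ∈ U) →
        ∀ n : ℕ, γ (n : ℝ) = f^[n] z)

/-- The homogeneous components `Z₁, Z₂, …` of the Baker-Campbell-Hausdorff series
`Z = Z₁ + Z₂ + ⋯`, `exp X exp Y = exp Z`, with respect to a bracket `br`. They are computed by the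
standard recursion `Z₁ = X + Y` and, for `m ≥ 1`,
`(m + 1) Z_{m+1} = ½ [X - Y, Z_m]`
`  + ∑_{j even} (B_j / j!) ∑_{k₁ + ⋯ + k_j = m, kᵢ ≥ 1} [Z_{k₁}, [Z_{k₂}, … [Z_{k_j}, X + Y] … ]]`
where `B_j` are the Bernoulli numbers and `(k₁, …, k_j)` runs through the compositions of `m` of
even length. Thus `Z₂ = ½ [X, Y]`, `Z₃ = (1/12) ([X, [X, Y]] + [Y, [Y, X]])`, and so on. -/
def bchTerm {L : Type*} [AddCommGroup L] [Module ℝ L] (br : L → L → L) (X Y : L) : ℕ → L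
  | 0 => 0
  | 1 => X + Y
  | n + 2 =>
    (1 / ((n : ℝ) + 2)) •
      ((1 / 2 : ℝ) • br (X - Y) (bchTerm br X Y (n + 1)) +
        ∑ c : Composition (n + 1),
          if Even c.length then
            ((bernoulli c.length : ℝ) / (c.length.factorial : ℝ)) •
              c.blocks.attach.foldr (fun k W => br (bchTerm br X Y k.1) W) (X + Y)
          else 0)
  termination_by n => n
  decreasing_by
  · omega
  · have := c.blocks_le k.2
    omega

/-- The Baker-Campbell-Hausdorff (Yoshida) coefficients of the modified Hamiltonian of the splitting
step `exp (τ D_V) exp (τ D_T) = exp (D_{τ H₁ + τ² H₂ + ⋯})`, where `D_G F = {F, G}`. Since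
`D_F D_G - D_G D_F = D_{{G, F}}`, these are the BCH terms of the pair `V, T` with respect to the
bracket `[F, G] = {G, F}`. Thus `H₁ = T + V`, `H₂ = ½ {T, V}`, and so on. -/
def yoshidaTerm (T V : ℝ × ℝ → ℝ) (n : ℕ) : ℝ × ℝ → ℝ :=
  bchTerm (fun F G => poissonBracket G F) V T n

/-- The KdV map `(q, p) ↦ (q̄, p̄)`. -/
def kdvMap (ε δ : ℝ) (z : ℝ × ℝ) : ℝ × ℝ :=
  let p' := z.2 + 2 * ε * δ * z.1 / (ε ^ 2 - z.1 ^ 2)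
  (z.1 - 2 * ε * δ * p' / (ε ^ 2 - p' ^ 2), p')

/-- The points at which both denominators of the KdV map are non-zero. -/
def kdvDomain (ε δ : ℝ) : Set (ℝ × ℝ) :=
  {z | ε ^ 2 - z.1 ^ 2 ≠ 0 ∧ ε ^ 2 - (kdvMap ε δ z).2 ^ 2 ≠ 0}

/-- The invariant `I = p² q² - ε² (p² + q²) - 2 ε δ p q`. -/
def kdvInvariant (ε δ : ℝ) (z : ℝ × ℝ) : ℝ :=
  z.2 ^ 2 * z.1 ^ 2 - ε ^ 2 * (z.2 ^ 2 + z.1 ^ 2) - 2 * ε * δ * z.2 * z.1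

/-- The kinetic part `T = ε log (ε² - p²)` of the discrete Hamiltonian `δ (T + V)`. -/
def kdvKinetic (ε : ℝ) (z : ℝ × ℝ) : ℝ := ε * Real.log (ε ^ 2 - z.2 ^ 2)

/-- The potential part `V = ε log (ε² - q²)` of the discrete Hamiltonian `δ (T + V)`. -/
def kdvPotential (ε : ℝ) (z : ℝ × ℝ) : ℝ := ε * Real.log (ε ^ 2 - z.1 ^ 2)

/-- The discrete Hamiltonian `H(q, p̄)` (generating function). -/
def kdvDiscreteHamiltonian (ε δ : ℝ) (z : ℝ × ℝ) : ℝ :=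
  ε * δ * Real.log (ε ^ 2 - z.2 ^ 2) + ε * δ * Real.log (ε ^ 2 - z.1 ^ 2)

/-- The quartic `δ² ε² x² - (ε² - x²) (ε² x² + P)` under the square root. -/
def kdvQuartic (ε δ P x : ℝ) : ℝ :=
  δ ^ 2 * ε ^ 2 * x ^ 2 - (ε ^ 2 - x ^ 2) * (ε ^ 2 * x ^ 2 + P)

/-- The branch `p(q, P)` of the level curve `I(q, p) = P` used in the action-angle variables. -/
def kdvBranch (ε δ x P : ℝ) : ℝ :=
  (ε * δ * x + √(kdvQuartic ε δ P x)) / (x ^ 2 - ε ^ 2)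

/-- The position `q̄` reached in one step from `q = 0`. -/
def kdvEndpoint (ε δ P : ℝ) : ℝ := 2 * ε ^ 2 * δ * √(-P) / (ε ^ 4 + P)

/-- The frequency `ν(P)`, an elliptic integral of the first kind. -/
def kdvFrequency (ε δ P : ℝ) : ℝ :=
  ∫ x in (0 : ℝ)..kdvEndpoint ε δ P, 1 / (2 * √(kdvQuartic ε δ P x))

/-- The closed-form modified Hamiltonian `H*(P)`, as a function of the invariant, with the constant
of integration fixed by `H*(0) = 4 ε δ log ε`. -/
def kdvClosedForm (ε δ P : ℝ) : ℝ :=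
  4 * ε * δ * Real.log ε + ∫ P' in (0 : ℝ)..P, kdvFrequency ε δ P'

/-- The value `P_*` of the invariant for which the endpoint `q̄` is a turning point of the level
curve. -/
def kdvThreshold (ε δ : ℝ) : ℝ :=
  ε ^ 2 * (|δ| * √(δ ^ 2 + 4 * ε ^ 2) - δ ^ 2 - ε ^ 2)

/-- The region of phase space around the origin that consists of the origin and the closed
invariant curves around it on which `I > P_*`. -/
def kdvRegion (ε δ : ℝ) : Set (ℝ × ℝ) :=
  {z | z.1 ^ 2 < ε * (ε - |δ|) ∧ z.2 ^ 2 < ε * (ε - |δ|) ∧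
    kdvThreshold ε δ < kdvInvariant ε δ z}

end

/-!
The map and the Hamiltonian flow of the invariant `I` live on the same level curves, and the
derivative of the map carries the Hamiltonian vector field of `I` to itself
(`hasDerivAt_kdvMap_comp`). Hence, on an orbit of `I`, the map is the translation by a constant
time. This time can be read off at a single point of the orbit. In the region `Ω` the level curves
stay away from the boundary, the flow is complete (`exists_kdvOrbit`), and every orbit other than
the fixed point crosses the axis `q = 0` (`exists_kdvOrbit_fst_eq_zero`). There the image of the
point is known, the arc between the two is a graph over `q`, and `dq = 2 √D_P dt` along it, so that
the time is `ν(P)`, which is negative if `δ < 0` (`exists_kdvArc_time`, `kdvMap_orbit`). A function `K ∘ I` with `K' = ν` generates the flow of `I`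
with time scaled by `ν`, and is therefore a modified Hamiltonian.

The substitution `x = √(-P) y` removes the singularity of the integrals at `P = 0` and `δ = 0`: the
closed form is `H^*(P) = δ η(δ, P)`, where `η` (`kdvEta`) is an integral over `[0, 1]` of a function
that is analytic in all variables, and so is itself analytic (`analyticAt_kdvEta`). This covers the
fixed point, and it gives the expansion in `δ` by expanding the integrand of `ν`, uniformly in `P`,
and integrating with respect to `P` (`eventually_abs_kdvEta_sub_le`).

For the comparison with the Baker-Campbell-Hausdorff series, let `h(δ, z) = δ η(δ, I(z))`. The sum
of the potential `V` at `z` and of the kinetic energy `T` at the image of `z` is the average of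
`∂h/∂δ` along the trajectory of `h` from `z` to its image (`hasDerivAt_mul_kdvEta_orbit`). Expanded
in powers of `δ`, this is the equation
`((exp (ad h) - 1) / ad h) (∂h/∂δ) = V + exp (ad h) T`
for the Taylor series of `h` in the Poisson algebra of analytic functions. Multiplication by the
Bernoulli series `ad h / (exp (ad h) - 1)` turns it into the recursion that defines the
Baker-Campbell-Hausdorff terms (`eq_bchTerm_of_formal_ode`, `yoshidaTerm_eq_familyCoeff`). The
terms of that series are thus the Taylor coefficients in `δ` of an analytic function, which gives
convergence (`hasSum_yoshidaTerm_kdv`), and the first four are read off from the expansion of the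
closed form, uniform in `P`, at `P = I(z)` (`yoshidaTerm_kdv_eq`).
-/

/-! ### The Baker-Campbell-Hausdorff recursion as a formal differential equation -/

section FormalBCH

variable {L : Type*} [AddCommGroup L] [Module ℝ L]

/-- The adjoint action `F ↦ [h, F]` of a formal power series `h = ∑ hₙ δⁿ` on formal power series
`F = ∑ Fₙ δⁿ`, both with coefficients in `L` and given as sequences of coefficients. -/
def formalAd (br : L →ₗ[ℝ] L →ₗ[ℝ] L) (h : ℕ → L) : Module.End ℝ (ℕ → L) where
  toFun F n := ∑ p ∈ Finset.HasAntidiagonal.antidiagonal n, br (h p.1) (F p.2)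
  map_add' F G := by
    funext n
    simp [Finset.sum_add_distrib]
  map_smul' c F := by
    funext n
    simp [Finset.smul_sum]

theorem formalAd_apply (br : L →ₗ[ℝ] L →ₗ[ℝ] L) (h : ℕ → L) (F : ℕ → L) (n : ℕ) :
    formalAd br h F n = ∑ p ∈ Finset.HasAntidiagonal.antidiagonal n, br (h p.1) (F p.2) := rfl

variable {br : L →ₗ[ℝ] L →ₗ[ℝ] L} {h : ℕ → L}

/-- As `h` has no constant term, `ad h` raises the order in `δ`. -/
theorem formalAd_pow_apply_eq_zero (h0 : h 0 = 0) {M : ℕ} {F : ℕ → L} (hF : ∀ m < M, F m = 0)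
    (k : ℕ) : ∀ m < M + k, (formalAd br h ^ k) F m = 0 := by
  induction k with
  | zero => simpa using hF
  | succ k ih =>
    intro m hm
    rw [pow_succ', Module.End.mul_apply, formalAd_apply]
    refine Finset.sum_eq_zero fun p hp => ?_
    rw [Finset.HasAntidiagonal.mem_antidiagonal] at hp
    rcases Nat.eq_zero_or_pos p.1 with h1 | h1
    · simp [h1, h0]
    · rw [ih p.2 (by omega), map_zero]

theorem aeval_formalAd_apply_eq_zero (h0 : h 0 = 0) (p : Polynomial ℝ) {M : ℕ} {F : ℕ → L}
    (hF : ∀ m < M, F m = 0) : ∀ m < M, Polynomial.aeval (formalAd br h) p F m = 0 := by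
  intro m hm
  rw [Polynomial.aeval_eq_sum_range]
  simp only [LinearMap.sum_apply, LinearMap.smul_apply, Finset.sum_apply, Pi.smul_apply]
  exact Finset.sum_eq_zero fun k _ => by
    rw [formalAd_pow_apply_eq_zero h0 hF k m (by omega), smul_zero]

theorem aeval_formalAd_apply_congr (h0 : h 0 = 0) {p q : Polynomial ℝ} {M : ℕ}
    (hpq : ∀ d < M, p.coeff d = q.coeff d) (F : ℕ → L) {m : ℕ} (hm : m < M) :
    Polynomial.aeval (formalAd br h) p F m = Polynomial.aeval (formalAd br h) q F m := by
  have hdvd : Polynomial.X ^ M ∣ p - q :=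
    Polynomial.X_pow_dvd_iff.2 fun d hd => by simp [hpq d hd]
  obtain ⟨r, hr⟩ := hdvd
  have : Polynomial.aeval (formalAd br h) (p - q) F m = 0 := by
    rw [hr, map_mul, map_pow, Polynomial.aeval_X, Module.End.mul_apply]
    exact formalAd_pow_apply_eq_zero h0 (M := 0) (by simp) M m (by omega)
  rw [map_sub, LinearMap.sub_apply, Pi.sub_apply, sub_eq_zero] at this
  exact this

theorem aeval_trunc_formalAd (φ : PowerSeries ℝ) (M : ℕ) (F : ℕ → L) (m : ℕ) :
    Polynomial.aeval (formalAd br h) (φ.trunc M) F m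
      = ∑ k ∈ Finset.range M, PowerSeries.coeff k φ • (formalAd br h ^ k) F m := by
  rw [Polynomial.aeval_def, PowerSeries.eval₂_trunc_eq_sum_range]
  simp only [LinearMap.sum_apply, Finset.sum_apply, Module.End.mul_apply,
    Module.algebraMap_end_apply, Pi.smul_apply]

/-- The lists of `k` positive integers with sum `n`. -/
def posLists : ℕ → ℕ → Finset (List ℕ)
  | 0, n => if n = 0 then {[]} else ∅
  | k + 1, n => ((Finset.HasAntidiagonal.antidiagonal n).filter fun p => 0 < p.1).biUnion
      fun p => (posLists k p.2).image (List.cons p.1)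

theorem mem_posLists {k n : ℕ} {l : List ℕ} :
    l ∈ posLists k n ↔ l.length = k ∧ l.sum = n ∧ ∀ i ∈ l, 0 < i := by
  induction k generalizing n l with
  | zero =>
    by_cases hn : n = 0
    · simp only [posLists, hn, if_true, Finset.mem_singleton, List.length_eq_zero_iff]
      constructor
      · rintro rfl; simp
      · exact fun hl => hl.1
    · simp only [posLists, hn, if_false, Finset.notMem_empty, false_iff, List.length_eq_zero_iff]
      rintro ⟨rfl, h2, -⟩
      exact hn (by simpa using h2.symm)
  | succ k ih =>
    simp only [posLists, Finset.mem_biUnion, Finset.mem_filter, Finset.HasAntidiagonal.mem_antidiagonal,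
      Finset.mem_image, ih]
    constructor
    · rintro ⟨p, ⟨hp, hp1⟩, l', ⟨h1, h2, h3⟩, rfl⟩
      refine ⟨by simp [h1], by simp [h2, hp], ?_⟩
      simpa [hp1] using h3
    · rintro ⟨h1, h2, h3⟩
      cases l with
      | nil => simp at h1
      | cons a l' =>
        refine ⟨(a, l'.sum), ⟨by simpa using h2, h3 a (by simp)⟩, l', ⟨by simpa using h1, rfl, ?_⟩,
          rfl⟩
        exact fun i hi => h3 i (by simp [hi])

/-- Expanding the `k`-th power of `ad h`: the coefficient of `δⁿ` is the sum of the brackets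
`[hᵢ₁, [hᵢ₂, …, [hᵢₖ, W]]]` over all `i₁ + … + iₖ = n`. -/
theorem sum_posLists (h0 : h 0 = 0) (W : L) (k n : ℕ) :
    ∑ l ∈ posLists k n, l.foldr (fun i V => br (h i) V) W
      = (formalAd br h ^ k) (Pi.single 0 W) n := by
  induction k generalizing n with
  | zero =>
    by_cases hn : n = 0
    · subst hn; simp [posLists]
    · simp [posLists, hn]
  | succ k ih =>
    rw [pow_succ', Module.End.mul_apply, formalAd_apply, posLists, Finset.sum_biUnion]
    · rw [← Finset.sum_subset (Finset.filter_subset (fun p : ℕ × ℕ => 0 < p.1)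
        (Finset.HasAntidiagonal.antidiagonal n))]
      · refine Finset.sum_congr rfl fun p _ => ?_
        rw [Finset.sum_image fun a _ b _ hab => (List.cons.inj hab).2, ← ih, map_sum]
        simp
      · intro p hp hp'
        have : p.1 = 0 := by
          by_contra hne
          exact hp' (Finset.mem_filter.2 ⟨hp, Nat.pos_of_ne_zero hne⟩)
        simp [this, h0]
    · intro p hp p' hp' hne
      simp only [Finset.coe_filter, Finset.HasAntidiagonal.mem_antidiagonal, Set.mem_ofPred_eq] at hp hp'
      refine Finset.disjoint_left.2 fun l hl hl' => hne ?_
      obtain ⟨a, -, rfl⟩ := Finset.mem_image.1 hl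
      obtain ⟨b, -, hb⟩ := Finset.mem_image.1 hl'
      have := (List.cons.inj hb).1
      exact Prod.ext this.symm (by omega)

/-- The coefficient of `δⁿ` of `φ(ad h) W`, as a sum over compositions: this is how the nested
brackets of the recursion for the Baker-Campbell-Hausdorff terms arise. -/
theorem sum_composition_foldr (h0 : h 0 = 0) (W : L) (n : ℕ) (φ : ℕ → ℝ) :
    ∑ c : Composition n, φ c.length • c.blocks.foldr (fun i V => br (h i) V) W
      = ∑ k ∈ Finset.range (n + 1), φ k • (formalAd br h ^ k) (Pi.single 0 W) n := by
  have hmaps : ∀ c ∈ (Finset.univ : Finset (Composition n)), c.length ∈ Finset.range (n + 1) :=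
    fun c _ => Finset.mem_range.2 (Nat.lt_succ_of_le c.length_le)
  rw [← Finset.sum_fiberwise_of_maps_to hmaps]
  refine Finset.sum_congr rfl fun k _ => ?_
  rw [← sum_posLists h0, Finset.smul_sum]
  refine Finset.sum_bij' (fun c _ => c.blocks)
    (fun l hl => ⟨l, fun {i} hi => (mem_posLists.1 hl).2.2 i hi, (mem_posLists.1 hl).2.1⟩)
    ?_ ?_ ?_ ?_ ?_
  · intro c hc
    simp only [Finset.mem_filter, Finset.mem_univ, true_and] at hc
    exact mem_posLists.2 ⟨hc, c.blocks_sum, fun i hi => c.blocks_pos hi⟩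
  · intro l hl
    simp only [Finset.mem_filter, Finset.mem_univ, true_and]
    exact (mem_posLists.1 hl).1
  · intro c hc; rfl
  · intro l hl; rfl
  · intro c hc
    simp only [Finset.mem_filter, Finset.mem_univ, true_and] at hc
    rw [hc]

theorem bernoulliPowerSeries_mul_exp_eq_add_X :
    bernoulliPowerSeries ℝ * PowerSeries.exp ℝ = bernoulliPowerSeries ℝ + PowerSeries.X := by
  have := bernoulliPowerSeries_mul_exp_sub_one ℝ
  rw [mul_sub, mul_one, sub_eq_iff_eq_add] at this
  rw [this, add_comm]

/-- The Bernoulli series `x / (exp x - 1)` is the inverse of the series `(exp x - 1) / x`. -/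
theorem bernoulliPowerSeries_mul_expDiv :
    bernoulliPowerSeries ℝ * PowerSeries.mk (fun k => (((k + 1).factorial : ℝ))⁻¹) = 1 := by
  have hX : PowerSeries.X * PowerSeries.mk (fun k => (((k + 1).factorial : ℝ))⁻¹)
      = PowerSeries.exp ℝ - 1 := by
    ext n
    cases n with
    | zero => simp
    | succ n => simp [PowerSeries.coeff_succ_X_mul, PowerSeries.coeff_one, PowerSeries.coeff_exp]
  have := bernoulliPowerSeries_mul_exp_sub_one ℝ
  rw [← hX] at this
  refine mul_left_cancel₀ (PowerSeries.X_ne_zero (R := ℝ)) ?_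
  rw [mul_one, mul_left_comm]
  exact this

/-- If the formal series `h = ∑_{n ≥ 1} hₙ δⁿ` satisfies
`((exp (ad h) - 1) / ad h) (dh/dδ) = X + exp (ad h) Y`, then its coefficients are the terms of the
Baker-Campbell-Hausdorff series of `X` and `Y`: applying the Bernoulli series
`ad h / (exp (ad h) - 1)` to the equation turns it into the recursion that defines these terms. The
Jacobi identity is not needed. -/
theorem eq_bchTerm_of_formal_ode (halt : ∀ x y, br x y = -br y x) (X Y : L) (h0 : h 0 = 0)
    (hE : ∀ n, ∑ k ∈ Finset.range (n + 1), (((k + 1).factorial : ℝ))⁻¹ •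
        (formalAd br h ^ k) (fun m => ((m : ℝ) + 1) • h (m + 1)) n
      = (Pi.single 0 X : ℕ → L) n + ∑ k ∈ Finset.range (n + 1), ((k.factorial : ℝ))⁻¹ •
        (formalAd br h ^ k) (Pi.single 0 Y) n) :
    ∀ n, h n = bchTerm (fun a b => br a b) X Y n := by
  have key : ∀ n : ℕ, ((n : ℝ) + 1) • h (n + 1)
      = (∑ k ∈ Finset.range (n + 1), ((bernoulli k : ℝ) / (k.factorial : ℝ)) •
          (formalAd br h ^ k) (Pi.single 0 (X + Y)) n) + br (h n) Y := by
    intro n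
    set A := formalAd br h with hA
    set h' : ℕ → L := fun m => ((m : ℝ) + 1) • h (m + 1) with hh'
    set e1 : PowerSeries ℝ := PowerSeries.mk (fun k => (((k + 1).factorial : ℝ))⁻¹) with he1
    set b : PowerSeries ℝ := bernoulliPowerSeries ℝ with hb
    -- The equation modulo `δ ^ (n + 1)`, with all power series in `ad h` truncated.
    have h1 : ∀ m < n + 1, (Polynomial.aeval A (e1.trunc (n + 1)) h'
        - (Pi.single 0 X : ℕ → L) - Polynomial.aeval A ((PowerSeries.exp ℝ).trunc (n + 1))
          (Pi.single 0 Y)) m = 0 := by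
      intro m hm
      have e : ∀ (φ : PowerSeries ℝ) (F : ℕ → L), Polynomial.aeval A (φ.trunc (n + 1)) F m
          = Polynomial.aeval A (φ.trunc (m + 1)) F m := fun φ F =>
        aeval_formalAd_apply_congr h0 (M := m + 1) (fun d hd => by
          rw [PowerSeries.coeff_trunc, PowerSeries.coeff_trunc, if_pos (by omega),
            if_pos (by omega)]) F (by omega)
      have hm' := hE m
      rw [Pi.sub_apply, Pi.sub_apply, e, e, hA, aeval_trunc_formalAd, aeval_trunc_formalAd,
        sub_sub, sub_eq_zero]
      simpa [he1, PowerSeries.coeff_exp] using hm'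
    have h2 := aeval_formalAd_apply_eq_zero h0 (br := br) (b.trunc (n + 1)) h1 n (by omega)
    rw [map_sub, map_sub, ← Module.End.mul_apply, ← Module.End.mul_apply, ← hA,
      ← map_mul (Polynomial.aeval A), ← map_mul (Polynomial.aeval A), Pi.sub_apply, Pi.sub_apply] at h2
    have c1 : ∀ (φ : PowerSeries ℝ) (d : ℕ), d < n + 1 →
        (b.trunc (n + 1) * φ.trunc (n + 1)).coeff d = PowerSeries.coeff d (b * φ) :=
      fun φ d hd => by
        rw [PowerSeries.coeff_mul_eq_coeff_trunc_mul_trunc _ _ hd, ← Polynomial.coe_mul,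
          Polynomial.coeff_coe]
    rw [aeval_formalAd_apply_congr h0 (M := n + 1) (m := n) (q := 1) _ h' (by omega),
      aeval_formalAd_apply_congr h0 (M := n + 1) (m := n) (q := b.trunc (n + 1) + Polynomial.X) _
        (Pi.single 0 Y) (by omega)] at h2
    · rw [map_one, Module.End.one_apply, map_add, LinearMap.add_apply, Pi.add_apply,
        Polynomial.aeval_X, ← hA, sub_sub, sub_eq_zero, ← add_assoc, ← Pi.add_apply,
        ← map_add, ← Pi.single_add] at h2
      rw [show ((n : ℝ) + 1) • h (n + 1) = h' n from rfl, h2, hA, aeval_trunc_formalAd]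
      congr 1
      · simp [hb, bernoulliPowerSeries]
      · rw [formalAd_apply, Finset.sum_eq_single (n, 0)]
        · simp
        · intro p hp hne
          rw [Finset.HasAntidiagonal.mem_antidiagonal] at hp
          have : p.2 ≠ 0 := fun h2 => hne (Prod.ext (by simpa [h2] using hp) h2)
          simp [this]
        · simp
    · intro d hd
      rw [c1 _ d hd, hb, bernoulliPowerSeries_mul_exp_eq_add_X, map_add, Polynomial.coeff_add,
        PowerSeries.coeff_trunc, if_pos hd, PowerSeries.coeff_X, Polynomial.coeff_X]
      simp [eq_comm]
    · intro d hd
      rw [c1 _ d hd, hb, he1, bernoulliPowerSeries_mul_expDiv, PowerSeries.coeff_one,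
        Polynomial.coeff_one]
  intro n
  induction n using Nat.strong_induction_on with
  | _ n ih =>
    match n with
    | 0 => rw [h0, bchTerm]
    | 1 =>
      have := key 0
      simp [h0] at this
      rw [this, bchTerm]
    | n + 2 =>
      have hk := key (n + 1)
      have hpos : ((n + 1 : ℕ) : ℝ) + 1 ≠ 0 := by positivity
      have hn2 : ((n : ℝ) + 2) = ((n + 1 : ℕ) : ℝ) + 1 := by push_cast; ring
      rw [bchTerm, hn2, ← ih (n + 1) (by omega)]
      rw [eq_comm, one_div, inv_smul_eq_iff₀ hpos, hk]
      have hfold : ∀ c : Composition (n + 1),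
          c.blocks.attach.foldr (fun k W => br (bchTerm (fun a b => br a b) X Y k.1) W) (X + Y)
            = c.blocks.foldr (fun i V => br (h i) V) (X + Y) := by
        intro c
        rw [← List.foldr_attach (l := c.blocks)]
        have : ∀ k : {x // x ∈ c.blocks}, bchTerm (fun a b => br a b) X Y k.1 = h k.1 := fun k => by
          have := c.blocks_le k.2
          exact (ih k.1 (by omega)).symm
        simp_rw [this]
      simp_rw [hfold]
      have hsum := sum_composition_foldr (br := br) h0 (X + Y) (n + 1)
        (fun k => if Even k then ((bernoulli k : ℝ) / (k.factorial : ℝ)) else 0)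
      have hite : ∀ c : Composition (n + 1), (if Even c.length then
            ((bernoulli c.length : ℝ) / (c.length.factorial : ℝ)) •
              c.blocks.foldr (fun i V => br (h i) V) (X + Y) else 0)
          = (if Even c.length then ((bernoulli c.length : ℝ) / (c.length.factorial : ℝ)) else 0) •
              c.blocks.foldr (fun i V => br (h i) V) (X + Y) := by
        intro c; split_ifs <;> simp
      simp_rw [hite]
      rw [hsum]
      -- Among the odd Bernoulli numbers only `B₁ = -1/2` is non-zero.
      have hodd : ∀ k ∈ Finset.range (n + 1 + 1), ((bernoulli k : ℝ) / (k.factorial : ℝ)) •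
            (formalAd br h ^ k) (Pi.single 0 (X + Y)) (n + 1)
          = (if Even k then ((bernoulli k : ℝ) / (k.factorial : ℝ)) else 0) •
              (formalAd br h ^ k) (Pi.single 0 (X + Y)) (n + 1)
            + if k = 1 then (-(1 / 2 : ℝ)) • br (h (n + 1)) (X + Y) else 0 := by
        intro k _
        by_cases hk1 : k = 1
        · subst hk1
          simp only [pow_one, formalAd_apply]
          rw [Finset.sum_eq_single (n + 1, 0)]
          · simp [bernoulli_one]
            norm_num
          · intro p hp hne
            rw [Finset.HasAntidiagonal.mem_antidiagonal] at hp
            have : p.2 ≠ 0 := fun h2 => hne (Prod.ext (by simpa [h2] using hp) h2)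
            simp [this]
          · simp
        · rcases Nat.even_or_odd k with he | ho
          · simp [he, hk1]
          · have : 1 < k := by
              rcases ho with ⟨j, rfl⟩; omega
            simp [bernoulli_eq_zero_of_odd ho this, hk1]
      rw [Finset.sum_congr rfl hodd, Finset.sum_add_distrib, Finset.sum_ite_eq',
        if_pos (Finset.mem_range.2 (by omega)), halt (X - Y)]
      simp only [map_add, map_sub]
      module

end FormalBCH

/-! ### Analytic dependence of integrals on parameters -/

section ParametricIntegral

variable {E : Type*} [NormedAddCommGroup E] [NormedSpace ℝ E]

open scoped NNReal ENNReal in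
/-- Local form of `AnalyticAt.intervalIntegral_param`: the power series of `F` at `(x₀, u₀)` is
re-expanded around `(x₀, u)` and integrated term by term. -/
theorem AnalyticAt.exists_analyticAt_intervalIntegral {F : E × ℝ → ℝ} {x₀ : E} {u₀ : ℝ}
    (hF : AnalyticAt ℝ F (x₀, u₀)) :
    ∃ ρ > 0, ∀ c ∈ Metric.ball u₀ ρ, ∀ d ∈ Metric.ball u₀ ρ,
      AnalyticAt ℝ (fun x => ∫ u in c..d, F (x, u)) x₀ := by
  obtain ⟨p, r, hp⟩ := hF
  obtain ⟨r', hr'0, hr'⟩ : ∃ r' : ℝ≥0, 0 < r' ∧ (r' : ℝ≥0∞) < r := by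
    obtain ⟨r', h1, h2⟩ := ENNReal.lt_iff_exists_nnreal_btwn.1 hp.r_pos
    exact ⟨r', by exact_mod_cast h1, h2⟩
  set ρ : ℝ≥0 := r' / 2 with hρ
  have hρ0 : 0 < ρ := by positivity
  have hρρ : ρ + ρ = r' := by rw [hρ]; exact add_halves r'
  have hρr : ((ρ : ℝ≥0∞) + ρ) < p.radius := by
    refine lt_of_lt_of_le ?_ hp.r_le
    rw [← ENNReal.coe_add, hρρ]
    exact hr'
  have hρr1 : (ρ : ℝ≥0∞) < p.radius := lt_of_le_of_lt le_self_add hρr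
  refine ⟨ρ, by exact_mod_cast hρ0, fun c hc d hd => ?_⟩
  have hcd : ∀ u ∈ uIcc c d, ‖((0 : E), u - u₀)‖₊ < ρ := by
    intro u hu
    have : u ∈ Metric.ball u₀ (ρ : ℝ) :=
      (convex_ball u₀ (ρ : ℝ)).ordConnected.uIcc_subset hc hd hu
    rw [Metric.mem_ball, dist_eq_norm] at this
    rw [← NNReal.coe_lt_coe, coe_nnnorm]
    simpa using this
  set C : ℕ → ℝ≥0 := fun k =>
    ∑' s : Σ l : ℕ, { s : Finset (Fin (k + l)) // s.card = l }, ‖p (k + s.1)‖₊ * ρ ^ s.1 with hC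
  have hCsum : Summable fun k => C k * ρ ^ k := by
    simpa only [hC, ← NNReal.tsum_mul_right] using
      (NNReal.summable_sigma.1 (p.changeOriginSeries_summable_aux₁ hρr)).2
  have hbound : ∀ u ∈ uIcc c d, ∀ k, ‖p.changeOrigin ((0 : E), u - u₀) k‖₊ ≤ C k := by
    intro u hu k
    have h1 := hcd u hu
    have h2 : (‖((0 : E), u - u₀)‖₊ : ℝ≥0∞) < p.radius :=
      lt_trans (by exact_mod_cast h1) hρr1
    refine (p.nnnorm_changeOrigin_le k h2).trans ?_
    refine Summable.tsum_le_tsum (fun s => ?_) (p.changeOriginSeries_summable_aux₂ h2 k)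
      (p.changeOriginSeries_summable_aux₂ hρr1 k)
    gcongr
  set q : ℝ → (n : ℕ) → ContinuousMultilinearMap ℝ (fun _ : Fin n => E) ℝ := fun u n =>
    (p.changeOrigin ((0 : E), u - u₀) n).compContinuousLinearMap
      (fun _ => ContinuousLinearMap.inl ℝ E ℝ) with hq
  have hqn : ∀ u ∈ uIcc c d, ∀ n, ‖q u n‖ ≤ C n := by
    intro u hu n
    refine (ContinuousMultilinearMap.norm_compContinuousLinearMap_le _ _).trans ?_
    have h1 : ∏ _i : Fin n, ‖ContinuousLinearMap.inl ℝ E ℝ‖ ≤ 1 :=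
      Finset.prod_le_one (fun _ _ => norm_nonneg _)
        fun _ _ => ContinuousLinearMap.norm_inl_le_one ℝ E ℝ
    calc _ ≤ ‖p.changeOrigin ((0 : E), u - u₀) n‖ * 1 := by gcongr
      _ ≤ C n := by
        rw [mul_one]
        exact_mod_cast hbound u hu n
  have hqc : ∀ n, ContinuousOn (fun u => q u n) (uIcc c d) := by
    intro n
    have h1 : ContinuousOn (fun y => p.changeOrigin y n) (Metric.eball 0 p.radius) :=
      (p.hasFPowerSeriesOnBall_changeOrigin n (hp.r_pos.trans_le hp.r_le)).continuousOn
    have h2 : ContinuousOn (fun u : ℝ => p.changeOrigin ((0 : E), u - u₀) n) (uIcc c d) := by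
      refine h1.comp (Continuous.continuousOn (by fun_prop)) fun u hu => ?_
      rw [mem_eball_zero_iff]
      exact lt_trans (by exact_mod_cast hcd u hu) hρr1
    exact (ContinuousMultilinearMap.compContinuousLinearMapL (F := ℝ)
      (fun _ : Fin n => ContinuousLinearMap.inl ℝ E ℝ)).continuous.comp_continuousOn h2
  have hqi : ∀ n, IntervalIntegrable (fun u => q u n) MeasureTheory.volume c d :=
    fun n => (hqc n).intervalIntegrable
  refine ⟨fun n => ∫ u in c..d, q u n, ρ, ?_, by exact_mod_cast hρ0, ?_⟩
  · refine FormalMultilinearSeries.le_radius_of_bound _ ((∑' k, C k * ρ ^ k : ℝ≥0) * |d - c|)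
      fun n => ?_
    have h1 : ‖∫ u in c..d, q u n‖ ≤ C n * |d - c| :=
      intervalIntegral.norm_integral_le_of_norm_le_const fun u hu =>
        hqn u (uIoc_subset_uIcc hu) n
    have h2 : C n * ρ ^ n ≤ ∑' k, C k * ρ ^ k := hCsum.le_tsum n fun _ _ => zero_le
    have h3 : (C n : ℝ) * (ρ : ℝ) ^ n ≤ ((∑' k, C k * ρ ^ k : ℝ≥0) : ℝ) := by exact_mod_cast h2
    calc ‖∫ u in c..d, q u n‖ * (ρ : ℝ) ^ n ≤ (C n * |d - c|) * (ρ : ℝ) ^ n := by gcongr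
      _ = (C n * (ρ : ℝ) ^ n) * |d - c| := by ring
      _ ≤ _ := by gcongr
  · intro v hv
    have hv' : ‖v‖₊ < ρ := by
      rw [mem_eball_zero_iff] at hv
      exact_mod_cast hv
    have hev : ∀ n, (∫ u in c..d, q u n) (fun _ => v) = ∫ u in c..d, q u n (fun _ => v) := by
      intro n
      exact ((ContinuousMultilinearMap.apply ℝ (fun _ : Fin n => E) ℝ
        (fun _ => v)).intervalIntegral_comp_comm (hqi n)).symm
    simp_rw [hev]
    refine intervalIntegral.hasSum_integral_of_dominated_convergence
      (fun n _ => (C n * ρ ^ n : ℝ)) (fun n => ?_) (fun n => ?_) ?_ ?_ ?_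
    · have : ContinuousOn (fun u => q u n (fun _ => v)) (uIcc c d) :=
        (ContinuousMultilinearMap.apply ℝ (fun _ : Fin n => E) ℝ
          (fun _ => v)).continuous.comp_continuousOn (hqc n)
      exact (this.mono uIoc_subset_uIcc).aestronglyMeasurable measurableSet_uIoc
    · refine Eventually.of_forall fun u hu => ?_
      refine ((q u n).le_opNorm _).trans ?_
      rw [Finset.prod_const, Finset.card_univ, Fintype.card_fin]
      have : ‖v‖ ≤ ρ := by exact_mod_cast hv'.le
      gcongr
      exact hqn u (uIoc_subset_uIcc hu) n
    · exact Eventually.of_forall fun u hu => by exact_mod_cast hCsum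
    · exact intervalIntegrable_const
    · refine Eventually.of_forall fun u hu => ?_
      have h1 := hcd u (uIoc_subset_uIcc hu)
      have h2 := (hp.changeOrigin (y := ((0 : E), u - u₀))
        (lt_trans (by exact_mod_cast h1) (lt_of_le_of_lt
          (ENNReal.coe_le_coe.2 (hρρ ▸ le_self_add)) hr'))).hasSum (y := (v, (0 : ℝ))) (by
          rw [mem_eball_zero_iff, lt_tsub_iff_right]
          refine lt_of_le_of_lt ?_ hr'
          have e1 : ‖(v, (0 : ℝ))‖₊ ≤ ρ := by
            rw [← NNReal.coe_le_coe, coe_nnnorm, Prod.norm_mk, norm_zero]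
            exact max_le (by exact_mod_cast hv'.le) ρ.2
          rw [← hρρ, ENNReal.coe_add]
          exact add_le_add (by exact_mod_cast e1) (by exact_mod_cast h1.le))
      simpa [hq] using h2

/-- An integral over a compact interval of a function which is analytic in all variables depends
analytically on the parameters. -/
theorem AnalyticAt.intervalIntegral_param {F : E × ℝ → ℝ} {x₀ : E}
    (hF : ∀ u ∈ Icc (0 : ℝ) 1, AnalyticAt ℝ F (x₀, u)) :
    AnalyticAt ℝ (fun x => ∫ u in (0 : ℝ)..1, F (x, u)) x₀ := by
  have hcont : ∀ᶠ x in 𝓝 x₀, ∀ u ∈ Icc (0 : ℝ) 1, ContinuousAt F (x, u) :=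
    isCompact_Icc.eventually_forall_of_forall_eventually fun u hu =>
      (hF u hu).eventually_analyticAt.mono fun y hy => hy.continuousAt
  have hint : ∀ᶠ x in 𝓝 x₀, ∀ c ∈ Icc (0 : ℝ) 1, ∀ d ∈ Icc (0 : ℝ) 1,
      IntervalIntegrable (fun u => F (x, u)) MeasureTheory.volume c d := by
    filter_upwards [hcont] with x hx c hc d hd
    refine ContinuousOn.intervalIntegrable fun u hu => ?_
    have hu' : u ∈ Icc (0 : ℝ) 1 := ordConnected_Icc.uIcc_subset hc hd hu
    exact ((hx u hu').comp (f := fun u => (x, u)) (by fun_prop)).continuousWithinAt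
  -- The set of admissible upper limits of integration is open and closed in `[0, 1]`.
  set A : ℝ → Prop := fun t => AnalyticAt ℝ (fun x => ∫ u in (0 : ℝ)..t, F (x, u)) x₀ with hA
  have hloc : ∀ t ∈ Icc (0 : ℝ) 1, ∃ ρ > 0, ∀ c ∈ Icc (0 : ℝ) 1, ∀ d ∈ Icc (0 : ℝ) 1,
      c ∈ Metric.ball t ρ → d ∈ Metric.ball t ρ → A c → A d := by
    intro t ht
    obtain ⟨ρ, hρ, h⟩ := (hF t ht).exists_analyticAt_intervalIntegral
    refine ⟨ρ, hρ, fun c hc d hd hct hdt hAc => ?_⟩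
    refine (hAc.add (h c hct d hdt)).congr ?_
    filter_upwards [hint] with x hx
    exact intervalIntegral.integral_add_adjacent_intervals (hx 0 (by simp) c hc) (hx c hc d hd)
  have hconn : IsPreconnected (Icc (0 : ℝ) 1) := isPreconnected_Icc
  have h0 : A 0 := by
    simp only [hA, intervalIntegral.integral_same]
    exact analyticAt_const
  by_contra h1
  obtain ⟨t, ht, ht1, ht2⟩ := hconn
    {t | ∃ ρ > 0, Metric.ball t ρ ∩ Icc 0 1 ⊆ {s | A s}}
    {t | ∃ ρ > 0, Metric.ball t ρ ∩ Icc 0 1 ⊆ {s | ¬ A s}}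
    (by
      refine isOpen_iff_mem_nhds.2 fun t ⟨ρ, hρ, h⟩ => ?_
      filter_upwards [Metric.ball_mem_nhds t (half_pos hρ)] with s hs
      refine ⟨ρ / 2, half_pos hρ, fun x hx => h ⟨?_, hx.2⟩⟩
      have := dist_triangle x s t
      have h3 := Metric.mem_ball.1 hx.1
      have h4 := Metric.mem_ball.1 hs
      exact Metric.mem_ball.2 (by linarith))
    (by
      refine isOpen_iff_mem_nhds.2 fun t ⟨ρ, hρ, h⟩ => ?_
      filter_upwards [Metric.ball_mem_nhds t (half_pos hρ)] with s hs
      refine ⟨ρ / 2, half_pos hρ, fun x hx => h ⟨?_, hx.2⟩⟩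
      have := dist_triangle x s t
      have h3 := Metric.mem_ball.1 hx.1
      have h4 := Metric.mem_ball.1 hs
      exact Metric.mem_ball.2 (by linarith))
    (by
      intro t ht
      obtain ⟨ρ, hρ, h⟩ := hloc t ht
      by_cases hAt : A t
      · exact Or.inl ⟨ρ, hρ, fun s hs => h t ht s hs.2 (Metric.mem_ball_self hρ) hs.1 hAt⟩
      · exact Or.inr ⟨ρ, hρ, fun s hs hAs =>
          hAt (h s hs.2 t ht hs.1 (Metric.mem_ball_self hρ) hAs)⟩)
    (by
      obtain ⟨ρ, hρ, h⟩ := hloc 0 (by simp)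
      exact ⟨0, by simp, ρ, hρ, fun s hs => h 0 (by simp) s hs.2 (Metric.mem_ball_self hρ) hs.1 h0⟩)
    (by
      obtain ⟨ρ, hρ, h⟩ := hloc 1 (by simp)
      exact ⟨1, by simp, ρ, hρ, fun s hs hAs =>
        h1 (h s hs.2 1 (by simp) hs.1 (Metric.mem_ball_self hρ) hAs)⟩)
  obtain ⟨⟨ρ, hρ, h⟩, ρ', hρ', h'⟩ := ht1, ht2
  exact h' ⟨Metric.mem_ball_self hρ', ht⟩ (h ⟨Metric.mem_ball_self hρ, ht⟩)

/-- Differentiation under the integral sign. -/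
theorem hasDerivAt_intervalIntegral_param {F F' : ℝ → ℝ → ℝ} {x₀ : ℝ}
    (hF : ∀ u ∈ Icc (0 : ℝ) 1, ∀ᶠ y : ℝ × ℝ in 𝓝 (x₀, u),
      HasDerivAt (fun x => F x y.2) (F' y.1 y.2) y.1 ∧ ContinuousAt (fun u => F y.1 u) y.2)
    (hF' : ∀ u ∈ Icc (0 : ℝ) 1, ContinuousAt (fun y : ℝ × ℝ => F' y.1 y.2) (x₀, u)) :
    HasDerivAt (fun x => ∫ u in (0 : ℝ)..1, F x u) (∫ u in (0 : ℝ)..1, F' x₀ u) x₀ := by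
  have h1 := isCompact_Icc.eventually_forall_of_forall_eventually (P := fun x u =>
    HasDerivAt (fun x => F x u) (F' x u) x ∧ ContinuousAt (fun u => F x u) u) hF
  have hF'c : ContinuousOn (fun u => F' x₀ u) (Icc (0 : ℝ) 1) := fun u hu =>
    ((hF' u hu).comp (f := fun u => (x₀, u)) (by fun_prop)).continuousWithinAt
  obtain ⟨C, hC⟩ := isCompact_Icc.exists_bound_of_continuousOn hF'c
  have h2 : ∀ᶠ x in 𝓝 x₀, ∀ u ∈ Icc (0 : ℝ) 1, ‖F' x u‖ ≤ C + 1 := by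
    refine isCompact_Icc.eventually_forall_of_forall_eventually fun u hu => ?_
    have := (hF' u hu).norm.eventually_lt
      (g := fun _ => C + 1) continuousAt_const (by simpa using (hC u hu).trans_lt (lt_add_one C))
    exact this.mono fun y hy => hy.le
  obtain ⟨s, hs, hs'⟩ := (h1.and h2).exists_mem
  have hsub : uIoc (0 : ℝ) 1 ⊆ Icc 0 1 := by
    rw [uIoc_of_le zero_le_one]
    exact Ioc_subset_Icc_self
  have hcF : ∀ x ∈ s, ContinuousOn (fun u => F x u) (Icc 0 1) := fun x hx u hu =>
    ((hs' x hx).1 u hu).2.continuousWithinAt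
  refine (intervalIntegral.hasDerivAt_integral_of_dominated_loc_of_deriv_le (s := s)
    (bound := fun _ => C + 1) (F' := F') hs ?_ ?_ ?_ ?_ ?_ ?_).2
  · filter_upwards [hs] with x hx
    exact ((hcF x hx).mono hsub).aestronglyMeasurable measurableSet_uIoc
  · refine ContinuousOn.intervalIntegrable ?_
    rw [uIcc_of_le zero_le_one]
    exact hcF x₀ (mem_of_mem_nhds hs)
  · exact (hF'c.mono hsub).aestronglyMeasurable measurableSet_uIoc
  · exact Eventually.of_forall fun u hu x hx => (hs' x hx).2 u (hsub hu)
  · exact intervalIntegrable_const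
  · exact Eventually.of_forall fun u hu x hx => ((hs' x hx).1 u (hsub hu)).1

end ParametricIntegral

/-! ### The map: symplecticity, generating function and invariant -/

section Map

variable {ε δ : ℝ}

theorem kdvMap_snd (z : ℝ × ℝ) :
    (kdvMap ε δ z).2 = z.2 + 2 * ε * δ * z.1 / (ε ^ 2 - z.1 ^ 2) := rfl

theorem kdvMap_fst (z : ℝ × ℝ) :
    (kdvMap ε δ z).1
      = z.1 - 2 * ε * δ * (kdvMap ε δ z).2 / (ε ^ 2 - (kdvMap ε δ z).2 ^ 2) := rfl

theorem kdvMap_zero : kdvMap ε δ 0 = 0 := by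
  simp [kdvMap]

theorem kdvMap_neg (z : ℝ × ℝ) : kdvMap ε δ (-z) = -kdvMap ε δ z := by
  simp only [kdvMap, Prod.fst_neg, Prod.snd_neg]
  ext
  · simp only [Prod.fst_neg]
    rw [show -z.2 + 2 * ε * δ * -z.1 / (ε ^ 2 - (-z.1) ^ 2)
      = -(z.2 + 2 * ε * δ * z.1 / (ε ^ 2 - z.1 ^ 2)) by rw [neg_sq]; ring]
    rw [neg_sq]
    ring
  · simp only [Prod.snd_neg]
    rw [neg_sq]
    ring

theorem kdvInvariant_neg (z : ℝ × ℝ) : kdvInvariant ε δ (-z) = kdvInvariant ε δ z := by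
  simp [kdvInvariant]

theorem hasDerivAt_kick {x : ℝ} (hx : ε ^ 2 - x ^ 2 ≠ 0) :
    HasDerivAt (fun x : ℝ => 2 * ε * δ * x / (ε ^ 2 - x ^ 2))
      (2 * ε * δ * (ε ^ 2 + x ^ 2) / (ε ^ 2 - x ^ 2) ^ 2) x := by
  have h1 : HasDerivAt (fun x : ℝ => 2 * ε * δ * x) (2 * ε * δ * 1) x :=
    (hasDerivAt_id x).const_mul _
  have h2 : HasDerivAt (fun x : ℝ => ε ^ 2 - x ^ 2) (-(2 * x)) x := by
    simpa using (hasDerivAt_pow 2 x).const_sub (ε ^ 2)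
  refine (h1.div h2 hx).congr_deriv ?_
  field_simp
  ring

/-- The derivative of the map, in the form of the composition of the two shears. -/
theorem hasFDerivAt_kdvMap {z : ℝ × ℝ} (hz : z ∈ kdvDomain ε δ) :
    ∃ A : ℝ × ℝ →L[ℝ] ℝ × ℝ, HasFDerivAt (kdvMap ε δ) A z ∧ ∀ v : ℝ × ℝ,
      (A v).2 = v.2 + 2 * ε * δ * (ε ^ 2 + z.1 ^ 2) / (ε ^ 2 - z.1 ^ 2) ^ 2 * v.1 ∧
      (A v).1 = v.1 - 2 * ε * δ * (ε ^ 2 + (kdvMap ε δ z).2 ^ 2)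
        / (ε ^ 2 - (kdvMap ε δ z).2 ^ 2) ^ 2 * (A v).2 := by
  have h2 := (hasFDerivAt_snd (𝕜 := ℝ) (p := z)).add
    ((hasDerivAt_kick (δ := δ) hz.1).comp_hasFDerivAt z (hasFDerivAt_fst (𝕜 := ℝ) (p := z)))
  have h1 := (hasFDerivAt_fst (𝕜 := ℝ) (p := z)).sub
    ((hasDerivAt_kick (δ := δ) hz.2).comp_hasFDerivAt z h2)
  refine ⟨_, h1.prodMk h2, fun v => ⟨?_, ?_⟩⟩
  · simp
  · simp
    ring

theorem hasDerivAt_log_sub_sq {x : ℝ} (hx : ε ^ 2 - x ^ 2 ≠ 0) :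
    HasDerivAt (fun x : ℝ => Real.log (ε ^ 2 - x ^ 2)) (-(2 * x) / (ε ^ 2 - x ^ 2)) x := by
  have h2 : HasDerivAt (fun x : ℝ => ε ^ 2 - x ^ 2) (-(2 * x)) x := by
    simpa using (hasDerivAt_pow 2 x).const_sub (ε ^ 2)
  exact h2.log hx

/-- The points `(q, p)` and `(q, -p̄)` lie on the same level curve of the invariant: `p` and `-p̄` are
the two roots of a quadratic equation. -/
theorem kdvInvariant_fst_neg_kdvMap_snd {z : ℝ × ℝ} (hz : ε ^ 2 - z.1 ^ 2 ≠ 0) :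
    kdvInvariant ε δ (z.1, -(kdvMap ε δ z).2) = kdvInvariant ε δ z := by
  simp only [kdvInvariant, kdvMap_snd]
  field_simp
  ring

theorem kdvInvariant_kdvMap {z : ℝ × ℝ} (hz : z ∈ kdvDomain ε δ) :
    kdvInvariant ε δ (kdvMap ε δ z) = kdvInvariant ε δ z := by
  rw [← kdvInvariant_fst_neg_kdvMap_snd hz.1]
  have h2 := hz.2
  simp only [kdvInvariant, kdvMap_fst]
  field_simp
  ring

theorem kdvMap_isSymplectic_discreteHamilton {z : ℝ × ℝ} (hz : z ∈ kdvDomain ε δ) :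
    (∃ A : ℝ × ℝ →L[ℝ] ℝ × ℝ, HasFDerivAt (kdvMap ε δ) A z ∧
        ∀ u v : ℝ × ℝ, symplecticForm (A u) (A v) = symplecticForm u v) ∧
      HasDerivAt (fun x => kdvDiscreteHamiltonian ε δ (x, (kdvMap ε δ z).2))
        (-((kdvMap ε δ z).2 - z.2)) z.1 ∧
      HasDerivAt (fun y => kdvDiscreteHamiltonian ε δ (z.1, y))
        ((kdvMap ε δ z).1 - z.1) (kdvMap ε δ z).2 ∧
      kdvInvariant ε δ (kdvMap ε δ z) = kdvInvariant ε δ z := by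
  refine ⟨?_, ?_, ?_, kdvInvariant_kdvMap hz⟩
  · obtain ⟨A, hA, hA'⟩ := hasFDerivAt_kdvMap hz
    refine ⟨A, hA, fun u v => ?_⟩
    simp only [symplecticForm, (hA' u).2, (hA' v).2, (hA' u).1, (hA' v).1]
    ring
  · refine (((hasDerivAt_log_sub_sq hz.1).const_mul (ε * δ)).const_add
      (ε * δ * Real.log (ε ^ 2 - (kdvMap ε δ z).2 ^ 2))).congr_deriv ?_
    rw [kdvMap_snd]
    ring
  · refine (((hasDerivAt_log_sub_sq hz.2).const_mul (ε * δ)).add_const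
      (ε * δ * Real.log (ε ^ 2 - z.1 ^ 2))).congr_deriv ?_
    rw [kdvMap_fst]
    ring

end Map

/-! ### The region around the fixed point -/

section Region

variable {ε δ : ℝ}

theorem abs_lt_of_two_mul_sq_lt (hε : 0 < ε) (hδ : 2 * δ ^ 2 < ε ^ 2) : |δ| < ε := by
  have h1 := sq_abs δ
  nlinarith [abs_nonneg δ, sq_nonneg δ]

/-- On the lines `p² = m`, where `m = ε (ε - |δ|)`, the invariant is at most `-m²`. -/
theorem kdvInvariant_le_of_sq_eq (hε : 0 < ε) {q s : ℝ}
    (hs : s ^ 2 = ε * (ε - |δ|)) : kdvInvariant ε δ (q, s) ≤ -(ε * (ε - |δ|)) ^ 2 := by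
  have h1 : kdvInvariant ε δ (q, s)
      = -(ε * |δ|) * q ^ 2 - 2 * ε * δ * s * q - ε ^ 2 * (ε * (ε - |δ|)) := by
    simp only [kdvInvariant]
    rw [hs]
    ring
  have h2 : |δ| * (ε * |δ| * q ^ 2 + 2 * ε * δ * s * q + ε * |δ| * s ^ 2)
      = ε * (|δ| * q + δ * s) ^ 2 := by
    have := sq_abs δ
    linear_combination (ε * s ^ 2) * this
  rw [h1]
  rcases (abs_nonneg δ).eq_or_lt with h0 | h0
  · have : δ = 0 := abs_eq_zero.1 h0.symm
    subst this
    simp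
    nlinarith
  · have h3 : 0 ≤ ε * |δ| * q ^ 2 + 2 * ε * δ * s * q + ε * |δ| * s ^ 2 :=
      nonneg_of_mul_nonneg_right (by rw [h2]; positivity) h0
    rw [hs] at h3
    nlinarith

theorem kdvInvariant_swap (q p : ℝ) : kdvInvariant ε δ (q, p) = kdvInvariant ε δ (p, q) := by
  simp only [kdvInvariant]
  ring

theorem neg_sq_le_kdvThreshold (hε : 0 < ε) :
    -(ε * (ε - |δ|)) ^ 2 ≤ kdvThreshold ε δ := by
  have h1 : 2 * ε ≤ √(δ ^ 2 + 4 * ε ^ 2) := by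
    refine Real.le_sqrt_of_sq_le ?_
    nlinarith [sq_nonneg δ]
  have h2 := mul_le_mul_of_nonneg_left h1 (abs_nonneg δ)
  have h3 := sq_abs δ
  simp only [kdvThreshold]
  have : ε ^ 2 * (|δ| * (2 * ε)) ≤ ε ^ 2 * (|δ| * √(δ ^ 2 + 4 * ε ^ 2)) := by gcongr
  nlinarith

theorem neg_pow_four_le_kdvThreshold (hε : 0 < ε) (hδ : 2 * δ ^ 2 < ε ^ 2) :
    -ε ^ 4 ≤ kdvThreshold ε δ := by
  have h1 := neg_sq_le_kdvThreshold (δ := δ) hε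
  have h2 := abs_lt_of_two_mul_sq_lt hε hδ
  have h3 : (ε * (ε - |δ|)) ^ 2 ≤ (ε * ε) ^ 2 := by
    have := abs_nonneg δ
    have : 0 ≤ ε - |δ| := by linarith
    gcongr
    linarith
  nlinarith

theorem kdvThreshold_neg (hε : 0 < ε) (hδ : 2 * δ ^ 2 < ε ^ 2) : kdvThreshold ε δ < 0 := by
  have h1 : |δ| * √(δ ^ 2 + 4 * ε ^ 2) < δ ^ 2 + ε ^ 2 := by
    rw [← abs_of_nonneg (Real.sqrt_nonneg (δ ^ 2 + 4 * ε ^ 2)), ← abs_mul]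
    refine abs_lt_of_sq_lt_sq ?_ (by positivity)
    rw [mul_pow, Real.sq_sqrt (by positivity)]
    nlinarith [sq_nonneg δ, sq_nonneg (ε ^ 2)]
  simp only [kdvThreshold]
  have : 0 < ε ^ 2 := by positivity
  nlinarith

/-- The polynomial form of the condition `P > P_*`. -/
theorem lt_sq_of_kdvThreshold_lt (hε : 0 < ε) {P : ℝ}
    (hP : kdvThreshold ε δ < P) : 2 * ε ^ 2 * δ ^ 2 * (ε ^ 4 - P) < (ε ^ 4 + P) ^ 2 := by
  have h1 : ε ^ 2 * (|δ| * √(δ ^ 2 + 4 * ε ^ 2)) < P + ε ^ 2 * δ ^ 2 + ε ^ 4 := by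
    simp only [kdvThreshold] at hP
    nlinarith
  have h2 := pow_lt_pow_left₀ h1 (by positivity) two_ne_zero
  rw [mul_pow, mul_pow, Real.sq_sqrt (by positivity), sq_abs] at h2
  nlinarith

theorem kdvThreshold_lt_of_lt_sq (hε : 0 < ε) {P : ℝ} (hP4 : -ε ^ 4 < P)
    (hP : 2 * ε ^ 2 * δ ^ 2 * (ε ^ 4 - P) < (ε ^ 4 + P) ^ 2) : kdvThreshold ε δ < P := by
  have h1 : ε ^ 2 * (|δ| * √(δ ^ 2 + 4 * ε ^ 2)) < P + ε ^ 2 * δ ^ 2 + ε ^ 4 := by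
    refine lt_of_pow_lt_pow_left₀ 2 (by nlinarith [sq_nonneg (ε * δ)]) ?_
    rw [mul_pow, mul_pow, Real.sq_sqrt (by positivity), sq_abs]
    nlinarith
  simp only [kdvThreshold]
  nlinarith

theorem isOpen_kdvRegion : IsOpen (kdvRegion ε δ) := by
  have h : Continuous (kdvInvariant ε δ) := by
    unfold kdvInvariant
    fun_prop
  have h1 : Continuous fun z : ℝ × ℝ => z.1 ^ 2 := by fun_prop
  have h2 : Continuous fun z : ℝ × ℝ => z.2 ^ 2 := by fun_prop
  exact (isOpen_lt h1 continuous_const).inter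
    ((isOpen_lt h2 continuous_const).inter (isOpen_lt continuous_const h))

theorem zero_mem_kdvRegion (hε : 0 < ε) (hδ : 2 * δ ^ 2 < ε ^ 2) :
    (0 : ℝ × ℝ) ∈ kdvRegion ε δ := by
  have h1 : 0 < ε * (ε - |δ|) := mul_pos hε (by linarith [abs_lt_of_two_mul_sq_lt hε hδ])
  refine ⟨by simpa using h1, by simpa using h1, ?_⟩
  simpa [kdvInvariant] using kdvThreshold_neg hε hδ

theorem abs_mul_lt_of_mem_kdvRegion {z : ℝ × ℝ} (hz : z ∈ kdvRegion ε δ) :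
    |z.1 * z.2| < ε * (ε - |δ|) := by
  have h1 := hz.1
  have h2 := hz.2.1
  rw [abs_lt]
  constructor <;> nlinarith [sq_nonneg (z.1 - z.2), sq_nonneg (z.1 + z.2)]

/-- `I ≤ |qp|² - 2 m |qp|`, where `m = ε (ε - |δ|)`. -/
theorem kdvInvariant_le (hε : 0 < ε) (z : ℝ × ℝ) :
    kdvInvariant ε δ z ≤ |z.1 * z.2| ^ 2 - 2 * (ε * (ε - |δ|)) * |z.1 * z.2| := by
  have h1 : ε ^ 2 * (2 * |z.1 * z.2|) ≤ ε ^ 2 * (z.2 ^ 2 + z.1 ^ 2) := by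
    gcongr
    rw [abs_mul]
    nlinarith [sq_nonneg (|z.1| - |z.2|), sq_abs z.1, sq_abs z.2]
  have h2 : -(δ * (z.1 * z.2)) ≤ |δ| * |z.1 * z.2| := by
    rw [← abs_mul]
    exact neg_le_abs _
  have h3 := sq_abs (z.1 * z.2)
  simp only [kdvInvariant]
  nlinarith

theorem kdvInvariant_neg_of_mem (hε : 0 < ε) {z : ℝ × ℝ}
    (hz : z ∈ kdvRegion ε δ) (h0 : z ≠ 0) : kdvInvariant ε δ z < 0 := by
  have h1 := abs_mul_lt_of_mem_kdvRegion hz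
  have h2 := kdvInvariant_le (δ := δ) hε z
  rcases (abs_nonneg (z.1 * z.2)).eq_or_lt with h3 | h3
  · have h4 : z.1 * z.2 = 0 := abs_eq_zero.1 h3.symm
    have h5 : kdvInvariant ε δ z = -ε ^ 2 * (z.2 ^ 2 + z.1 ^ 2) := by
      simp only [kdvInvariant]
      linear_combination (z.1 * z.2 - 2 * ε * δ) * h4
    have h6 : 0 < z.2 ^ 2 + z.1 ^ 2 := by
      by_contra h
      have h7 : z.1 ^ 2 = 0 := by nlinarith [sq_nonneg z.1, sq_nonneg z.2]
      have h8 : z.2 ^ 2 = 0 := by nlinarith [sq_nonneg z.1, sq_nonneg z.2]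
      exact h0 (Prod.ext (pow_eq_zero_iff two_ne_zero |>.1 h7)
        (pow_eq_zero_iff two_ne_zero |>.1 h8))
    rw [h5]
    have : 0 < ε ^ 2 := by positivity
    nlinarith
  · nlinarith

theorem kdvInvariant_nonpos_of_mem (hε : 0 < ε) {z : ℝ × ℝ} (hz : z ∈ kdvRegion ε δ) :
    kdvInvariant ε δ z ≤ 0 := by
  rcases eq_or_ne z 0 with rfl | h
  · simp [kdvInvariant]
  · exact (kdvInvariant_neg_of_mem hε hz h).le

/-- The level curves of the invariant in the region keep a distance from the boundary of the square
`q², p² < m`; in particular `m - |qp| ≥ √(P + m²)` on the level `I = P`. -/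
theorem abs_mul_le_of_mem_kdvRegion (hε : 0 < ε) {z : ℝ × ℝ} (hz : z ∈ kdvRegion ε δ) :
    |z.1 * z.2| ≤ ε * (ε - |δ|) - √(kdvInvariant ε δ z + (ε * (ε - |δ|)) ^ 2) := by
  have h1 := abs_mul_lt_of_mem_kdvRegion hz
  have h2 := kdvInvariant_le (δ := δ) hε z
  have h3 : √(kdvInvariant ε δ z + (ε * (ε - |δ|)) ^ 2) ≤ ε * (ε - |δ|) - |z.1 * z.2| := by
    refine Real.sqrt_le_iff.2 ⟨by linarith, by nlinarith⟩
  linarith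

/-- A point of the closed square with `I > P_*` lies in the open square. -/
theorem mem_kdvRegion_of_le (hε : 0 < ε) {z : ℝ × ℝ} (h1 : z.1 ^ 2 ≤ ε * (ε - |δ|))
    (h2 : z.2 ^ 2 ≤ ε * (ε - |δ|)) (hP : kdvThreshold ε δ < kdvInvariant ε δ z) :
    z ∈ kdvRegion ε δ := by
  have h3 := neg_sq_le_kdvThreshold (δ := δ) hε
  refine ⟨lt_of_le_of_ne h1 fun h => ?_, lt_of_le_of_ne h2 fun h => ?_, hP⟩
  · have := kdvInvariant_le_of_sq_eq (δ := δ) hε (q := z.2) h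
    rw [kdvInvariant_swap] at this
    linarith
  · have := kdvInvariant_le_of_sq_eq (δ := δ) hε (q := z.1) h
    linarith

/-- The level curve through a point of the region meets the vertical line through that point in one
further point, whose ordinate is `-p̄`; as `I ≤ -m²` for `p² = m`, it lies in the same square. -/
theorem sq_kdvMap_snd_lt (hε : 0 < ε) (hδ : 2 * δ ^ 2 < ε ^ 2) {z : ℝ × ℝ}
    (hz : z ∈ kdvRegion ε δ) : (kdvMap ε δ z).2 ^ 2 < ε * (ε - |δ|) := by
  have hm : 0 < ε * (ε - |δ|) := mul_pos hε (by linarith [abs_lt_of_two_mul_sq_lt hε hδ])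
  have hq : 0 < ε ^ 2 - z.1 ^ 2 := by
    have := hz.1
    nlinarith [abs_nonneg δ]
  set s := √(ε * (ε - |δ|)) with hs
  have hs2 : s ^ 2 = ε * (ε - |δ|) := Real.sq_sqrt hm.le
  have hs0 : 0 < s := Real.sqrt_pos.2 hm
  have hp : |z.2| < s := abs_lt_of_sq_lt_sq (by rw [hs2]; exact hz.2.1) hs0.le
  have h3 := neg_sq_le_kdvThreshold (δ := δ) hε
  have h4 := hz.2.2
  have fac : ∀ x, kdvInvariant ε δ (z.1, x) - kdvInvariant ε δ z
      = -(ε ^ 2 - z.1 ^ 2) * ((x - z.2) * (x + (kdvMap ε δ z).2)) := by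
    intro x
    simp only [kdvInvariant, kdvMap_snd]
    field_simp
    ring
  rw [abs_lt] at hp
  have h5 := fac s
  have h6 := fac (-s)
  have h7 := kdvInvariant_le_of_sq_eq (δ := δ) hε (q := z.1) hs2
  have h8 := kdvInvariant_le_of_sq_eq (δ := δ) hε (q := z.1) (s := -s) (by rw [neg_sq, hs2])
  have h9 : 0 < (s - z.2) * (s + (kdvMap ε δ z).2) := by nlinarith
  have h10 : 0 < (-s - z.2) * (-s + (kdvMap ε δ z).2) := by nlinarith
  have h11 : 0 < s + (kdvMap ε δ z).2 := by
    by_contra h; nlinarith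
  have h12 : 0 < s - (kdvMap ε δ z).2 := by
    by_contra h; nlinarith
  rw [← hs2]
  nlinarith

theorem kdvRegion_sub_sq_pos (hε : 0 < ε) {z : ℝ × ℝ} (hz : z ∈ kdvRegion ε δ) :
    0 < ε ^ 2 - z.1 ^ 2 ∧ 0 < ε ^ 2 - z.2 ^ 2 := by
  have h1 := hz.1
  have h2 := hz.2.1
  constructor <;> nlinarith [abs_nonneg δ]

theorem kdvRegion_subset_kdvDomain (hε : 0 < ε) (hδ : 2 * δ ^ 2 < ε ^ 2) :
    kdvRegion ε δ ⊆ kdvDomain ε δ := by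
  intro z hz
  have h1 := sq_kdvMap_snd_lt hε hδ hz
  exact ⟨(kdvRegion_sub_sq_pos hε hz).1.ne', by nlinarith [abs_nonneg δ]⟩

/-- The map preserves the region: each of its two steps replaces one coordinate by the negative of
the second root of a quadratic equation whose roots lie in the same interval. -/
theorem kdvMap_mem_kdvRegion (hε : 0 < ε) (hδ : 2 * δ ^ 2 < ε ^ 2) {z : ℝ × ℝ}
    (hz : z ∈ kdvRegion ε δ) : kdvMap ε δ z ∈ kdvRegion ε δ := by
  have h1 := sq_kdvMap_snd_lt hε hδ hz
  have hdom := kdvRegion_subset_kdvDomain hε hδ hz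
  have hI := kdvInvariant_kdvMap hdom
  -- The second step is the first one for the point `(-p̄, q)`.
  set w : ℝ × ℝ := (-(kdvMap ε δ z).2, z.1) with hw
  have hwI : kdvInvariant ε δ w = kdvInvariant ε δ z := by
    rw [hw, kdvInvariant_swap, kdvInvariant_fst_neg_kdvMap_snd hdom.1]
  have hwm : w ∈ kdvRegion ε δ := ⟨by simpa [hw] using h1, hz.1, by rw [hwI]; exact hz.2.2⟩
  have h2 := sq_kdvMap_snd_lt hε hδ hwm
  have h3 : (kdvMap ε δ w).2 = (kdvMap ε δ z).1 := by
    rw [kdvMap_snd, kdvMap_fst, hw]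
    simp only [neg_sq]
    ring
  rw [h3] at h2
  exact ⟨h2, h1, by rw [hI]; exact hz.2.2⟩

theorem neg_mem_kdvRegion {z : ℝ × ℝ} (hz : z ∈ kdvRegion ε δ) : -z ∈ kdvRegion ε δ :=
  ⟨by simpa using hz.1, by simpa using hz.2.1, by rw [kdvInvariant_neg]; exact hz.2.2⟩

end Region

/-! ### Global solutions of differential equations -/

section ODE

open scoped NNReal

variable {E : Type*} [NormedAddCommGroup E] [NormedSpace ℝ E]

/-- A bounded, globally Lipschitz vector field is complete. -/
theorem LipschitzWith.exists_global_solution [CompleteSpace E] {V : E → E} {K L : ℝ≥0}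
    (hV : LipschitzWith K V) (hL : ∀ x, ‖V x‖ ≤ L) (x : E) :
    ∃ γ : ℝ → E, γ 0 = x ∧ ∀ t, HasDerivAt γ (V (γ t)) t := by
  have hloc : ∀ a : ℝ, ∃ γ : ℝ → E, γ 0 = x ∧ ∀ t ∈ Ioo (-a) a, HasDerivAt γ (V (γ t)) t := by
    intro a
    rcases le_or_gt a 0 with ha | ha
    · exact ⟨fun _ => x, rfl, fun t ht => absurd (ht.1.trans ht.2) (by linarith)⟩
    have hPL : IsPicardLindelof (fun _ => V) (tmin := -a) (tmax := a) ⟨0, by constructor <;> linarith⟩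
        x (L * a.toNNReal) 0 L K :=
      IsPicardLindelof.of_time_independent (fun y _ => hL y) hV.lipschitzOnWith (by
        simp [ha.le])
    obtain ⟨γ, h0, h⟩ := hPL.exists_eq_forall_mem_Icc_hasDerivWithinAt₀
    exact ⟨γ, h0, fun t ht => (h t (Ioo_subset_Icc_self ht)).hasDerivAt (Icc_mem_nhds ht.1 ht.2)⟩
  choose γ h0 hγ using hloc
  have heq : ∀ a b : ℝ, 0 < a → a ≤ b → EqOn (γ a) (γ b) (Ioo (-a) a) := by
    intro a b ha hab
    refine ODE_solution_unique_of_mem_Ioo (v := fun _ => V) (s := fun _ => univ) (K := K) (t₀ := 0)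
      (fun t _ => hV.lipschitzOnWith) (by constructor <;> linarith) (fun t ht => ⟨hγ a t ht, trivial⟩)
      (fun t ht => ⟨hγ b t ⟨by linarith [ht.1], by linarith [ht.2]⟩, trivial⟩)
      (by rw [h0, h0])
  refine ⟨fun t => γ (|t| + 1) t, h0 _, fun t => ?_⟩
  have ht : t ∈ Ioo (-(|t| + 1)) (|t| + 1) := abs_lt.1 (lt_add_one _)
  refine (hγ (|t| + 1) t ht).congr_of_eventuallyEq ?_
  filter_upwards [Ioo_mem_nhds ht.1 ht.2] with s hs
  rcases le_total (|s| + 1) (|t| + 1) with h | h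
  · exact heq _ _ (by positivity) h (abs_lt.1 (lt_add_one _))
  · exact (heq _ _ (by positivity) h hs).symm

end ODE

/-! ### The Hamiltonian flow of the invariant -/

section Flow

open scoped NNReal

variable {ε δ : ℝ}

/-- The Hamiltonian vector field of the invariant. -/
def kdvField (ε δ : ℝ) (z : ℝ × ℝ) : ℝ × ℝ :=
  (2 * z.2 * z.1 ^ 2 - 2 * ε ^ 2 * z.2 - 2 * ε * δ * z.1,
    -(2 * z.1 * z.2 ^ 2 - 2 * ε ^ 2 * z.1 - 2 * ε * δ * z.2))

theorem contDiff_kdvField : ContDiff ℝ 1 (kdvField ε δ) := by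
  unfold kdvField
  fun_prop

theorem contDiff_kdvInvariant {n : WithTop ℕ∞} : ContDiff ℝ n (kdvInvariant ε δ) := by
  unfold kdvInvariant
  fun_prop

theorem fderiv_kdvInvariant (z v : ℝ × ℝ) :
    fderiv ℝ (kdvInvariant ε δ) z v = (kdvField ε δ z).1 * v.2 - (kdvField ε δ z).2 * v.1 := by
  have h1 := hasFDerivAt_fst (𝕜 := ℝ) (E := ℝ) (F := ℝ) (p := z)
  have h2 := hasFDerivAt_snd (𝕜 := ℝ) (E := ℝ) (F := ℝ) (p := z)
  have h3 := (((h2.pow 2).mul (h1.pow 2)).sub (((h2.pow 2).add (h1.pow 2)).const_mul (ε ^ 2))).sub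
    ((h2.const_mul (2 * ε * δ)).mul h1)
  have h4 : HasFDerivAt (kdvInvariant ε δ) _ z := h3
  rw [h4.fderiv]
  simp [kdvField]
  ring

theorem hasFDerivAt_kdvInvariant (z : ℝ × ℝ) :
    HasFDerivAt (kdvInvariant ε δ) (fderiv ℝ (kdvInvariant ε δ) z) z :=
  ((contDiff_kdvInvariant (n := 1)).differentiable one_ne_zero z).hasFDerivAt

/-- The chain rule for functions of the invariant: their Hamiltonian vector fields are multiples of
that of the invariant. -/
theorem hamiltonianField_comp_kdvInvariant {K : ℝ → ℝ} {k : ℝ} {z : ℝ × ℝ}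
    (hK : HasDerivAt K k (kdvInvariant ε δ z)) :
    (fderiv ℝ (fun z => K (kdvInvariant ε δ z)) z (0, 1),
      -fderiv ℝ (fun z => K (kdvInvariant ε δ z)) z (1, 0)) = k • kdvField ε δ z := by
  have h := (hK.comp_hasFDerivAt z (hasFDerivAt_kdvInvariant z)).fderiv
  simp only [Function.comp_def] at h
  rw [h]
  ext <;> simp [fderiv_kdvInvariant]

theorem isHamiltonianTrajectory_kdvInvariant_iff {γ : ℝ → ℝ × ℝ} :
    IsHamiltonianTrajectory (kdvInvariant ε δ) γ ↔ ∀ t, HasDerivAt γ (kdvField ε δ (γ t)) t := by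
  have h : ∀ z, (fderiv ℝ (kdvInvariant ε δ) z (0, 1), -fderiv ℝ (kdvInvariant ε δ) z (1, 0))
      = kdvField ε δ z := fun z => by
    ext <;> simp [fderiv_kdvInvariant]
  simp only [IsHamiltonianTrajectory, h]

theorem hasDerivAt_kdvInvariant_comp {γ : ℝ → ℝ × ℝ} {k t : ℝ}
    (hγ : HasDerivAt γ (k • kdvField ε δ (γ t)) t) :
    HasDerivAt (fun s => kdvInvariant ε δ (γ s)) 0 t := by
  have h := (hasFDerivAt_kdvInvariant (ε := ε) (δ := δ) (γ t)).comp_hasDerivAt t hγ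
  refine h.congr_deriv ?_
  rw [fderiv_kdvInvariant]
  simp only [Prod.smul_fst, Prod.smul_snd, smul_eq_mul]
  ring

theorem kdvInvariant_comp_eq {γ : ℝ → ℝ × ℝ} {k : ℝ → ℝ}
    (hγ : ∀ t, HasDerivAt γ (k t • kdvField ε δ (γ t)) t) (t s : ℝ) :
    kdvInvariant ε δ (γ t) = kdvInvariant ε δ (γ s) :=
  is_const_of_deriv_eq_zero (fun t => (hasDerivAt_kdvInvariant_comp (hγ t)).differentiableAt)
    (fun t => (hasDerivAt_kdvInvariant_comp (hγ t)).deriv) t s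

/-- The Hamiltonian vector field of the invariant agrees on the region with a bounded, globally
Lipschitz field which is everywhere a multiple of it, and hence still preserves the invariant. -/
theorem exists_cutoff_kdvField (hε : 0 < ε) :
    ∃ (V : ℝ × ℝ → ℝ × ℝ) (K L : ℝ≥0), LipschitzWith K V ∧ (∀ z, ‖V z‖ ≤ L) ∧
      (∀ z ∈ kdvRegion ε δ, V z = kdvField ε δ z) ∧ ∀ z, ∃ c : ℝ, V z = c • kdvField ε δ z := by
  let χ : ContDiffBump (0 : ℝ × ℝ) := ⟨ε, 2 * ε, hε, by linarith⟩
  have hcs : HasCompactSupport fun z => χ z • kdvField ε δ z := χ.hasCompactSupport.smul_right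
  have hcd : ContDiff ℝ 1 fun z => χ z • kdvField ε δ z := χ.contDiff.smul contDiff_kdvField
  obtain ⟨C, hC⟩ := hcd.lipschitzWith_of_hasCompactSupport hcs one_ne_zero
  obtain ⟨L, hL⟩ := hcd.continuous.bounded_above_of_compact_support hcs
  refine ⟨_, C, L.toNNReal, hC, fun z => (hL z).trans (Real.le_coe_toNNReal L), fun z hz => ?_,
    fun z => ⟨χ z, rfl⟩⟩
  have : z ∈ Metric.closedBall (0 : ℝ × ℝ) χ.rIn := by
    have h := kdvRegion_sub_sq_pos hε hz
    rw [mem_closedBall_zero_iff]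
    change ‖z‖ ≤ ε
    rw [Prod.norm_def, Real.norm_eq_abs, Real.norm_eq_abs]
    exact max_le (abs_le_of_sq_le_sq (by linarith [h.1]) hε.le)
      (abs_le_of_sq_le_sq (by linarith [h.2]) hε.le)
  simp only [χ.one_of_mem_closedBall this, one_smul]

/-- A curve along which the invariant is constant and `> P_*` cannot leave the region. -/
theorem mem_kdvRegion_of_continuous (hε : 0 < ε) {γ : ℝ → ℝ × ℝ} (hγ : Continuous γ)
    (hI : ∀ t, kdvInvariant ε δ (γ t) = kdvInvariant ε δ (γ 0)) (h0 : γ 0 ∈ kdvRegion ε δ) (t : ℝ) :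
    γ t ∈ kdvRegion ε δ := by
  have h : IsClopen (γ ⁻¹' kdvRegion ε δ) := by
    refine ⟨?_, isOpen_kdvRegion.preimage hγ⟩
    have : γ ⁻¹' kdvRegion ε δ
        = {t | (γ t).1 ^ 2 ≤ ε * (ε - |δ|)} ∩ {t | (γ t).2 ^ 2 ≤ ε * (ε - |δ|)} := by
      ext s
      constructor
      · exact fun hs => ⟨hs.1.le, hs.2.1.le⟩
      · exact fun hs => mem_kdvRegion_of_le hε hs.1 hs.2 (by rw [hI s]; exact h0.2.2)
    rw [this]
    exact (isClosed_le (by fun_prop) continuous_const).inter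
      (isClosed_le (by fun_prop) continuous_const)
  exact (h.eq_univ ⟨0, h0⟩).symm.subset (mem_univ t)

/-- The flow of the invariant is complete in the region. -/
theorem exists_kdvOrbit (hε : 0 < ε) {z : ℝ × ℝ} (hz : z ∈ kdvRegion ε δ) :
    ∃ γ : ℝ → ℝ × ℝ, γ 0 = z ∧ (∀ t, HasDerivAt γ (kdvField ε δ (γ t)) t) ∧
      ∀ t, γ t ∈ kdvRegion ε δ := by
  obtain ⟨V, K, L, hV, hL, hVX, hVc⟩ := exists_cutoff_kdvField (δ := δ) hε
  obtain ⟨γ, h0, hγ⟩ := hV.exists_global_solution hL z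
  choose c hc using hVc
  have hcont : Continuous γ := continuous_iff_continuousAt.2 fun t => (hγ t).continuousAt
  have hI : ∀ t, kdvInvariant ε δ (γ t) = kdvInvariant ε δ (γ 0) := fun t =>
    kdvInvariant_comp_eq (k := fun t => c (γ t)) (fun t => by rw [← hc]; exact hγ t) t 0
  have hmem := mem_kdvRegion_of_continuous hε hcont hI (by rw [h0]; exact hz)
  exact ⟨γ, h0, fun t => by rw [← hVX _ (hmem t)]; exact hγ t, hmem⟩

theorem kdvOrbit_unique (hε : 0 < ε) {γ γ' : ℝ → ℝ × ℝ} {k : ℝ}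
    (hγ : ∀ t, HasDerivAt γ (k • kdvField ε δ (γ t)) t) (hγm : ∀ t, γ t ∈ kdvRegion ε δ)
    (hγ' : ∀ t, HasDerivAt γ' (k • kdvField ε δ (γ' t)) t) (hγm' : ∀ t, γ' t ∈ kdvRegion ε δ)
    {t₀ : ℝ} (h : γ t₀ = γ' t₀) : γ = γ' := by
  obtain ⟨V, K, L, hV, hL, hVX, -⟩ := exists_cutoff_kdvField (δ := δ) hε
  refine ODE_solution_unique_univ (v := fun _ z => k • V z) (s := fun _ => kdvRegion ε δ)
    (K := ‖k‖₊ * K) (t₀ := t₀) (fun t => ?_) (fun t => ⟨?_, hγm t⟩) (fun t => ⟨?_, hγm' t⟩) h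
  · refine LipschitzWith.lipschitzOnWith ?_
    exact (lipschitzWith_smul k).comp hV
  · rw [hVX _ (hγm t)]
    exact hγ t
  · rw [hVX _ (hγm' t)]
    exact hγ' t

/-- A curve in the region which is everywhere tangent to the Hamiltonian vector field of the
invariant is a reparametrised orbit. -/
theorem eq_kdvOrbit_comp (hε : 0 < ε) {γ c : ℝ → ℝ × ℝ} {T g : ℝ → ℝ}
    (hγ : ∀ t, HasDerivAt γ (kdvField ε δ (γ t)) t) (hγm : ∀ t, γ t ∈ kdvRegion ε δ)
    (hT : ∀ u ∈ Icc (0 : ℝ) 1, HasDerivWithinAt T (g u) (Icc 0 1) u)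
    (hg : ContinuousOn g (Icc 0 1))
    (hc : ∀ u ∈ Icc (0 : ℝ) 1, HasDerivAt c (g u • kdvField ε δ (c u)) u)
    (hcm : ∀ u ∈ Icc (0 : ℝ) 1, c u ∈ kdvRegion ε δ) (h0 : c 0 = γ (T 0)) :
    ∀ u ∈ Icc (0 : ℝ) 1, c u = γ (T u) := by
  obtain ⟨V, K, L, hV, hL, hVX, -⟩ := exists_cutoff_kdvField (δ := δ) hε
  obtain ⟨M, hM⟩ := isCompact_Icc.exists_bound_of_continuousOn hg
  have hM0 : 0 ≤ M := (norm_nonneg _).trans (hM 0 (by simp))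
  have hd : ∀ u ∈ Icc (0 : ℝ) 1,
      HasDerivWithinAt (γ ∘ T) (g u • kdvField ε δ (γ (T u))) (Icc 0 1) u := fun u hu =>
    (hγ (T u)).scomp_hasDerivWithinAt u (hT u hu)
  refine ODE_solution_unique_of_mem_Icc_right (v := fun u z => g u • V z)
    (s := fun _ => kdvRegion ε δ) (K := M.toNNReal * K) (fun u hu => ?_)
    (fun u hu => (hc u hu).continuousAt.continuousWithinAt) (fun u hu => ?_)
    (fun u hu => hcm u (Ico_subset_Icc_self hu)) (fun u hu => (hd u hu).continuousWithinAt)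
    (fun u hu => ?_) (fun u _ => hγm _) h0
  · refine LipschitzWith.lipschitzOnWith ?_
    refine ((lipschitzWith_smul (g u)).comp hV).weaken ?_
    gcongr
    rw [← NNReal.coe_le_coe, coe_nnnorm, Real.coe_toNNReal _ hM0]
    exact hM u (Ico_subset_Icc_self hu)
  · rw [hVX _ (hcm u (Ico_subset_Icc_self hu))]
    exact (hc u (Ico_subset_Icc_self hu)).hasDerivWithinAt
  · rw [hVX _ (hγm _)]
    exact (hd u (Ico_subset_Icc_self hu)).mono_of_mem_nhdsWithin
      (Icc_mem_nhdsGE_of_mem hu)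

/-- The derivative of the map carries the Hamiltonian vector field of the invariant to itself, so
that the map carries orbits to orbits. -/
theorem hasDerivAt_kdvMap_comp (hε : 0 < ε) (hδ : 2 * δ ^ 2 < ε ^ 2) {γ : ℝ → ℝ × ℝ} {t : ℝ}
    (hγ : HasDerivAt γ (kdvField ε δ (γ t)) t) (hm : γ t ∈ kdvRegion ε δ) :
    HasDerivAt (fun s => kdvMap ε δ (γ s)) (kdvField ε δ (kdvMap ε δ (γ t))) t := by
  have hdom := kdvRegion_subset_kdvDomain hε hδ hm
  obtain ⟨A, hA, hA'⟩ := hasFDerivAt_kdvMap hdom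
  refine (hA.comp_hasDerivAt t hγ).congr_deriv ?_
  have h1 := hdom.1
  have h2 := hdom.2
  set z := γ t
  have e2 : (A (kdvField ε δ z)).2 = (kdvField ε δ (kdvMap ε δ z)).2 := by
    rw [(hA' _).1]
    have h3 : (kdvMap ε δ z).1 * (ε ^ 2 - (kdvMap ε δ z).2 ^ 2)
        = z.1 * (ε ^ 2 - (kdvMap ε δ z).2 ^ 2) - 2 * ε * δ * (kdvMap ε δ z).2 := by
      rw [kdvMap_fst]
      field_simp
    have h4 : (kdvField ε δ (kdvMap ε δ z)).2
        = 2 * ((kdvMap ε δ z).1 * (ε ^ 2 - (kdvMap ε δ z).2 ^ 2))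
          + 2 * ε * δ * (kdvMap ε δ z).2 := by
      simp only [kdvField]
      ring
    rw [h4, h3]
    simp only [kdvField, kdvMap_snd]
    field_simp
    ring
  ext
  · rw [(hA' _).2, e2]
    have h5 : (kdvMap ε δ z).2 * (ε ^ 2 - z.1 ^ 2)
        = z.2 * (ε ^ 2 - z.1 ^ 2) + 2 * ε * δ * z.1 := by
      rw [kdvMap_snd]
      field_simp
    have h6 : (kdvField ε δ z).1
        = -2 * ((kdvMap ε δ z).2 * (ε ^ 2 - z.1 ^ 2)) + 2 * ε * δ * z.1 := by
      rw [h5]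
      simp only [kdvField]
      ring
    rw [h6]
    simp only [kdvField]
    rw [kdvMap_fst]
    field_simp
    ring
  · exact e2

end Flow

noncomputable section

/-! ### The closed form of the modified Hamiltonian -/

/-- The endpoint `q̄_P` in units of `√(-P)`. -/
def scaledEndpoint (ε δ P : ℝ) : ℝ := 2 * ε ^ 2 * δ / (ε ^ 4 + P)

/-- The quartic `D_P` in the rescaled variable `y = x / √(-P)`, divided by `-P`. It is regular at
`P = 0`. -/
def scaledQuartic (ε δ P y : ℝ) : ℝ :=
  ε ^ 2 + y ^ 2 * (δ ^ 2 * ε ^ 2 + P - ε ^ 4) - ε ^ 2 * P * y ^ 4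

/-- The branch `p(x, P)` of the level curve in the rescaled variable `y = x / √(-P)`, divided by
`-√(-P)`. -/
def scaledBranch (ε δ P y : ℝ) : ℝ :=
  (ε * δ * y + √(scaledQuartic ε δ P y)) / (ε ^ 2 + P * y ^ 2)

/-- The partial derivative of `scaledBranch` with respect to `P`. -/
def scaledBranchP (ε δ P y : ℝ) : ℝ :=
  (y ^ 2 - ε ^ 2 * y ^ 4) / (2 * √(scaledQuartic ε δ P y)) / (ε ^ 2 + P * y ^ 2)
    - (ε * δ * y + √(scaledQuartic ε δ P y)) * y ^ 2 / (ε ^ 2 + P * y ^ 2) ^ 2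

/-- The partial derivative of `scaledBranch` with respect to `y`. -/
def scaledBranchY (ε δ P y : ℝ) : ℝ :=
  (ε * δ + (2 * y * (δ ^ 2 * ε ^ 2 + P - ε ^ 4) - 4 * ε ^ 2 * P * y ^ 3)
      / (2 * √(scaledQuartic ε δ P y))) / (ε ^ 2 + P * y ^ 2)
    - (ε * δ * y + √(scaledQuartic ε δ P y)) * (2 * P * y) / (ε ^ 2 + P * y ^ 2) ^ 2

/-- The frequency `ν(P)` in rescaled variables. -/
def scaledFrequency (ε δ P : ℝ) : ℝ :=
  ∫ u in (0 : ℝ)..1,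
    scaledEndpoint ε δ P / (2 * √(scaledQuartic ε δ P (scaledEndpoint ε δ P * u)))

/-- The modified Hamiltonian divided by `δ`, with the outer one of the two integrations carried out.
Up to elementary terms, `δ` times this function is the action integral `∫ p dq` along the arc of
the level curve from `q = 0` to `q = q̄_P`, reduced by the generating function of the step; it is
analytic in `δ` and `P`, also at `δ = 0` and at `P = 0`. -/
def kdvEta (ε δ P : ℝ) : ℝ :=
  ε * Real.log (ε ^ 4 + P) - 2 * ε * P / (ε ^ 4 + P)
    + ∫ u in (0 : ℝ)..1, P * (2 * ε ^ 2 / (ε ^ 4 + P))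
        * scaledBranch ε δ P (scaledEndpoint ε δ P * u)

/-- The range of parameters that belongs to the part `P_* < P ≤ 0` of the levels. -/
def KdvAdmissible (ε δ P : ℝ) : Prop :=
  -ε ^ 4 < P ∧ P ≤ 0 ∧ 2 * ε ^ 2 * δ ^ 2 * (ε ^ 4 - P) < (ε ^ 4 + P) ^ 2

end

section ClosedForm

variable {ε δ P : ℝ}

theorem KdvAdmissible.pos (h : KdvAdmissible ε δ P) : 0 < ε ^ 4 + P := by linarith [h.1]

theorem kdvAdmissible_of_mem (hε : 0 < ε) (hδ : 2 * δ ^ 2 < ε ^ 2)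
    (hP : P ∈ Ioc (kdvThreshold ε δ) 0) : KdvAdmissible ε δ P :=
  ⟨(neg_pow_four_le_kdvThreshold hε hδ).trans_lt hP.1, hP.2, lt_sq_of_kdvThreshold_lt hε hP.1⟩

theorem KdvAdmissible.sub_pos (hε : 0 < ε) (h : KdvAdmissible ε δ P) :
    0 < (ε ^ 2 + P * scaledEndpoint ε δ P ^ 2) / ε - ε * δ * scaledEndpoint ε δ P := by
  have hS := h.pos
  have : (ε ^ 2 + P * scaledEndpoint ε δ P ^ 2) / ε - ε * δ * scaledEndpoint ε δ P
      = ε * ((ε ^ 4 + P) ^ 2 - 2 * ε ^ 2 * δ ^ 2 * (ε ^ 4 - P)) / (ε ^ 4 + P) ^ 2 := by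
    unfold scaledEndpoint
    field_simp
    ring
  rw [this]
  have := h.2.2
  have : 0 < (ε ^ 4 + P) ^ 2 - 2 * ε ^ 2 * δ ^ 2 * (ε ^ 4 - P) := by linarith
  positivity

theorem scaledQuartic_scaledEndpoint (hε : 0 < ε) (hS : 0 < ε ^ 4 + P) :
    scaledQuartic ε δ P (scaledEndpoint ε δ P)
      = ((ε ^ 2 + P * scaledEndpoint ε δ P ^ 2) / ε - ε * δ * scaledEndpoint ε δ P) ^ 2 := by
  unfold scaledQuartic scaledEndpoint
  field_simp
  ring

theorem sq_mul_le {y u : ℝ} (hu : u ∈ Icc (0 : ℝ) 1) : (y * u) ^ 2 ≤ y ^ 2 := by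
  rw [mul_pow]
  have : u ^ 2 ≤ 1 := pow_le_one₀ hu.1 hu.2
  nlinarith [sq_nonneg y]

theorem KdvAdmissible.denominator_pos (hε : 0 < ε) (h : KdvAdmissible ε δ P) {u : ℝ}
    (hu : u ∈ Icc (0 : ℝ) 1) : 0 < ε ^ 2 + P * (scaledEndpoint ε δ P * u) ^ 2 := by
  have h1 := h.sub_pos hε
  have hS := h.pos
  have h2 : 0 ≤ ε * δ * scaledEndpoint ε δ P := by
    have : ε * δ * scaledEndpoint ε δ P = 2 * ε ^ 3 * δ ^ 2 / (ε ^ 4 + P) := by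
      unfold scaledEndpoint
      ring
    rw [this]
    positivity
  have h3 : 0 < (ε ^ 2 + P * scaledEndpoint ε δ P ^ 2) / ε := by linarith
  have h4 : 0 < ε ^ 2 + P * scaledEndpoint ε δ P ^ 2 := by
    rwa [div_pos_iff_of_pos_right hε] at h3
  have := sq_mul_le (y := scaledEndpoint ε δ P) hu
  nlinarith [h.2.1]

/-- The radicand is positive on the whole arc. It is a perfect square at the endpoint, and a
decreasing function of `y²` up to there. -/
theorem KdvAdmissible.scaledQuartic_pos (hε : 0 < ε) (h : KdvAdmissible ε δ P) {u : ℝ}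
    (hu : u ∈ Icc (0 : ℝ) 1) : 0 < scaledQuartic ε δ P (scaledEndpoint ε δ P * u) := by
  have hS := h.pos
  have h1 : 0 < scaledQuartic ε δ P (scaledEndpoint ε δ P) := by
    rw [scaledQuartic_scaledEndpoint hε hS]
    exact pow_pos (h.sub_pos hε) 2
  refine h1.trans_le ?_
  have h2 := sq_mul_le (y := scaledEndpoint ε δ P) hu
  set Y := scaledEndpoint ε δ P ^ 2 with hY
  set X := (scaledEndpoint ε δ P * u) ^ 2 with hX
  have hP := h.2.1
  have hA := h.2.2
  have hX0 : 0 ≤ X := sq_nonneg _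
  have e1 : scaledQuartic ε δ P (scaledEndpoint ε δ P * u)
      - scaledQuartic ε δ P (scaledEndpoint ε δ P)
      = (Y - X) * ((ε ^ 4 - P - δ ^ 2 * ε ^ 2) + ε ^ 2 * P * (X + Y)) := by
    simp only [scaledQuartic, hX, hY]
    ring
  have hYe : Y * (ε ^ 4 + P) ^ 2 = 4 * ε ^ 4 * δ ^ 2 := by
    simp only [hY, scaledEndpoint]
    field_simp
    ring
  have hM : 0 < ε ^ 4 - P := by
    have : 0 < ε ^ 4 := by positivity
    linarith
  have h3 : Y * (ε ^ 4 - P) ≤ 2 * ε ^ 2 := by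
    have : Y * (ε ^ 4 - P) * (ε ^ 4 + P) ^ 2 ≤ 2 * ε ^ 2 * (ε ^ 4 + P) ^ 2 := by
      have e : Y * (ε ^ 4 - P) * (ε ^ 4 + P) ^ 2
        = 2 * ε ^ 2 * (2 * ε ^ 2 * δ ^ 2 * (ε ^ 4 - P)) := by
        linear_combination (ε ^ 4 - P) * hYe
      rw [e]
      gcongr
    exact le_of_mul_le_mul_right this (by positivity)
  have h4 : 0 ≤ (ε ^ 4 - P - δ ^ 2 * ε ^ 2) + 2 * ε ^ 2 * P * Y := by
    have : 0 ≤ ((ε ^ 4 - P - δ ^ 2 * ε ^ 2) + 2 * ε ^ 2 * P * Y) * (ε ^ 4 - P) := by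
      have h5 : 2 * ε ^ 2 * -P * (Y * (ε ^ 4 - P)) ≤ 2 * ε ^ 2 * -P * (2 * ε ^ 2) := by
        have : 0 ≤ -P := by linarith
        gcongr
      nlinarith [sq_nonneg (ε ^ 4 + P)]
    exact nonneg_of_mul_nonneg_left this hM
  have h5 : ε ^ 2 * P * (2 * Y) ≤ ε ^ 2 * P * (X + Y) := by
    have : ε ^ 2 * P ≤ 0 := mul_nonpos_of_nonneg_of_nonpos (by positivity) hP
    exact mul_le_mul_of_nonpos_left (by linarith) this
  have h6 : 0 ≤ (Y - X) * ((ε ^ 4 - P - δ ^ 2 * ε ^ 2) + ε ^ 2 * P * (X + Y)) :=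
    mul_nonneg (by linarith) (by linarith)
  linarith

theorem KdvAdmissible.scaledBranch_scaledEndpoint (hε : 0 < ε) (h : KdvAdmissible ε δ P) :
    scaledBranch ε δ P (scaledEndpoint ε δ P) = 1 / ε := by
  have hN := h.denominator_pos hε (u := 1) (by simp)
  rw [mul_one] at hN
  rw [scaledBranch, scaledQuartic_scaledEndpoint hε h.pos, Real.sqrt_sq (h.sub_pos hε).le,
    add_sub_cancel, div_right_comm, div_self hN.ne']

theorem hasDerivAt_scaledQuartic {d p y : ℝ → ℝ} {d' p' y' t : ℝ} (hd : HasDerivAt d d' t)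
    (hp : HasDerivAt p p' t) (hy : HasDerivAt y y' t) :
    HasDerivAt (fun t => scaledQuartic ε (d t) (p t) (y t))
      (d' * (2 * d t * ε ^ 2 * y t ^ 2) + p' * (y t ^ 2 - ε ^ 2 * y t ^ 4)
        + y' * (2 * y t * (d t ^ 2 * ε ^ 2 + p t - ε ^ 4) - 4 * ε ^ 2 * p t * y t ^ 3)) t := by
  have h1 := (((hy.pow 2).mul ((((hd.pow 2).mul_const (ε ^ 2)).add hp).sub_const (ε ^ 4))).const_add
    (ε ^ 2)).sub ((hp.const_mul (ε ^ 2)).mul (hy.pow 4))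
  refine h1.congr_deriv ?_
  simp
  ring

theorem hasDerivAt_scaledBranch {d p y : ℝ → ℝ} {d' p' y' t : ℝ} (hd : HasDerivAt d d' t)
    (hp : HasDerivAt p p' t) (hy : HasDerivAt y y' t)
    (hq : 0 < scaledQuartic ε (d t) (p t) (y t)) (hN : ε ^ 2 + p t * y t ^ 2 ≠ 0) :
    HasDerivAt (fun t => scaledBranch ε (d t) (p t) (y t))
      (d' * (ε * y t * scaledBranch ε (d t) (p t) (y t) / √(scaledQuartic ε (d t) (p t) (y t)))
        + p' * scaledBranchP ε (d t) (p t) (y t) + y' * scaledBranchY ε (d t) (p t) (y t)) t := by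
  have h1 := (((hd.const_mul ε).mul hy).add ((hasDerivAt_scaledQuartic (ε := ε) hd hp hy).sqrt hq.ne')).div
    ((hp.mul (hy.pow 2)).const_add (ε ^ 2)) hN
  refine h1.congr_deriv ?_
  have hs : √(scaledQuartic ε (d t) (p t) (y t)) ≠ 0 := (Real.sqrt_pos.2 hq).ne'
  simp only [scaledBranch, scaledBranchP, scaledBranchY, Pi.add_apply, Pi.mul_apply, Pi.pow_apply]
  set s := √(scaledQuartic ε (d t) (p t) (y t))
  field_simp
  ring

/-- The infinitesimal form of the homogeneity that relates the rescaled branch to the branch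
`p(x, P)`, together with `∂p/∂P = 1 / (2 √D_P)`. -/
theorem scaledBranch_homogeneity {y : ℝ} (hq : 0 < scaledQuartic ε δ P y)
    (hN : ε ^ 2 + P * y ^ 2 ≠ 0) :
    scaledBranch ε δ P y / 2 + P * scaledBranchP ε δ P y - y * scaledBranchY ε δ P y / 2
      = 1 / (2 * √(scaledQuartic ε δ P y)) := by
  have hs : √(scaledQuartic ε δ P y) ≠ 0 := (Real.sqrt_pos.2 hq).ne'
  have hs2 : √(scaledQuartic ε δ P y) ^ 2 = scaledQuartic ε δ P y := Real.sq_sqrt hq.le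
  simp only [scaledBranch, scaledBranchP, scaledBranchY]
  set s := √(scaledQuartic ε δ P y)
  set N := ε ^ 2 + P * y ^ 2 with hNdef
  set Dy := 2 * y * (δ ^ 2 * ε ^ 2 + P - ε ^ 4) - 4 * ε ^ 2 * P * y ^ 3 with hDy
  set DP := y ^ 2 - ε ^ 2 * y ^ 4 with hDP
  have h1 : 2 * s ^ 2 + 2 * P * DP - y * Dy = 2 * N := by
    rw [hs2, hDP, hDy, hNdef, scaledQuartic]
    ring
  have h2 : (ε * δ * y + s) / N / 2
      + P * (DP / (2 * s) / N - (ε * δ * y + s) * y ^ 2 / N ^ 2)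
      - y * ((ε * δ + Dy / (2 * s)) / N - (ε * δ * y + s) * (2 * P * y) / N ^ 2) / 2
      = (2 * s ^ 2 + 2 * P * DP - y * Dy) / (4 * s * N) := by
    field_simp
    ring
  rw [h2, h1]
  field_simp
  norm_num

theorem hasDerivAt_scaledEndpoint (hS : ε ^ 4 + P ≠ 0) :
    HasDerivAt (fun P => scaledEndpoint ε δ P) (-scaledEndpoint ε δ P / (ε ^ 4 + P)) P := by
  have := ((hasDerivAt_id P).const_add (ε ^ 4)).inv hS
  refine (this.const_mul (2 * ε ^ 2 * δ)).congr_deriv ?_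
  simp only [scaledEndpoint]
  simp
  field_simp

theorem KdvAdmissible.sqrt_pos (hε : 0 < ε) (h : KdvAdmissible ε δ P) {u : ℝ}
    (hu : u ∈ Icc (0 : ℝ) 1) : 0 < √(scaledQuartic ε δ P (scaledEndpoint ε δ P * u)) :=
  Real.sqrt_pos.2 (h.scaledQuartic_pos hε hu)

theorem analyticAt_scaledEndpoint {x : ℝ × ℝ} (hS : ε ^ 4 + x.2 ≠ 0) :
    AnalyticAt ℝ (fun x : ℝ × ℝ => scaledEndpoint ε x.1 x.2) x := by
  unfold scaledEndpoint
  exact (analyticAt_const.mul analyticAt_fst).div (analyticAt_const.add analyticAt_snd) hS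

theorem analyticAt_sqrt {x : ℝ} (hx : x ≠ 0) : AnalyticAt ℝ Real.sqrt x :=
  (Real.contDiffAt_sqrt (n := ⊤) hx).analyticAt

/-- Analyticity of the rescaled radicand along the arc in all variables `((δ, P), u)`. -/
theorem analyticAt_scaledQuartic_comp {x : ℝ × ℝ} {u : ℝ} (hS : ε ^ 4 + x.2 ≠ 0) :
    AnalyticAt ℝ (fun y : (ℝ × ℝ) × ℝ =>
      scaledQuartic ε y.1.1 y.1.2 (scaledEndpoint ε y.1.1 y.1.2 * y.2)) (x, u) := by
  have hδ : AnalyticAt ℝ (fun y : (ℝ × ℝ) × ℝ => y.1.1) (x, u) :=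
    analyticAt_fst.comp (f := fun y : (ℝ × ℝ) × ℝ => y.1) analyticAt_fst
  have hP : AnalyticAt ℝ (fun y : (ℝ × ℝ) × ℝ => y.1.2) (x, u) :=
    analyticAt_snd.comp (f := fun y : (ℝ × ℝ) × ℝ => y.1) analyticAt_fst
  have hy : AnalyticAt ℝ (fun y : (ℝ × ℝ) × ℝ => scaledEndpoint ε y.1.1 y.1.2 * y.2) (x, u) :=
    ((analyticAt_scaledEndpoint hS).comp (f := fun y : (ℝ × ℝ) × ℝ => y.1)
      (x := (x, u)) analyticAt_fst).mul analyticAt_snd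
  unfold scaledQuartic
  exact (analyticAt_const.add ((hy.pow 2).mul
    ((((hδ.pow 2).mul analyticAt_const).add hP).sub analyticAt_const))).sub
    ((analyticAt_const.mul hP).mul (hy.pow 4))

theorem analyticAt_denominator_comp {x : ℝ × ℝ} {u : ℝ} (hS : ε ^ 4 + x.2 ≠ 0) :
    AnalyticAt ℝ (fun y : (ℝ × ℝ) × ℝ =>
      ε ^ 2 + y.1.2 * (scaledEndpoint ε y.1.1 y.1.2 * y.2) ^ 2) (x, u) := by
  have hP : AnalyticAt ℝ (fun y : (ℝ × ℝ) × ℝ => y.1.2) (x, u) :=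
    analyticAt_snd.comp (f := fun y : (ℝ × ℝ) × ℝ => y.1) analyticAt_fst
  have hy : AnalyticAt ℝ (fun y : (ℝ × ℝ) × ℝ => scaledEndpoint ε y.1.1 y.1.2 * y.2) (x, u) :=
    ((analyticAt_scaledEndpoint hS).comp (f := fun y : (ℝ × ℝ) × ℝ => y.1)
      (x := (x, u)) analyticAt_fst).mul analyticAt_snd
  exact analyticAt_const.add (hP.mul (hy.pow 2))

theorem analyticAt_scaledBranch_comp {x : ℝ × ℝ} {u : ℝ} (hS : ε ^ 4 + x.2 ≠ 0)
    (hq : 0 < scaledQuartic ε x.1 x.2 (scaledEndpoint ε x.1 x.2 * u))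
    (hN : ε ^ 2 + x.2 * (scaledEndpoint ε x.1 x.2 * u) ^ 2 ≠ 0) :
    AnalyticAt ℝ (fun y : (ℝ × ℝ) × ℝ =>
      scaledBranch ε y.1.1 y.1.2 (scaledEndpoint ε y.1.1 y.1.2 * y.2)) (x, u) := by
  have hδ : AnalyticAt ℝ (fun y : (ℝ × ℝ) × ℝ => y.1.1) (x, u) :=
    analyticAt_fst.comp (f := fun y : (ℝ × ℝ) × ℝ => y.1) analyticAt_fst
  have hy : AnalyticAt ℝ (fun y : (ℝ × ℝ) × ℝ => scaledEndpoint ε y.1.1 y.1.2 * y.2) (x, u) :=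
    ((analyticAt_scaledEndpoint hS).comp (f := fun y : (ℝ × ℝ) × ℝ => y.1)
      (x := (x, u)) analyticAt_fst).mul analyticAt_snd
  unfold scaledBranch
  exact (((analyticAt_const.mul hδ).mul hy).add (AnalyticAt.fun_comp (analyticAt_sqrt hq.ne')
    (analyticAt_scaledQuartic_comp hS))).div (analyticAt_denominator_comp hS) hN

/-- The closed form is analytic in the step size and the value of the invariant. -/
theorem analyticAt_kdvEta (hε : 0 < ε) (h : KdvAdmissible ε δ P) :
    AnalyticAt ℝ (fun x : ℝ × ℝ => kdvEta ε x.1 x.2) (δ, P) := by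
  have hS : AnalyticAt ℝ (fun x : ℝ × ℝ => ε ^ 4 + x.2) (δ, P) :=
    analyticAt_const.add analyticAt_snd
  have hS' : ε ^ 4 + P ≠ 0 := h.pos.ne'
  have hlog : AnalyticAt ℝ (fun x : ℝ × ℝ => Real.log (ε ^ 4 + x.2)) (δ, P) :=
    AnalyticAt.fun_comp_of_eq (analyticAt_log h.pos) hS rfl
  unfold kdvEta
  refine ((analyticAt_const.mul hlog).sub
    ((analyticAt_const.mul analyticAt_snd).div hS hS')).add ?_
  refine AnalyticAt.intervalIntegral_param (F := fun y : (ℝ × ℝ) × ℝ =>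
    y.1.2 * (2 * ε ^ 2 / (ε ^ 4 + y.1.2))
      * scaledBranch ε y.1.1 y.1.2 (scaledEndpoint ε y.1.1 y.1.2 * y.2)) fun u hu => ?_
  have hP : AnalyticAt ℝ (fun y : (ℝ × ℝ) × ℝ => y.1.2) ((δ, P), u) :=
    analyticAt_snd.comp (f := fun y : (ℝ × ℝ) × ℝ => y.1) analyticAt_fst
  exact (hP.mul (analyticAt_const.div (analyticAt_const.add hP) hS')).mul
    (analyticAt_scaledBranch_comp hS' (h.scaledQuartic_pos hε hu) (h.denominator_pos hε hu).ne')

end ClosedForm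

/-! ### The derivatives of the closed form -/

section ClosedFormDerivative

variable {ε δ P : ℝ}

/-- Positivity of the radicand and of the denominator along the arc persists for nearby
parameters. -/
theorem KdvAdmissible.eventually_pos (hε : 0 < ε) (h : KdvAdmissible ε δ P) {u : ℝ}
    (hu : u ∈ Icc (0 : ℝ) 1) : ∀ᶠ y : (ℝ × ℝ) × ℝ in 𝓝 ((δ, P), u), 0 < ε ^ 4 + y.1.2 ∧
      0 < scaledQuartic ε y.1.1 y.1.2 (scaledEndpoint ε y.1.1 y.1.2 * y.2) ∧
      0 < ε ^ 2 + y.1.2 * (scaledEndpoint ε y.1.1 y.1.2 * y.2) ^ 2 := by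
  have hS : ε ^ 4 + (δ, P).2 ≠ 0 := h.pos.ne'
  have h1 : ContinuousAt (fun y : (ℝ × ℝ) × ℝ => ε ^ 4 + y.1.2) ((δ, P), u) := by fun_prop
  exact (continuousAt_const.eventually_lt h1 h.pos).and
    ((continuousAt_const.eventually_lt (analyticAt_scaledQuartic_comp hS).continuousAt
      (h.scaledQuartic_pos hε hu)).and
    (continuousAt_const.eventually_lt (analyticAt_denominator_comp hS).continuousAt
      (h.denominator_pos hε hu)))

theorem continuousAt_scaledEndpoint_comp {y : (ℝ × ℝ) × ℝ} (hS : ε ^ 4 + y.1.2 ≠ 0) :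
    ContinuousAt (fun y : (ℝ × ℝ) × ℝ => scaledEndpoint ε y.1.1 y.1.2 * y.2) y :=
  ((analyticAt_scaledEndpoint hS).continuousAt.comp (f := fun y : (ℝ × ℝ) × ℝ => y.1)
      continuousAt_fst).mul continuousAt_snd

theorem continuousAt_sqrt_comp {y : (ℝ × ℝ) × ℝ} (hS : ε ^ 4 + y.1.2 ≠ 0) :
    ContinuousAt (fun y : (ℝ × ℝ) × ℝ =>
      √(scaledQuartic ε y.1.1 y.1.2 (scaledEndpoint ε y.1.1 y.1.2 * y.2))) y :=
  (analyticAt_scaledQuartic_comp (u := y.2) hS).continuousAt.sqrt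

theorem continuousAt_scaledBranch_comp {y : (ℝ × ℝ) × ℝ} (hS : ε ^ 4 + y.1.2 ≠ 0)
    (hN : ε ^ 2 + y.1.2 * (scaledEndpoint ε y.1.1 y.1.2 * y.2) ^ 2 ≠ 0) :
    ContinuousAt (fun y : (ℝ × ℝ) × ℝ =>
      scaledBranch ε y.1.1 y.1.2 (scaledEndpoint ε y.1.1 y.1.2 * y.2)) y := by
  have h1 := continuousAt_scaledEndpoint_comp hS
  have h2 := continuousAt_sqrt_comp hS
  unfold scaledBranch
  refine ContinuousAt.div ?_ ?_ hN <;> fun_prop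

theorem continuousAt_scaledBranchP_comp {y : (ℝ × ℝ) × ℝ} (hS : ε ^ 4 + y.1.2 ≠ 0)
    (hq : 0 < scaledQuartic ε y.1.1 y.1.2 (scaledEndpoint ε y.1.1 y.1.2 * y.2))
    (hN : ε ^ 2 + y.1.2 * (scaledEndpoint ε y.1.1 y.1.2 * y.2) ^ 2 ≠ 0) :
    ContinuousAt (fun y : (ℝ × ℝ) × ℝ =>
      scaledBranchP ε y.1.1 y.1.2 (scaledEndpoint ε y.1.1 y.1.2 * y.2)) y := by
  have h1 := continuousAt_scaledEndpoint_comp hS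
  have h2 := continuousAt_sqrt_comp hS
  have hs := (Real.sqrt_pos.2 hq).ne'
  unfold scaledBranchP
  refine ContinuousAt.sub (ContinuousAt.div (ContinuousAt.div ?_ ?_ (by simpa using hs)) ?_ hN)
    (ContinuousAt.div ?_ ?_ (pow_ne_zero 2 hN)) <;> fun_prop

theorem continuousAt_scaledBranchY_comp {y : (ℝ × ℝ) × ℝ} (hS : ε ^ 4 + y.1.2 ≠ 0)
    (hq : 0 < scaledQuartic ε y.1.1 y.1.2 (scaledEndpoint ε y.1.1 y.1.2 * y.2))
    (hN : ε ^ 2 + y.1.2 * (scaledEndpoint ε y.1.1 y.1.2 * y.2) ^ 2 ≠ 0) :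
    ContinuousAt (fun y : (ℝ × ℝ) × ℝ =>
      scaledBranchY ε y.1.1 y.1.2 (scaledEndpoint ε y.1.1 y.1.2 * y.2)) y := by
  have h1 := continuousAt_scaledEndpoint_comp hS
  have h2 := continuousAt_sqrt_comp hS
  have hs := (Real.sqrt_pos.2 hq).ne'
  unfold scaledBranchY
  refine ContinuousAt.sub (ContinuousAt.div (ContinuousAt.add ?_ (ContinuousAt.div ?_ ?_
    (by simpa using hs))) ?_ hN) (ContinuousAt.div ?_ ?_ (pow_ne_zero 2 hN)) <;> fun_prop

/-- Along the arc, the branch is differentiable in the parameter `u` of the arc. -/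
theorem KdvAdmissible.hasDerivAt_scaledBranch_comp (hε : 0 < ε) (h : KdvAdmissible ε δ P) {u : ℝ}
    (hu : u ∈ Icc (0 : ℝ) 1) :
    HasDerivAt (fun u => scaledBranch ε δ P (scaledEndpoint ε δ P * u))
      (scaledEndpoint ε δ P * scaledBranchY ε δ P (scaledEndpoint ε δ P * u)) u := by
  have hy : HasDerivAt (fun u => scaledEndpoint ε δ P * u) (scaledEndpoint ε δ P) u := by
    simpa using (hasDerivAt_id u).const_mul (scaledEndpoint ε δ P)
  refine (hasDerivAt_scaledBranch (hasDerivAt_const u δ) (hasDerivAt_const u P) hy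
    (h.scaledQuartic_pos hε hu) (h.denominator_pos hε hu).ne').congr_deriv ?_
  ring

theorem KdvAdmissible.continuousOn_sqrt (h : KdvAdmissible ε δ P) :
    ContinuousOn (fun u => √(scaledQuartic ε δ P (scaledEndpoint ε δ P * u))) (Icc 0 1) :=
  fun u _ => ((continuousAt_sqrt_comp (y := ((δ, P), u)) h.pos.ne').comp
    (f := fun u : ℝ => ((δ, P), u)) (by fun_prop)).continuousWithinAt

theorem KdvAdmissible.continuousOn_scaledBranch (hε : 0 < ε) (h : KdvAdmissible ε δ P) :
    ContinuousOn (fun u => scaledBranch ε δ P (scaledEndpoint ε δ P * u)) (Icc 0 1) :=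
  fun _ hu => (h.hasDerivAt_scaledBranch_comp hε hu).continuousAt.continuousWithinAt

theorem KdvAdmissible.continuousOn_scaledBranchY (hε : 0 < ε) (h : KdvAdmissible ε δ P) :
    ContinuousOn (fun u => scaledBranchY ε δ P (scaledEndpoint ε δ P * u)) (Icc 0 1) :=
  fun u hu => ((continuousAt_scaledBranchY_comp (y := ((δ, P), u)) h.pos.ne'
    (h.scaledQuartic_pos hε hu) (h.denominator_pos hε hu).ne').comp
    (f := fun u : ℝ => ((δ, P), u)) (by fun_prop)).continuousWithinAt

/-- Integration by parts along the arc: the total derivative of `u p` contributes only the value of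
the branch at the endpoint. -/
theorem KdvAdmissible.integral_scaledBranch_add (hε : 0 < ε) (h : KdvAdmissible ε δ P) :
    ∫ u in (0 : ℝ)..1, (scaledBranch ε δ P (scaledEndpoint ε δ P * u)
      + scaledEndpoint ε δ P * u * scaledBranchY ε δ P (scaledEndpoint ε δ P * u)) = 1 / ε := by
  have h1 : ∀ u ∈ uIcc (0 : ℝ) 1,
      HasDerivAt (fun u => u * scaledBranch ε δ P (scaledEndpoint ε δ P * u))
        (scaledBranch ε δ P (scaledEndpoint ε δ P * u)
          + scaledEndpoint ε δ P * u * scaledBranchY ε δ P (scaledEndpoint ε δ P * u)) u := by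
    intro u hu
    rw [uIcc_of_le zero_le_one] at hu
    refine ((hasDerivAt_id u).mul (h.hasDerivAt_scaledBranch_comp hε hu)).congr_deriv ?_
    simp
    ring
  rw [intervalIntegral.integral_eq_sub_of_hasDerivAt h1]
  · simp [h.scaledBranch_scaledEndpoint hε]
  · refine ContinuousOn.intervalIntegrable ?_
    rw [uIcc_of_le zero_le_one]
    have h2 := h.continuousOn_scaledBranch hε
    have h3 := h.continuousOn_scaledBranchY hε
    fun_prop

/-- The derivative of the closed form with respect to the value of the invariant is the
frequency. -/
theorem KdvAdmissible.hasDerivAt_kdvEta (hε : 0 < ε) (h : KdvAdmissible ε δ P) :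
    HasDerivAt (fun P => δ * kdvEta ε δ P) (scaledFrequency ε δ P) P := by
  have hS : ε ^ 4 + P ≠ 0 := h.pos.ne'
  set e := scaledEndpoint ε δ P with he
  set F' : ℝ → ℝ → ℝ := fun P u =>
    2 * ε ^ 6 / (ε ^ 4 + P) ^ 2 * scaledBranch ε δ P (scaledEndpoint ε δ P * u)
      + P * (2 * ε ^ 2 / (ε ^ 4 + P)) * (scaledBranchP ε δ P (scaledEndpoint ε δ P * u)
        + -scaledEndpoint ε δ P / (ε ^ 4 + P) * u
          * scaledBranchY ε δ P (scaledEndpoint ε δ P * u)) with hF'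
  have hder : HasDerivAt (fun P => ∫ u in (0 : ℝ)..1, P * (2 * ε ^ 2 / (ε ^ 4 + P))
        * scaledBranch ε δ P (scaledEndpoint ε δ P * u)) (∫ u in (0 : ℝ)..1, F' P u) P := by
    have hg : Continuous fun y : ℝ × ℝ => ((δ, y.1), y.2) := by fun_prop
    refine hasDerivAt_intervalIntegral_param (F := fun P u => P * (2 * ε ^ 2 / (ε ^ 4 + P))
        * scaledBranch ε δ P (scaledEndpoint ε δ P * u)) (fun u hu => ?_) (fun u hu => ?_)
    · filter_upwards [(hg.tendsto (P, u)).eventually (h.eventually_pos hε hu)] with y hy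
      obtain ⟨hS, hq, hN⟩ := hy
      constructor
      · have h1 : HasDerivAt (fun P => P * (2 * ε ^ 2 / (ε ^ 4 + P)))
            (2 * ε ^ 6 / (ε ^ 4 + y.1) ^ 2) y.1 := by
          have h2 := ((hasDerivAt_id y.1).const_add (ε ^ 4)).inv hS.ne'
          refine ((hasDerivAt_id y.1).mul (h2.const_mul (2 * ε ^ 2))).congr_deriv ?_
          simp
          field_simp
          ring
        refine (h1.mul (hasDerivAt_scaledBranch (hasDerivAt_const y.1 δ) (hasDerivAt_id y.1)
          ((hasDerivAt_scaledEndpoint hS.ne').mul_const y.2) hq hN.ne')).congr_deriv ?_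
        simp [hF']
      · have h3 := (continuousAt_scaledBranch_comp (y := ((δ, y.1), y.2)) hS.ne' hN.ne').comp
          (f := fun u : ℝ => ((δ, y.1), u)) (by fun_prop)
        exact continuousAt_const.mul h3
    · have hq := h.scaledQuartic_pos hε hu
      have hN := (h.denominator_pos hε hu).ne'
      have c0 : ContinuousAt (fun y : ℝ × ℝ => scaledEndpoint ε δ y.1) (P, u) :=
        ContinuousAt.comp (f := fun y : ℝ × ℝ => y.1) (x := (P, u))
          (hasDerivAt_scaledEndpoint (δ := δ) hS).continuousAt continuousAt_fst
      have c1 := (continuousAt_scaledBranch_comp (y := ((δ, P), u)) hS hN).comp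
        (f := fun y : ℝ × ℝ => ((δ, y.1), y.2)) (x := (P, u)) hg.continuousAt
      have c2 := (continuousAt_scaledBranchP_comp (y := ((δ, P), u)) hS hq hN).comp
        (f := fun y : ℝ × ℝ => ((δ, y.1), y.2)) (x := (P, u)) hg.continuousAt
      have c3 := (continuousAt_scaledBranchY_comp (y := ((δ, P), u)) hS hq hN).comp
        (f := fun y : ℝ × ℝ => ((δ, y.1), y.2)) (x := (P, u)) hg.continuousAt
      simp only [Function.comp_def] at c1 c2 c3
      have c4 : ContinuousAt (fun y : ℝ × ℝ => 2 * ε ^ 6 / (ε ^ 4 + y.1) ^ 2) (P, u) :=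
        ContinuousAt.div (by fun_prop) (by fun_prop) (pow_ne_zero 2 hS)
      have c5 : ContinuousAt (fun y : ℝ × ℝ => 2 * ε ^ 2 / (ε ^ 4 + y.1)) (P, u) :=
        ContinuousAt.div (by fun_prop) (by fun_prop) hS
      have c6 : ContinuousAt (fun y : ℝ × ℝ => -scaledEndpoint ε δ y.1 / (ε ^ 4 + y.1)) (P, u) :=
        ContinuousAt.div (by fun_prop) (by fun_prop) hS
      exact (c4.mul c1).add ((continuousAt_fst.mul c5).mul
        (c2.add ((c6.mul continuousAt_snd).mul c3)))
  have hfun : HasDerivAt (fun P => ε * Real.log (ε ^ 4 + P) - 2 * ε * P / (ε ^ 4 + P))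
      (ε / (ε ^ 4 + P) - 2 * ε ^ 5 / (ε ^ 4 + P) ^ 2) P := by
    have h1 := (hasDerivAt_id P).const_add (ε ^ 4)
    refine (((h1.log hS).const_mul ε).sub
      (((hasDerivAt_id P).const_mul (2 * ε)).div h1 hS)).congr_deriv ?_
    simp
    field_simp
    ring
  refine ((hfun.add hder).const_mul δ).congr_deriv ?_
  -- The integrand is a total derivative plus the integrand of the frequency.
  have hint : ∫ u in (0 : ℝ)..1, δ * F' P u
      = (1 / 2 - P / (ε ^ 4 + P)) * e * (1 / ε) + scaledFrequency ε δ P := by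
    rw [← h.integral_scaledBranch_add hε, scaledFrequency, ← intervalIntegral.integral_const_mul,
      ← intervalIntegral.integral_add]
    · refine intervalIntegral.integral_congr fun u hu => ?_
      rw [uIcc_of_le zero_le_one] at hu
      have hom := scaledBranch_homogeneity (h.scaledQuartic_pos hε hu)
        (h.denominator_pos hε hu).ne'
      simp only [← he, hF'] at hom ⊢
      rw [div_eq_mul_one_div e, ← hom]
      have he2 : e = 2 * ε ^ 2 * δ / (ε ^ 4 + P) := rfl
      set b := scaledBranch ε δ P (e * u)
      set bP := scaledBranchP ε δ P (e * u)
      set bY := scaledBranchY ε δ P (e * u)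
      rw [he2]
      field_simp
      ring
    · refine ContinuousOn.intervalIntegrable ?_
      rw [uIcc_of_le zero_le_one]
      have h2 := h.continuousOn_scaledBranch hε
      have h3 := h.continuousOn_scaledBranchY hε
      fun_prop
    · refine ContinuousOn.intervalIntegrable ?_
      rw [uIcc_of_le zero_le_one]
      exact continuousOn_const.div (continuousOn_const.mul h.continuousOn_sqrt) fun u hu => by
        have := h.sqrt_pos hε hu
        positivity
  rw [mul_add, ← intervalIntegral.integral_const_mul, hint, he, scaledEndpoint]
  field_simp
  ring

/-- The derivative of the closed form with respect to the step size. -/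
theorem KdvAdmissible.hasDerivAt_mul_kdvEta (hε : 0 < ε) (h : KdvAdmissible ε δ P) :
    HasDerivAt (fun δ => δ * kdvEta ε δ P)
      (ε * Real.log (ε ^ 4 + P) + ∫ u in (0 : ℝ)..1, ε * P * scaledEndpoint ε δ P ^ 2 *
        (u * scaledBranch ε δ P (scaledEndpoint ε δ P * u)
          / √(scaledQuartic ε δ P (scaledEndpoint ε δ P * u)))) δ := by
  have hS : ε ^ 4 + P ≠ 0 := h.pos.ne'
  set e := scaledEndpoint ε δ P with he
  set η := 2 * ε ^ 2 / (ε ^ 4 + P) with hη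
  have heη : ∀ d, scaledEndpoint ε d P = d * η := fun d => by
    rw [scaledEndpoint, hη]
    ring
  set F' : ℝ → ℝ → ℝ := fun d u => P * η *
    (ε * (scaledEndpoint ε d P * u) * scaledBranch ε d P (scaledEndpoint ε d P * u)
        / √(scaledQuartic ε d P (scaledEndpoint ε d P * u))
      + η * u * scaledBranchY ε d P (scaledEndpoint ε d P * u)) with hF'
  have hder : HasDerivAt (fun d => ∫ u in (0 : ℝ)..1, P * η
        * scaledBranch ε d P (scaledEndpoint ε d P * u)) (∫ u in (0 : ℝ)..1, F' δ u) δ := by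
    have hg : Continuous fun y : ℝ × ℝ => ((y.1, P), y.2) := by fun_prop
    have hend : ∀ d, HasDerivAt (fun d => scaledEndpoint ε d P) η d := fun d => by
      simp only [heη]
      simpa using (hasDerivAt_id d).mul_const η
    refine hasDerivAt_intervalIntegral_param (F := fun d u => P * η
        * scaledBranch ε d P (scaledEndpoint ε d P * u)) (fun u hu => ?_) (fun u hu => ?_)
    · filter_upwards [(hg.tendsto (δ, u)).eventually (h.eventually_pos hε hu)] with y hy
      obtain ⟨hS, hq, hN⟩ := hy
      constructor
      · refine ((hasDerivAt_scaledBranch (hasDerivAt_id y.1) (hasDerivAt_const y.1 P)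
          ((hend y.1).mul_const y.2) hq hN.ne').const_mul (P * η)).congr_deriv ?_
        simp [hF']
      · have h3 := (continuousAt_scaledBranch_comp (y := ((y.1, P), y.2)) hS.ne' hN.ne').comp
          (f := fun u : ℝ => ((y.1, P), u)) (by fun_prop)
        exact continuousAt_const.mul h3
    · have hq := h.scaledQuartic_pos hε hu
      have hN := (h.denominator_pos hε hu).ne'
      have c0 : ContinuousAt (fun y : ℝ × ℝ => scaledEndpoint ε y.1 P) (δ, u) :=
        ContinuousAt.comp (f := fun y : ℝ × ℝ => y.1) (x := (δ, u))
          (hend δ).continuousAt continuousAt_fst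
      have c1 := (continuousAt_scaledBranch_comp (y := ((δ, P), u)) hS hN).comp
        (f := fun y : ℝ × ℝ => ((y.1, P), y.2)) (x := (δ, u)) hg.continuousAt
      have c2 := (continuousAt_sqrt_comp (y := ((δ, P), u)) hS).comp
        (f := fun y : ℝ × ℝ => ((y.1, P), y.2)) (x := (δ, u)) hg.continuousAt
      have c3 := (continuousAt_scaledBranchY_comp (y := ((δ, P), u)) hS hq hN).comp
        (f := fun y : ℝ × ℝ => ((y.1, P), y.2)) (x := (δ, u)) hg.continuousAt
      simp only [Function.comp_def] at c1 c2 c3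
      exact continuousAt_const.mul ((((continuousAt_const.mul (c0.mul continuousAt_snd)).mul c1).div
        c2 (h.sqrt_pos hε hu).ne').add ((continuousAt_const.mul continuousAt_snd).mul c3))
  have hη1 := (hder.const_add (ε * Real.log (ε ^ 4 + P) - 2 * ε * P / (ε ^ 4 + P)))
  refine ((hasDerivAt_id δ).mul hη1).congr_deriv ?_
  have i1 : IntervalIntegrable (fun u => scaledBranch ε δ P (e * u)) MeasureTheory.volume 0 1 := by
    refine ContinuousOn.intervalIntegrable ?_
    rw [uIcc_of_le zero_le_one]
    exact h.continuousOn_scaledBranch hε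
  have i2 : IntervalIntegrable (fun u => u * scaledBranch ε δ P (e * u)
      / √(scaledQuartic ε δ P (e * u))) MeasureTheory.volume 0 1 := by
    refine ContinuousOn.intervalIntegrable ?_
    rw [uIcc_of_le zero_le_one]
    exact (continuousOn_id.mul (h.continuousOn_scaledBranch hε)).div h.continuousOn_sqrt
      fun u hu => (h.sqrt_pos hε hu).ne'
  have i3 : IntervalIntegrable (fun u => e * u * scaledBranchY ε δ P (e * u))
      MeasureTheory.volume 0 1 := by
    refine ContinuousOn.intervalIntegrable ?_
    rw [uIcc_of_le zero_le_one]
    exact (continuousOn_const.mul continuousOn_id).mul (h.continuousOn_scaledBranchY hε)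
  have hint : (∫ u in (0 : ℝ)..1, P * η * scaledBranch ε δ P (e * u))
        + ∫ u in (0 : ℝ)..1, δ * F' δ u
      = (∫ u in (0 : ℝ)..1, ε * P * e ^ 2 *
          (u * scaledBranch ε δ P (e * u) / √(scaledQuartic ε δ P (e * u))))
        + P * η * (1 / ε) := by
    have hF'' : ∀ u, δ * F' δ u = ε * P * e ^ 2 *
          (u * scaledBranch ε δ P (e * u) / √(scaledQuartic ε δ P (e * u)))
          + P * η * (e * u * scaledBranchY ε δ P (e * u)) := by
      intro u
      simp only [hF', ← he]
      have := heη δ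
      rw [← he] at this
      linear_combination (-P * η * u * scaledBranchY ε δ P (e * u)
        - ε * P * e * (u * scaledBranch ε δ P (e * u) / √(scaledQuartic ε δ P (e * u)))) * this
    simp_rw [hF'']
    rw [← h.integral_scaledBranch_add hε, intervalIntegral.integral_add (i2.const_mul _)
      (i3.const_mul _), ← he, intervalIntegral.integral_add i1 i3]
    simp only [intervalIntegral.integral_const_mul]
    ring
  have e1 : δ * (∫ u in (0 : ℝ)..1, F' δ u) = ∫ u in (0 : ℝ)..1, δ * F' δ u :=
    (intervalIntegral.integral_const_mul _ _).symm
  have e2 : P * η * (1 / ε) = 2 * ε * P / (ε ^ 4 + P) := by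
    rw [hη]
    field_simp
  rw [e2] at hint
  simp only [id_eq, one_mul, e1]
  linarith

end ClosedFormDerivative

/-! ### The level curves of the invariant and the frequency integral -/

section LevelCurve

variable {ε δ P : ℝ}

theorem kdvEndpoint_eq : kdvEndpoint ε δ P = √(-P) * scaledEndpoint ε δ P := by
  unfold kdvEndpoint scaledEndpoint
  ring

theorem kdvQuartic_sqrt_mul (hP : P ≤ 0) (y : ℝ) :
    kdvQuartic ε δ P (√(-P) * y) = -P * scaledQuartic ε δ P y := by
  have h : √(-P) ^ 2 = -P := Real.sq_sqrt (by linarith)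
  simp only [kdvQuartic, scaledQuartic, mul_pow, h]
  ring

theorem kdvBranch_sqrt_mul (hP : P ≤ 0) (y : ℝ) :
    kdvBranch ε δ (√(-P) * y) P = -√(-P) * scaledBranch ε δ P y := by
  have h : √(-P) ^ 2 = -P := Real.sq_sqrt (by linarith)
  rw [kdvBranch, kdvQuartic_sqrt_mul hP, Real.sqrt_mul (by linarith), mul_pow, h, scaledBranch,
    show -P * y ^ 2 - ε ^ 2 = -(ε ^ 2 + P * y ^ 2) by ring, div_neg]
  ring

theorem kdvFrequency_eq_scaledFrequency (hP : P < 0) :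
    kdvFrequency ε δ P = scaledFrequency ε δ P := by
  have ha : 0 < √(-P) := Real.sqrt_pos.2 (by linarith)
  rw [kdvFrequency, scaledFrequency, kdvEndpoint_eq]
  have h := intervalIntegral.mul_integral_comp_mul_left (a := 0) (b := 1)
    (f := fun x => 1 / (2 * √(kdvQuartic ε δ P x))) (√(-P) * scaledEndpoint ε δ P)
  rw [mul_zero, mul_one] at h
  rw [← h, ← intervalIntegral.integral_const_mul]
  congr 1
  funext u
  rw [mul_assoc (√(-P)) (scaledEndpoint ε δ P) u, kdvQuartic_sqrt_mul hP.le, Real.sqrt_mul (by linarith)]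
  field_simp

theorem kdvEta_zero : kdvEta ε δ 0 = 4 * ε * Real.log ε := by
  have h : (Real.log (ε ^ 4) : ℝ) = 4 * Real.log ε := by
    rw [Real.log_pow]
    norm_num
  simp only [kdvEta, add_zero, h]
  simp
  ring

/-- The value of the analytic expression at the invariant is the closed form. At `P = 0` the
integrand of the closed form has a removable discontinuity. -/
theorem kdvClosedForm_eq (hε : 0 < ε) (hδ : 2 * δ ^ 2 < ε ^ 2)
    (hP : P ∈ Ioc (kdvThreshold ε δ) 0) : kdvClosedForm ε δ P = δ * kdvEta ε δ P := by
  have hadm : ∀ x ∈ uIcc 0 P, KdvAdmissible ε δ x := by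
    intro x hx
    rw [uIcc_of_ge hP.2] at hx
    exact kdvAdmissible_of_mem hε hδ ⟨hP.1.trans_le hx.1, hx.2⟩
  have hcont : ContinuousOn (scaledFrequency ε δ) (uIcc 0 P) := by
    have h1 : ContinuousOn (deriv fun P => δ * kdvEta ε δ P) (uIcc 0 P) := fun x hx => by
      have h2 : AnalyticAt ℝ (fun P => kdvEta ε δ P) x :=
        AnalyticAt.fun_comp_of_eq (f := fun P => (δ, P)) (analyticAt_kdvEta hε (hadm x hx))
          (analyticAt_const.prod analyticAt_id) rfl
      exact (analyticAt_const.mul h2).deriv.continuousAt.continuousWithinAt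
    exact h1.congr fun x hx => ((hadm x hx).hasDerivAt_kdvEta hε).deriv.symm
  have h1 : ∫ x in (0 : ℝ)..P, kdvFrequency ε δ x = ∫ x in (0 : ℝ)..P, scaledFrequency ε δ x := by
    refine intervalIntegral.integral_congr_ae ?_
    have h0 : ∀ᵐ x : ℝ, x ≠ 0 := by
      simp [MeasureTheory.ae_iff]
    filter_upwards [h0] with x hx0 hx
    refine kdvFrequency_eq_scaledFrequency (lt_of_le_of_ne ?_ hx0)
    exact (hadm x (uIoc_subset_uIcc hx)).2.1
  rw [kdvClosedForm, h1, intervalIntegral.integral_eq_sub_of_hasDerivAt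
    (fun x hx => (hadm x hx).hasDerivAt_kdvEta hε) hcont.intervalIntegrable, kdvEta_zero]
  ring

theorem exists_mul_of_mem_uIcc {c x : ℝ} (hx : x ∈ uIcc 0 c) : ∃ u ∈ Icc (0 : ℝ) 1, x = c * u := by
  rw [← segment_eq_uIcc, segment_eq_image] at hx
  obtain ⟨u, hu, rfl⟩ := hx
  exact ⟨u, hu, by simp [mul_comm]⟩

theorem kdvInvariant_kdvBranch {x : ℝ} (hD : 0 ≤ kdvQuartic ε δ P x) (hx : x ^ 2 - ε ^ 2 ≠ 0) :
    kdvInvariant ε δ (x, kdvBranch ε δ x P) = P := by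
  have h1 : kdvBranch ε δ x P * (x ^ 2 - ε ^ 2) = ε * δ * x + √(kdvQuartic ε δ P x) := by
    rw [kdvBranch, div_mul_cancel₀ _ hx]
  have h2 : √(kdvQuartic ε δ P x) ^ 2 = kdvQuartic ε δ P x := Real.sq_sqrt hD
  have h3 : (kdvInvariant ε δ (x, kdvBranch ε δ x P) - P) * (x ^ 2 - ε ^ 2) = 0 := by
    have : (kdvInvariant ε δ (x, kdvBranch ε δ x P) - P) * (x ^ 2 - ε ^ 2)
        = (kdvBranch ε δ x P * (x ^ 2 - ε ^ 2)) ^ 2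
          - 2 * ε * δ * x * (kdvBranch ε δ x P * (x ^ 2 - ε ^ 2))
          - (ε ^ 2 * x ^ 2 + P) * (x ^ 2 - ε ^ 2) := by
      simp only [kdvInvariant]
      ring
    rw [this, h1]
    have h4 : (ε * δ * x + √(kdvQuartic ε δ P x)) ^ 2
        = ε ^ 2 * δ ^ 2 * x ^ 2 + 2 * ε * δ * x * √(kdvQuartic ε δ P x) + kdvQuartic ε δ P x := by
      linear_combination h2
    rw [h4, kdvQuartic]
    ring
  rcases mul_eq_zero.1 h3 with h | h
  · linarith
  · exact absurd h hx

theorem hasDerivAt_kdvBranch {x : ℝ} (hD : 0 < kdvQuartic ε δ P x) (hx : x ^ 2 - ε ^ 2 ≠ 0) :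
    HasDerivAt (fun P' => kdvBranch ε δ x P') (1 / (2 * √(kdvQuartic ε δ P x))) P := by
  have h1 : HasDerivAt (fun P' => kdvQuartic ε δ P' x) (-(ε ^ 2 - x ^ 2)) P := by
    have := (((hasDerivAt_id P).const_add (ε ^ 2 * x ^ 2)).const_mul (ε ^ 2 - x ^ 2)).const_sub
      (δ ^ 2 * ε ^ 2 * x ^ 2)
    exact this.congr_deriv (by ring)
  refine (((h1.sqrt hD.ne').const_add (ε * δ * x)).div_const (x ^ 2 - ε ^ 2)).congr_deriv ?_
  have := (Real.sqrt_pos.2 hD).ne'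
  field_simp
  ring

theorem KdvAdmissible.arc (hε : 0 < ε) (h : KdvAdmissible ε δ P) (hP : P < 0) {x : ℝ}
    (hx : x ∈ uIcc 0 (kdvEndpoint ε δ P)) :
    0 < kdvQuartic ε δ P x ∧ x ^ 2 - ε ^ 2 ≠ 0 := by
  obtain ⟨u, hu, rfl⟩ := exists_mul_of_mem_uIcc hx
  rw [kdvEndpoint_eq, mul_assoc]
  constructor
  · rw [kdvQuartic_sqrt_mul hP.le]
    exact mul_pos (by linarith) (h.scaledQuartic_pos hε hu)
  · have h1 := h.denominator_pos hε hu
    rw [mul_pow, Real.sq_sqrt (by linarith)]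
    intro h2
    linarith

theorem kdvMap_branch_zero (hε : 0 < ε) (h : KdvAdmissible ε δ P) :
    kdvMap ε δ (0, kdvBranch ε δ 0 P)
      = (kdvEndpoint ε δ P, kdvBranch ε δ (kdvEndpoint ε δ P) P) := by
  have h0 : kdvBranch ε δ 0 P = -√(-P) * (1 / ε) := by
    have := kdvBranch_sqrt_mul (ε := ε) (δ := δ) h.2.1 0
    rw [mul_zero] at this
    rw [this, scaledBranch, scaledQuartic]
    simp [Real.sqrt_sq hε.le]
    left
    field_simp
  have h1 : kdvBranch ε δ (kdvEndpoint ε δ P) P = -√(-P) * (1 / ε) := by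
    rw [kdvEndpoint_eq, kdvBranch_sqrt_mul h.2.1, h.scaledBranch_scaledEndpoint hε]
  have h2 : √(-P) ^ 2 = -P := Real.sq_sqrt (by linarith [h.2.1])
  have hS := h.pos
  rw [h0, h1]
  ext
  · simp only [kdvMap]
    rw [show ε ^ 2 - (-√(-P) * (1 / ε) + 2 * ε * δ * 0 / (ε ^ 2 - 0 ^ 2)) ^ 2
      = (ε ^ 4 + P) / ε ^ 2 by
        rw [mul_zero, zero_div, add_zero, mul_pow, neg_sq, h2]
        field_simp
        ring]
    rw [kdvEndpoint]
    field_simp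
    ring
  · simp [kdvMap]

theorem hasDerivAt_kdvClosedForm (hε : 0 < ε) (hδ : 2 * δ ^ 2 < ε ^ 2)
    (hP : P ∈ Ioo (kdvThreshold ε δ) 0) :
    HasDerivAt (kdvClosedForm ε δ) (kdvFrequency ε δ P) P := by
  rw [kdvFrequency_eq_scaledFrequency hP.2]
  refine ((kdvAdmissible_of_mem hε hδ ⟨hP.1, hP.2.le⟩).hasDerivAt_kdvEta hε).congr_of_eventuallyEq ?_
  filter_upwards [Ioo_mem_nhds hP.1 hP.2] with x hx
  exact kdvClosedForm_eq hε hδ ⟨hx.1, hx.2.le⟩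

/-- The slope of the level curve in rescaled variables: `√D_P · ∂p/∂x = -(1/2) ∂I/∂q`, where the right
side is half the second component of the Hamiltonian field and `√D_P` half the first one. -/
theorem sqrt_mul_scaledBranchY {y : ℝ} (hq : 0 < scaledQuartic ε δ P y)
    (hN : ε ^ 2 + P * y ^ 2 ≠ 0) :
    √(scaledQuartic ε δ P y) * scaledBranchY ε δ P y
      = -P * y * scaledBranch ε δ P y ^ 2 - ε ^ 2 * y + ε * δ * scaledBranch ε δ P y := by
  have hs : √(scaledQuartic ε δ P y) ≠ 0 := (Real.sqrt_pos.2 hq).ne'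
  have hs2 : √(scaledQuartic ε δ P y) ^ 2 = scaledQuartic ε δ P y := Real.sq_sqrt hq.le
  simp only [scaledBranch, scaledBranchY]
  set s := √(scaledQuartic ε δ P y)
  rw [scaledQuartic] at hs2
  have hN' : (ε ^ 2 + P * y ^ 2) ^ 2 ≠ 0 := pow_ne_zero 2 hN
  have key : s * ((ε * δ + (2 * y * (δ ^ 2 * ε ^ 2 + P - ε ^ 4) - 4 * ε ^ 2 * P * y ^ 3) / (2 * s))
        * (ε ^ 2 + P * y ^ 2) - (ε * δ * y + s) * (2 * P * y))
      = -P * y * (ε * δ * y + s) ^ 2 - ε ^ 2 * y * (ε ^ 2 + P * y ^ 2) ^ 2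
        + ε * δ * (ε * δ * y + s) * (ε ^ 2 + P * y ^ 2) := by
    have e1 : s * ((2 * y * (δ ^ 2 * ε ^ 2 + P - ε ^ 4) - 4 * ε ^ 2 * P * y ^ 3) / (2 * s))
        = y * (δ ^ 2 * ε ^ 2 + P - ε ^ 4) - 2 * ε ^ 2 * P * y ^ 3 := by
      field_simp
      ring
    linear_combination (ε ^ 2 + P * y ^ 2) * e1 - P * y * hs2
  have e2 : s * ((ε * δ + (2 * y * (δ ^ 2 * ε ^ 2 + P - ε ^ 4) - 4 * ε ^ 2 * P * y ^ 3) / (2 * s))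
        / (ε ^ 2 + P * y ^ 2) - (ε * δ * y + s) * (2 * P * y) / (ε ^ 2 + P * y ^ 2) ^ 2)
      = s * ((ε * δ + (2 * y * (δ ^ 2 * ε ^ 2 + P - ε ^ 4) - 4 * ε ^ 2 * P * y ^ 3) / (2 * s))
        * (ε ^ 2 + P * y ^ 2) - (ε * δ * y + s) * (2 * P * y)) / (ε ^ 2 + P * y ^ 2) ^ 2 := by
    generalize (ε * δ + (2 * y * (δ ^ 2 * ε ^ 2 + P - ε ^ 4) - 4 * ε ^ 2 * P * y ^ 3) / (2 * s)) = w
    field_simp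
  rw [e2, key]
  field_simp

end LevelCurve

/-! ### One step of the map as the flow of the invariant -/

noncomputable section

/-- The arc of the level curve `I = P` that joins the point with `q = 0`, `p < 0` to its image,
parametrised proportionally to `q`. -/
def kdvArc (ε δ P u : ℝ) : ℝ × ℝ :=
  (√(-P) * (scaledEndpoint ε δ P * u),
    -√(-P) * scaledBranch ε δ P (scaledEndpoint ε δ P * u))

end

section OneStep

variable {ε δ P : ℝ}

theorem kdvArc_eq_kdvBranch (hP : P ≤ 0) (u : ℝ) :
    kdvArc ε δ P u = (√(-P) * (scaledEndpoint ε δ P * u),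
      kdvBranch ε δ (√(-P) * (scaledEndpoint ε δ P * u)) P) := by
  rw [kdvBranch_sqrt_mul hP, kdvArc]

theorem kdvArc_zero (hε : 0 < ε) : kdvArc ε δ P 0 = (0, -√(-P) / ε) := by
  simp [kdvArc, scaledBranch, scaledQuartic, Real.sqrt_sq hε.le]
  field_simp

theorem kdvArc_one (hε : 0 < ε) (h : KdvAdmissible ε δ P) :
    kdvArc ε δ P 1 = kdvMap ε δ (kdvArc ε δ P 0) := by
  rw [kdvArc_eq_kdvBranch h.2.1, kdvArc_eq_kdvBranch h.2.1, mul_one, mul_zero, mul_zero,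
    ← kdvEndpoint_eq, kdvMap_branch_zero hε h]

theorem kdvInvariant_kdvArc (hε : 0 < ε) (h : KdvAdmissible ε δ P) (hP : P < 0) {u : ℝ}
    (hu : u ∈ Icc (0 : ℝ) 1) : kdvInvariant ε δ (kdvArc ε δ P u) = P := by
  have hq := h.scaledQuartic_pos hε hu
  have hN := h.denominator_pos hε hu
  rw [kdvArc_eq_kdvBranch h.2.1]
  refine kdvInvariant_kdvBranch ?_ ?_
  · rw [kdvQuartic_sqrt_mul hP.le]
    exact mul_nonneg (by linarith) hq.le
  · rw [mul_pow (√(-P)), Real.sq_sqrt (by linarith)]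
    intro h2
    linarith

theorem hasDerivAt_kdvArc (hε : 0 < ε) (h : KdvAdmissible ε δ P) {u : ℝ}
    (hu : u ∈ Icc (0 : ℝ) 1) :
    HasDerivAt (kdvArc ε δ P)
      ((scaledEndpoint ε δ P / (2 * √(scaledQuartic ε δ P (scaledEndpoint ε δ P * u))))
        • kdvField ε δ (kdvArc ε δ P u)) u := by
  have hy : HasDerivAt (fun u => scaledEndpoint ε δ P * u) (scaledEndpoint ε δ P) u := by
    simpa using (hasDerivAt_id u).const_mul (scaledEndpoint ε δ P)
  have h1 := (hy.const_mul (√(-P))).prodMk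
    ((h.hasDerivAt_scaledBranch_comp hε hu).const_mul (-√(-P)))
  refine HasDerivAt.congr_deriv (f := kdvArc ε δ P) h1 ?_
  have hs := (h.sqrt_pos hε hu).ne'
  have hN := (h.denominator_pos hε hu).ne'
  have hid := sqrt_mul_scaledBranchY (h.scaledQuartic_pos hε hu) hN
  have ha : √(-P) ^ 2 = -P := Real.sq_sqrt (by linarith [h.2.1])
  set y := scaledEndpoint ε δ P * u with hy
  set s := √(scaledQuartic ε δ P y) with hsdef
  have hB : scaledBranch ε δ P y * (ε ^ 2 + P * y ^ 2) = ε * δ * y + s := by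
    rw [scaledBranch, div_mul_cancel₀ _ hN]
  have e1 : (kdvField ε δ (kdvArc ε δ P u)).1 = 2 * √(-P) * s := by
    simp only [kdvField, kdvArc, ← hy]
    linear_combination 2 * √(-P) * hB - 2 * √(-P) * scaledBranch ε δ P y * y ^ 2 * ha
  have e2 : (kdvField ε δ (kdvArc ε δ P u)).2 = -2 * √(-P) * (s * scaledBranchY ε δ P y) := by
    simp only [kdvField, kdvArc, ← hy]
    linear_combination 2 * √(-P) * hid - 2 * √(-P) * y * scaledBranch ε δ P y ^ 2 * ha
  ext
  · rw [Prod.smul_fst, e1, smul_eq_mul]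
    field_simp
  · rw [Prod.smul_snd, e2, smul_eq_mul]
    field_simp

theorem mk_zero_mem_kdvRegion (hε : 0 < ε) (hδ : 2 * δ ^ 2 < ε ^ 2)
    (hP : P ∈ Ioo (kdvThreshold ε δ) 0) : (0, -√(-P) / ε) ∈ kdvRegion ε δ := by
  have h1 := neg_sq_le_kdvThreshold (δ := δ) hε
  have hm : 0 < ε - |δ| := sub_pos.2 (abs_lt_of_two_mul_sq_lt hε hδ)
  have ha : √(-P) ^ 2 = -P := Real.sq_sqrt (by linarith [hP.2])
  have hd := abs_nonneg δ
  refine ⟨by simpa using mul_pos hε hm, ?_, ?_⟩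
  · simp only [div_pow, neg_sq, ha]
    rw [div_lt_iff₀ (by positivity)]
    have h2 : ε * (ε - |δ|) * (ε * (ε - |δ|)) ≤ ε * (ε - |δ|) * ε ^ 2 := by
      gcongr
      nlinarith
    nlinarith [hP.1]
  · have : kdvInvariant ε δ (0, -√(-P) / ε) = P := by
      simp only [kdvInvariant, div_pow, neg_sq, ha]
      field_simp
      ring
    rw [this]
    exact hP.1

theorem kdvArc_mem_kdvRegion (hε : 0 < ε) (hδ : 2 * δ ^ 2 < ε ^ 2)
    (hP : P ∈ Ioo (kdvThreshold ε δ) 0) {u : ℝ} (hu : u ∈ Icc (0 : ℝ) 1) :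
    kdvArc ε δ P u ∈ kdvRegion ε δ := by
  have h := kdvAdmissible_of_mem hε hδ ⟨hP.1, hP.2.le⟩
  have hcont : Continuous (fun t : ℝ => kdvArc ε δ P (projIcc 0 1 zero_le_one t)) := by
    have h1 : ContinuousOn (kdvArc ε δ P) (Icc 0 1) := fun u hu =>
      (hasDerivAt_kdvArc hε h hu).continuousAt.continuousWithinAt
    exact h1.comp_continuous (by fun_prop) fun t => (projIcc (0 : ℝ) 1 zero_le_one t).2
  have h0 : kdvArc ε δ P (projIcc (0 : ℝ) 1 zero_le_one 0) = (0, -√(-P) / ε) := by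
    rw [projIcc_left, kdvArc_zero hε]
  have := mem_kdvRegion_of_continuous hε hcont (fun t => by
    rw [kdvInvariant_kdvArc hε h hP.2 (projIcc (0 : ℝ) 1 zero_le_one t).2,
      kdvInvariant_kdvArc hε h hP.2 (projIcc (0 : ℝ) 1 zero_le_one 0).2])
    (by rw [h0]; exact mk_zero_mem_kdvRegion hε hδ hP) u
  rwa [projIcc_of_mem _ hu] at this

theorem KdvAdmissible.continuousOn_speed (hε : 0 < ε) (h : KdvAdmissible ε δ P) :
    ContinuousOn (fun u => scaledEndpoint ε δ P
      / (2 * √(scaledQuartic ε δ P (scaledEndpoint ε δ P * u)))) (Icc 0 1) :=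
  continuousOn_const.div (continuousOn_const.mul h.continuousOn_sqrt) fun u hu => by
    have := h.sqrt_pos hε hu
    positivity

/-- The arc is a reparametrised piece of the orbit of the invariant, and the time needed along it
is the integral that defines the frequency. -/
theorem exists_kdvArc_time (hε : 0 < ε) (hδ : 2 * δ ^ 2 < ε ^ 2)
    (hP : P ∈ Ioo (kdvThreshold ε δ) 0) {γ : ℝ → ℝ × ℝ}
    (hγ : ∀ t, HasDerivAt γ (kdvField ε δ (γ t)) t) (hγm : ∀ t, γ t ∈ kdvRegion ε δ)
    (h0 : γ 0 = (0, -√(-P) / ε)) :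
    ∃ T : ℝ → ℝ, T 0 = 0 ∧ T 1 = scaledFrequency ε δ P ∧
      (∀ u ∈ Icc (0 : ℝ) 1, HasDerivAt T (scaledEndpoint ε δ P
        / (2 * √(scaledQuartic ε δ P (scaledEndpoint ε δ P * u)))) u) ∧
      ∀ u ∈ Icc (0 : ℝ) 1, kdvArc ε δ P u = γ (T u) := by
  have h := kdvAdmissible_of_mem hε hδ ⟨hP.1, hP.2.le⟩
  set g : ℝ → ℝ := fun u => scaledEndpoint ε δ P
      / (2 * √(scaledQuartic ε δ P (scaledEndpoint ε δ P * u))) with hg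
  have hgc : ContinuousOn g (Icc 0 1) := h.continuousOn_speed hε
  have hgp : Continuous fun t : ℝ => g (projIcc 0 1 zero_le_one t) :=
    hgc.comp_continuous (by fun_prop) fun t => (projIcc (0 : ℝ) 1 zero_le_one t).2
  have hT : ∀ u ∈ Icc (0 : ℝ) 1,
      HasDerivAt (fun u => ∫ t in (0 : ℝ)..u, g (projIcc 0 1 zero_le_one t)) (g u) u := by
    intro u hu
    refine (hgp.integral_hasStrictDerivAt 0 u).hasDerivAt.congr_deriv ?_
    rw [projIcc_of_mem _ hu]
  refine ⟨_, intervalIntegral.integral_same, ?_, hT, ?_⟩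
  · rw [scaledFrequency]
    refine intervalIntegral.integral_congr fun u hu => ?_
    rw [uIcc_of_le zero_le_one] at hu
    simp only [projIcc_of_mem _ hu, hg]
  · refine eq_kdvOrbit_comp hε hγ hγm (fun u hu => (hT u hu).hasDerivWithinAt) hgc
      (fun u hu => hasDerivAt_kdvArc hε h hu) (fun u hu => kdvArc_mem_kdvRegion hε hδ hP hu) ?_
    rw [kdvArc_zero hε, intervalIntegral.integral_same, h0]

theorem kdvField_neg (z : ℝ × ℝ) : kdvField ε δ (-z) = -kdvField ε δ z := by
  ext <;> simp [kdvField] <;> ring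

/-- Every orbit in the region other than the fixed point crosses the axis `q = 0`: otherwise the
angle `arctan (p / q)` would grow at a uniform rate. -/
theorem exists_kdvOrbit_fst_eq_zero (hε : 0 < ε) (hδ : 2 * δ ^ 2 < ε ^ 2) {γ : ℝ → ℝ × ℝ}
    (hγ : ∀ t, HasDerivAt γ (kdvField ε δ (γ t)) t) (hγm : ∀ t, γ t ∈ kdvRegion ε δ)
    (h0 : γ 0 ≠ 0) : ∃ t, (γ t).1 = 0 := by
  by_contra! hne
  have hI := kdvInvariant_comp_eq (k := fun _ => 1) (fun t => by simpa using hγ t)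
  have hP := kdvInvariant_neg_of_mem hε (hγm 0) h0
  set P := kdvInvariant ε δ (γ 0) with hPdef
  set m := ε * (ε - |δ|) with hm
  have hm0 : 0 < m := mul_pos hε (sub_pos.2 (abs_lt_of_two_mul_sq_lt hε hδ))
  have hPm : 0 < P + m ^ 2 := by
    have h1 := neg_sq_le_kdvThreshold (δ := δ) hε
    have h2 := (hγm 0).2.2
    linarith
  have hk := Real.sqrt_pos.2 hPm
  have hk2 : √(P + m ^ 2) ^ 2 = P + m ^ 2 := Real.sq_sqrt hPm.le
  have hkm : √(P + m ^ 2) < m := by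
    rw [Real.sqrt_lt' hm0]
    linarith
  set κ := √(P + m ^ 2) with hκ
  set c := 2 * κ * (m - κ) / ε ^ 2 with hc
  have hc0 : 0 < c := by
    have := sub_pos.2 hkm
    positivity
  have hder : ∀ t, HasDerivAt (fun t => Real.arctan ((γ t).2 / (γ t).1) - c * t)
      ((-2 * P - 2 * ((γ t).1 * (γ t).2) ^ 2) / ((γ t).1 ^ 2 + (γ t).2 ^ 2) - c) t := by
    intro t
    have h1 : HasDerivAt (fun t => (γ t).1) (kdvField ε δ (γ t)).1 t :=
      (hasFDerivAt_fst (p := γ t)).comp_hasDerivAt t (hγ t)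
    have h2 : HasDerivAt (fun t => (γ t).2) (kdvField ε δ (γ t)).2 t :=
      (hasFDerivAt_snd (p := γ t)).comp_hasDerivAt t (hγ t)
    refine (((h2.div h1 (hne t)).arctan).sub ((hasDerivAt_id t).const_mul c)).congr_deriv ?_
    have hq := hne t
    have hqp : (γ t).1 ^ 2 + (γ t).2 ^ 2 ≠ 0 := by positivity
    rw [hPdef, hI 0 t]
    simp only [kdvInvariant, kdvField, Pi.div_apply]
    rw [mul_one]
    congr 1
    have h3 : 1 + ((γ t).2 / (γ t).1) ^ 2 = ((γ t).1 ^ 2 + (γ t).2 ^ 2) / (γ t).1 ^ 2 := by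
      field_simp
    rw [h3]
    field_simp
    ring
  have hmono : Monotone fun t => Real.arctan ((γ t).2 / (γ t).1) - c * t := by
    refine monotone_of_deriv_nonneg (fun t => (hder t).differentiableAt) fun t => ?_
    rw [(hder t).deriv, sub_nonneg]
    have hmem := hγm t
    have h1 := abs_mul_le_of_mem_kdvRegion hε hmem
    rw [hI t 0, ← hPdef, ← hm, ← hκ] at h1
    have h2 : ((γ t).1 * (γ t).2) ^ 2 ≤ (m - κ) ^ 2 := sq_le_sq' (by linarith [(abs_le.1 h1).1])
      (abs_le.1 h1).2
    have h3 : 0 < (γ t).1 ^ 2 := by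
      have := hne t
      positivity
    have h4 := kdvRegion_sub_sq_pos hε hmem
    have h5 : 0 < (γ t).1 ^ 2 + (γ t).2 ^ 2 := by positivity
    rw [le_div_iff₀ h5]
    have h6 : c * ((γ t).1 ^ 2 + (γ t).2 ^ 2) ≤ c * (2 * ε ^ 2) := by
      gcongr
      linarith [h4.1, h4.2]
    have h7 : c * (2 * ε ^ 2) = 4 * κ * (m - κ) := by
      rw [hc]
      field_simp
      ring
    nlinarith
  have h1 := hmono (show (0 : ℝ) ≤ Real.pi / c by positivity)
  simp only [mul_zero, sub_zero] at h1
  rw [mul_div_cancel₀ _ hc0.ne'] at h1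
  have h2 := Real.arctan_lt_pi_div_two ((γ (Real.pi / c)).2 / (γ (Real.pi / c)).1)
  have h3 := Real.neg_pi_div_two_lt_arctan ((γ 0).2 / (γ 0).1)
  linarith

/-- The level curve meets the axis `q = 0` in two points, exchanged by the symmetry `z ↦ -z`. -/
theorem eq_or_eq_of_fst_eq_zero (hε : 0 < ε) {z : ℝ × ℝ} (hz : z.1 = 0) :
    z = (0, -√(-kdvInvariant ε δ z) / ε) ∨ -z = (0, -√(-kdvInvariant ε δ z) / ε) := by
  have h1 : -kdvInvariant ε δ z = (ε * z.2) ^ 2 := by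
    simp only [kdvInvariant, hz]
    ring
  rw [h1, Real.sqrt_sq_eq_abs, abs_mul, abs_of_pos hε]
  rcases le_total z.2 0 with h | h
  · left
    ext
    · exact hz
    · rw [abs_of_nonpos h]
      field_simp
  · right
    ext
    · simp [hz]
    · rw [abs_of_nonneg h]
      simp
      field_simp

/-- The time of one step, for the orbit that starts at the point with `q = 0`, `p < 0`. -/
theorem kdvMap_orbit_of_start (hε : 0 < ε) (hδ : 2 * δ ^ 2 < ε ^ 2)
    (hP : P ∈ Ioo (kdvThreshold ε δ) 0) {γ : ℝ → ℝ × ℝ}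
    (hγ : ∀ t, HasDerivAt γ (kdvField ε δ (γ t)) t) (hγm : ∀ t, γ t ∈ kdvRegion ε δ)
    (h0 : γ 0 = (0, -√(-P) / ε)) : kdvMap ε δ (γ 0) = γ (scaledFrequency ε δ P) := by
  obtain ⟨T, -, hT1, -, hT⟩ := exists_kdvArc_time hε hδ hP hγ hγm h0
  rw [← hT1, ← hT 1 (by simp), kdvArc_one hε (kdvAdmissible_of_mem hε hδ ⟨hP.1, hP.2.le⟩),
    kdvArc_zero hε, h0]

/-- One step of the map is the flow of the invariant for the time `ν`, all along an orbit. -/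
theorem kdvMap_orbit (hε : 0 < ε) (hδ : 2 * δ ^ 2 < ε ^ 2) {γ : ℝ → ℝ × ℝ}
    (hγ : ∀ t, HasDerivAt γ (kdvField ε δ (γ t)) t) (hγm : ∀ t, γ t ∈ kdvRegion ε δ)
    (t : ℝ) : kdvMap ε δ (γ t) = γ (t + scaledFrequency ε δ (kdvInvariant ε δ (γ 0))) := by
  by_cases h0 : γ 0 = 0
  · have : γ = fun _ => 0 := kdvOrbit_unique (k := 1) (t₀ := 0) hε
      (fun t => by rw [one_smul]; exact hγ t) hγm
      (fun t => by
        rw [one_smul, show kdvField ε δ 0 = 0 by ext <;> simp [kdvField]]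
        exact hasDerivAt_const t 0) (fun t => zero_mem_kdvRegion hε hδ) h0
    simp only [this, kdvMap_zero]
  have hI := kdvInvariant_comp_eq (k := fun _ => 1) (fun t => by simpa using hγ t)
  have hP : kdvInvariant ε δ (γ 0) ∈ Ioo (kdvThreshold ε δ) 0 :=
    ⟨(hγm 0).2.2, kdvInvariant_neg_of_mem hε (hγm 0) h0⟩
  set P := kdvInvariant ε δ (γ 0) with hPdef
  set ν := scaledFrequency ε δ P
  have hshift : ∀ s t, HasDerivAt (fun t => γ (t + s)) (kdvField ε δ (γ (t + s))) t :=
    fun s t => (hγ (t + s)).comp_add_const t s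
  obtain ⟨t₀, ht₀⟩ := exists_kdvOrbit_fst_eq_zero hε hδ hγ hγm h0
  -- if the orbit crosses the axis `q = 0` with `p > 0`, the orbit `-γ` crosses it with `p < 0`
  have key : kdvMap ε δ (γ t₀) = γ (t₀ + ν) := by
    rcases eq_or_eq_of_fst_eq_zero (δ := δ) hε ht₀ with h | h
    · rw [hI t₀ 0, ← hPdef] at h
      have := kdvMap_orbit_of_start hε hδ hP (hshift t₀) (fun t => hγm _) (by simpa using h)
      simpa [add_comm] using this
    · rw [hI t₀ 0, ← hPdef] at h
      have := kdvMap_orbit_of_start (γ := fun t => -γ (t + t₀)) hε hδ hP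
        (fun t => by rw [kdvField_neg]; exact (hshift t₀ t).neg)
        (fun t => neg_mem_kdvRegion (hγm _)) (by simpa using h)
      rw [kdvMap_neg, neg_inj] at this
      simpa [add_comm] using this
  have := kdvOrbit_unique (k := 1) (γ := fun t => kdvMap ε δ (γ t)) (γ' := fun t => γ (t + ν)) hε
    (fun t => by rw [one_smul]; exact hasDerivAt_kdvMap_comp hε hδ (hγ t) (hγm t))
    (fun t => kdvMap_mem_kdvRegion hε hδ (hγm t))
    (fun t => by rw [one_smul]; exact hshift ν t) (fun t => hγm _) key
  exact congrFun this t

theorem kdvMap_eq_flow (hε : 0 < ε) (hδ : 2 * δ ^ 2 < ε ^ 2) {z : ℝ × ℝ}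
    (hz : z ∈ kdvRegion ε δ) (h0 : z ≠ 0) :
    kdvInvariant ε δ z ∈ Ioo (kdvThreshold ε δ) 0 ∧
      ∃ γ : ℝ → ℝ × ℝ, IsHamiltonianTrajectory (kdvInvariant ε δ) γ ∧ γ 0 = z ∧
        (∀ t, γ t ∈ kdvRegion ε δ) ∧
        γ (kdvFrequency ε δ (kdvInvariant ε δ z)) = kdvMap ε δ z := by
  have hP := kdvInvariant_neg_of_mem hε hz h0
  obtain ⟨γ, rfl, hγ, hγm⟩ := exists_kdvOrbit hε hz
  refine ⟨⟨hz.2.2, hP⟩, γ, isHamiltonianTrajectory_kdvInvariant_iff.2 hγ, rfl, hγm, ?_⟩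
  rw [kdvFrequency_eq_scaledFrequency hP, kdvMap_orbit hε hδ hγ hγm, zero_add]

end OneStep

/-! ### Hamiltonian flows of functions of the invariant -/

section ModifiedHamiltonian

variable {ε δ : ℝ}

theorem KdvAdmissible.analyticAt_kdvEta_right {P : ℝ} (hε : 0 < ε) (h : KdvAdmissible ε δ P) :
    AnalyticAt ℝ (fun P => kdvEta ε δ P) P :=
  AnalyticAt.fun_comp_of_eq (f := fun P => (δ, P)) (analyticAt_kdvEta hε h)
    (analyticAt_const.prod analyticAt_id) rfl

theorem kdvAdmissible_kdvInvariant (hε : 0 < ε) (hδ : 2 * δ ^ 2 < ε ^ 2) {z : ℝ × ℝ}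
    (hz : z ∈ kdvRegion ε δ) : KdvAdmissible ε δ (kdvInvariant ε δ z) :=
  kdvAdmissible_of_mem hε hδ ⟨hz.2.2, kdvInvariant_nonpos_of_mem hε hz⟩

/-- A function that differs by a constant from the analytic form of the modified Hamiltonian has
the flow of the invariant as its Hamiltonian flow, with time scaled by the frequency. Its time-one
map is therefore the KdV map. -/
theorem isModifiedHamiltonian_of_eqOn (hε : 0 < ε) (hδ : 2 * δ ^ 2 < ε ^ 2) {U : Set (ℝ × ℝ)}
    (hU : IsOpen U) (hUm : U ⊆ kdvRegion ε δ)
    (hinv : ∀ γ : ℝ → ℝ × ℝ, (∀ t, γ t ∈ kdvRegion ε δ) →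
      (∀ t, kdvInvariant ε δ (γ t) = kdvInvariant ε δ (γ 0)) → γ 0 ∈ U → ∀ t, γ t ∈ U)
    {G : ℝ × ℝ → ℝ} {C : ℝ} (hG : ∀ z ∈ U, G z = δ * kdvEta ε δ (kdvInvariant ε δ z) + C) :
    IsModifiedHamiltonian (kdvMap ε δ) U G := by
  have hfield : ∀ z ∈ U, (fderiv ℝ G z (0, 1), -fderiv ℝ G z (1, 0))
      = scaledFrequency ε δ (kdvInvariant ε δ z) • kdvField ε δ z := by
    intro z hz
    have h1 := (kdvAdmissible_kdvInvariant hε hδ (hUm hz)).hasDerivAt_kdvEta hε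
    rw [← hamiltonianField_comp_kdvInvariant (h1.add_const C)]
    have h2 : G =ᶠ[𝓝 z] fun z => δ * kdvEta ε δ (kdvInvariant ε δ z) + C := by
      filter_upwards [hU.mem_nhds hz] with w hw using hG w hw
    rw [h2.fderiv_eq]
  constructor
  · refine ContDiffOn.congr (fun z hz => ?_) hG
    have h1 := ((kdvAdmissible_kdvInvariant hε hδ (hUm hz)).analyticAt_kdvEta_right
      hε).contDiffAt (n := 1)
    exact ((contDiffAt_const.mul (h1.comp z contDiff_kdvInvariant.contDiffAt)).add
      contDiffAt_const).contDiffWithinAt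
  intro z hz
  obtain ⟨Γ, hΓ0, hΓ, hΓm⟩ := exists_kdvOrbit hε (hUm hz)
  have hI := kdvInvariant_comp_eq (k := fun _ => 1) (fun t => by simpa using hΓ t)
  set ν := scaledFrequency ε δ (kdvInvariant ε δ z) with hν
  have hΓν : ∀ t, HasDerivAt (fun t => Γ (ν * t)) (ν • kdvField ε δ (Γ (ν * t))) t := by
    intro t
    have := (hΓ (ν * t)).scomp t ((hasDerivAt_id t).const_mul ν)
    simpa [Function.comp_def] using this
  have hΓU : ∀ t, Γ t ∈ U := hinv Γ hΓm (fun t => hI t 0) (hΓ0 ▸ hz)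
  constructor
  · refine ⟨fun t => Γ (ν * t), fun t => ?_, by simp [hΓ0], fun t => hΓU _⟩
    rw [hfield _ (hΓU _), hI _ 0, hΓ0]
    exact hΓν t
  · intro γ hγ hγ0 hγU n
    have hγ' : ∀ t, HasDerivAt γ
        (scaledFrequency ε δ (kdvInvariant ε δ (γ t)) • kdvField ε δ (γ t)) t := fun t => by
      rw [← hfield _ (hγU t)]
      exact hγ t
    have hIγ := kdvInvariant_comp_eq
      (k := fun t => scaledFrequency ε δ (kdvInvariant ε δ (γ t))) hγ'
    have hEq : γ = fun t => Γ (ν * t) := by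
      refine kdvOrbit_unique (k := ν) (t₀ := 0) hε (fun t => ?_) (fun t => hUm (hγU t)) hΓν
        (fun t => hΓm _) (by simp [hγ0, hΓ0])
      have := hγ' t
      rwa [hIγ t 0, hγ0, ← hν] at this
    simp only [hEq]
    induction n with
    | zero => simp [hΓ0]
    | succ n ih =>
      rw [Function.iterate_succ_apply', ← ih, kdvMap_orbit hε hδ hΓ hΓm, hΓ0, ← hν]
      push_cast
      ring_nf

theorem isModifiedHamiltonian_kdvClosedForm (hε : 0 < ε) (hδ : 2 * δ ^ 2 < ε ^ 2) :
    IsModifiedHamiltonian (kdvMap ε δ) (kdvRegion ε δ)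
      (fun z => kdvClosedForm ε δ (kdvInvariant ε δ z)) := by
  refine isModifiedHamiltonian_of_eqOn (C := 0) hε hδ isOpen_kdvRegion subset_rfl
    (fun γ h _ _ => h) fun z hz => ?_
  rw [kdvClosedForm_eq hε hδ ⟨hz.2.2, kdvInvariant_nonpos_of_mem hε hz⟩, add_zero]

theorem isModifiedHamiltonian_of_hasDerivAt (hε : 0 < ε) (hδ : 2 * δ ^ 2 < ε ^ 2) {K : ℝ → ℝ}
    (hK : ∀ P ∈ Ioo (kdvThreshold ε δ) 0, HasDerivAt K (kdvFrequency ε δ P) P) :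
    IsModifiedHamiltonian (kdvMap ε δ) (kdvRegion ε δ \ {0})
      (fun z => K (kdvInvariant ε δ z)) := by
  obtain ⟨C, hC⟩ : ∃ C, ∀ P ∈ Ioo (kdvThreshold ε δ) 0, K P = δ * kdvEta ε δ P + C := by
    have hd : ∀ P ∈ Ioo (kdvThreshold ε δ) 0,
        HasDerivAt (fun P => K P - δ * kdvEta ε δ P) 0 P := fun P hP => by
      refine ((hK P hP).sub ((kdvAdmissible_of_mem hε hδ
        ⟨hP.1, hP.2.le⟩).hasDerivAt_kdvEta hε)).congr_deriv ?_
      rw [kdvFrequency_eq_scaledFrequency hP.2, sub_self]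
    obtain ⟨C, hC⟩ := isOpen_Ioo.exists_is_const_of_deriv_eq_zero isPreconnected_Ioo
      (fun P hP => (hd P hP).differentiableAt.differentiableWithinAt) fun P hP => (hd P hP).deriv
    exact ⟨C, fun P hP => by linarith [hC P hP]⟩
  refine isModifiedHamiltonian_of_eqOn (C := C) hε hδ
    (isOpen_kdvRegion.sdiff isClosed_singleton) sdiff_subset (fun γ h hI h0 t => ⟨h t, fun ht => ?_⟩)
    fun z hz => hC _ ⟨hz.1.2.2, kdvInvariant_neg_of_mem hε hz.1 hz.2⟩
  have h1 := kdvInvariant_neg_of_mem hε h0.1 h0.2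
  rw [← hI t, ht] at h1
  simp [kdvInvariant] at h1

end ModifiedHamiltonian

/-! ### The derivative of the modified Hamiltonian with respect to the step size -/

section StepIdentity

variable {ε δ P : ℝ}

theorem kdvField_zero : kdvField ε δ 0 = 0 := by
  ext <;> simp [kdvField]

theorem hasDerivAt_kdvPotential_comp {γ : ℝ → ℝ × ℝ} {t : ℝ}
    (hγ : HasDerivAt γ (kdvField ε δ (γ t)) t) (h : ε ^ 2 - (γ t).1 ^ 2 ≠ 0) :
    HasDerivAt (fun t => kdvPotential ε (γ t))
      (2 * ε * (γ t).1 * ((γ t).2 + (kdvMap ε δ (γ t)).2)) t := by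
  have h1 : HasDerivAt (fun t => (γ t).1) (kdvField ε δ (γ t)).1 t :=
    (hasFDerivAt_fst (p := γ t)).comp_hasDerivAt t hγ
  refine (((hasDerivAt_log_sub_sq h).comp t h1).const_mul ε).congr_deriv ?_
  rw [kdvMap_snd]
  simp only [kdvField]
  field_simp
  ring

theorem hasDerivAt_kdvKinetic_comp {γ : ℝ → ℝ × ℝ} {t : ℝ} {z : ℝ × ℝ}
    (hγ : HasDerivAt γ (kdvField ε δ (γ t)) t) (h : ε ^ 2 - (γ t).2 ^ 2 ≠ 0)
    (hz : kdvMap ε δ z = γ t) :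
    HasDerivAt (fun t => kdvKinetic ε (γ t)) (-2 * ε * (γ t).2 * ((γ t).1 + z.1)) t := by
  have h1 : HasDerivAt (fun t => (γ t).2) (kdvField ε δ (γ t)).2 t :=
    (hasFDerivAt_snd (p := γ t)).comp_hasDerivAt t hγ
  refine (((hasDerivAt_log_sub_sq h).comp t h1).const_mul ε).congr_deriv ?_
  have h2 := kdvMap_fst (ε := ε) (δ := δ) z
  rw [hz] at h2
  have h3 : z.1 = (γ t).1 + 2 * ε * δ * (γ t).2 / (ε ^ 2 - (γ t).2 ^ 2) := by linarith
  rw [h3]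
  simp only [kdvField]
  field_simp
  ring

/-- The derivative with respect to the step size of the modified Hamiltonian at a fixed value of
the invariant, in terms of an orbit that starts at `q = 0`. -/
theorem kdvPotential_add_kdvKinetic_start (hε : 0 < ε) (hδ : 2 * δ ^ 2 < ε ^ 2)
    (hP : P ∈ Ioo (kdvThreshold ε δ) 0) {γ : ℝ → ℝ × ℝ}
    (hγ : ∀ t, HasDerivAt γ (kdvField ε δ (γ t)) t) (hγm : ∀ t, γ t ∈ kdvRegion ε δ)
    (h0 : γ 0 = (0, -√(-P) / ε)) :
    HasDerivAt (fun δ => δ * kdvEta ε δ P)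
      (kdvPotential ε (γ 0) + kdvKinetic ε (kdvMap ε δ (γ 0))
        + 2 * ε * ∫ σ in (0 : ℝ)..scaledFrequency ε δ P, (γ σ).1 * (γ σ).2) δ := by
  have h := kdvAdmissible_of_mem hε hδ ⟨hP.1, hP.2.le⟩
  have hS := h.pos
  have ha : √(-P) ^ 2 = -P := Real.sq_sqrt (by linarith [h.2.1])
  refine (h.hasDerivAt_mul_kdvEta hε).congr_deriv ?_
  obtain ⟨T, hT0, hT1, hTd, hT⟩ := exists_kdvArc_time hε hδ hP hγ hγm h0
  have hcont : Continuous γ := continuous_iff_continuousAt.2 fun t => (hγ t).continuousAt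
  have hint := intervalIntegral.integral_comp_mul_deriv (a := 0) (b := 1) (f := T)
    (g := fun σ => (γ σ).1 * (γ σ).2) (fun u hu => hTd u (by rwa [uIcc_of_le zero_le_one] at hu))
    (by rw [uIcc_of_le zero_le_one]; exact h.continuousOn_speed hε) (by fun_prop)
  rw [hT0, hT1] at hint
  rw [← hint, ← intervalIntegral.integral_const_mul]
  congr 1
  · have h1 : (kdvMap ε δ (γ 0)).2 = -√(-P) / ε := by
      rw [kdvMap_snd, h0]
      simp
    simp only [kdvPotential, kdvKinetic, h1]
    rw [h0, ← mul_add, div_pow, neg_sq, ha, ← Real.log_mul (by simpa using hε.ne')]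
    · congr 2
      field_simp
      ring
    · rw [show ε ^ 2 - -P / ε ^ 2 = (ε ^ 4 + P) / ε ^ 2 by field_simp; ring]
      positivity
  · refine intervalIntegral.integral_congr fun u hu => ?_
    rw [uIcc_of_le zero_le_one] at hu
    have hs := (h.sqrt_pos hε hu).ne'
    simp only [Function.comp_apply, ← hT u hu, kdvArc]
    field_simp
    rw [ha]
    ring

/-- The key identity behind the agreement with the Baker-Campbell-Hausdorff series. Summing the
potential at a point and the kinetic energy at its image gives the derivative of the modified
Hamiltonian with respect to the step size, averaged over the orbit between the two points. -/
theorem hasDerivAt_mul_kdvEta_orbit (hε : 0 < ε) (hδ : 2 * δ ^ 2 < ε ^ 2) {γ : ℝ → ℝ × ℝ}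
    (hγ : ∀ t, HasDerivAt γ (kdvField ε δ (γ t)) t) (hγm : ∀ t, γ t ∈ kdvRegion ε δ) :
    HasDerivAt (fun δ' => δ' * kdvEta ε δ' (kdvInvariant ε δ (γ 0)))
      (kdvPotential ε (γ 0) + kdvKinetic ε (kdvMap ε δ (γ 0))
        + 2 * ε * ∫ σ in (0 : ℝ)..scaledFrequency ε δ (kdvInvariant ε δ (γ 0)),
          (γ σ).1 * (γ σ).2) δ := by
  by_cases h0 : γ 0 = 0
  · have : γ = fun _ => 0 := kdvOrbit_unique (k := 1) (t₀ := 0) hε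
      (fun t => by rw [one_smul]; exact hγ t) hγm
      (fun t => by
        rw [one_smul, kdvField_zero]
        exact hasDerivAt_const t 0) (fun t => zero_mem_kdvRegion hε hδ) h0
    subst this
    have hI : kdvInvariant ε δ 0 = 0 := by simp [kdvInvariant]
    simp only [kdvMap_zero, hI, kdvEta_zero]
    refine ((hasDerivAt_id δ).mul_const _).congr_deriv ?_
    simp [kdvPotential, kdvKinetic, Real.log_pow]
    ring
  have hI := kdvInvariant_comp_eq (k := fun _ => 1) (fun t => by simpa using hγ t)
  have hP : kdvInvariant ε δ (γ 0) ∈ Ioo (kdvThreshold ε δ) 0 :=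
    ⟨(hγm 0).2.2, kdvInvariant_neg_of_mem hε (hγm 0) h0⟩
  have hmap := kdvMap_orbit hε hδ hγ hγm
  set P := kdvInvariant ε δ (γ 0) with hPdef
  set ν := scaledFrequency ε δ P
  have hcont : Continuous γ := continuous_iff_continuousAt.2 fun t => (hγ t).continuousAt
  have hqp : Continuous fun σ => (γ σ).1 * (γ σ).2 := by fun_prop
  have hshift : ∀ s t, HasDerivAt (fun t => γ (t + s)) (kdvField ε δ (γ (t + s))) t :=
    fun s t => (hγ (t + s)).comp_add_const t s
  set F : ℝ → ℝ := fun t => ∫ σ in (0 : ℝ)..t, (γ σ).1 * (γ σ).2 with hF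
  have hFd : ∀ t, HasDerivAt F ((γ t).1 * (γ t).2) t := fun t =>
    (hqp.integral_hasStrictDerivAt 0 t).hasDerivAt
  have hFsub : ∀ t s, F (t + s) - F t = ∫ σ in (0 : ℝ)..s, (γ (σ + t)).1 * (γ (σ + t)).2 := by
    intro t s
    rw [intervalIntegral.integral_comp_add_right (fun σ => (γ σ).1 * (γ σ).2), zero_add, hF]
    simp only
    rw [intervalIntegral.integral_interval_sub_left (hqp.intervalIntegrable _ _)
      (hqp.intervalIntegrable _ _), add_comm]
  -- the sum of the two energies plus the action of `2 ε q p` along one step is conserved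
  have hconst : ∀ t, HasDerivAt (fun t => kdvPotential ε (γ t) + kdvKinetic ε (γ (t + ν))
      + 2 * ε * (F (t + ν) - F t)) 0 t := by
    intro t
    have h1 := hasDerivAt_kdvPotential_comp (hγ t) (kdvRegion_sub_sq_pos hε (hγm t)).1.ne'
    have h2 := hasDerivAt_kdvKinetic_comp (γ := fun t => γ (t + ν)) (t := t) (z := γ t)
      (hshift ν t) (kdvRegion_sub_sq_pos hε (hγm _)).2.ne' (hmap t)
    have h3 := ((hFd (t + ν)).comp_add_const t ν).sub (hFd t)
    refine ((h1.add h2).add (h3.const_mul (2 * ε))).congr_deriv ?_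
    rw [hmap t]
    ring
  obtain ⟨t₀, ht₀⟩ := exists_kdvOrbit_fst_eq_zero hε hδ hγ hγm h0
  have hΨ := is_const_of_deriv_eq_zero (fun t => (hconst t).differentiableAt)
    (fun t => (hconst t).deriv) 0 t₀
  simp only [zero_add] at hΨ
  have hgoal : kdvPotential ε (γ 0) + kdvKinetic ε (kdvMap ε δ (γ 0)) + 2 * ε * F ν
      = kdvPotential ε (γ t₀) + kdvKinetic ε (kdvMap ε δ (γ t₀))
        + 2 * ε * ∫ σ in (0 : ℝ)..ν, (γ (σ + t₀)).1 * (γ (σ + t₀)).2 := by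
    rw [hmap 0, hmap t₀, zero_add, ← hFsub, ← hΨ]
    simp [hF]
  change HasDerivAt _ (_ + 2 * ε * F ν) δ
  rw [hgoal]
  -- the symmetry `z ↦ -z` reduces a crossing with `p > 0` to one with `p < 0`
  rcases eq_or_eq_of_fst_eq_zero (δ := δ) hε ht₀ with h | h
  · rw [hI t₀ 0, ← hPdef] at h
    have := kdvPotential_add_kdvKinetic_start hε hδ hP (hshift t₀) (fun t => hγm _) (by simpa using h)
    simpa using this
  · rw [hI t₀ 0, ← hPdef] at h
    have := kdvPotential_add_kdvKinetic_start (γ := fun t => -γ (t + t₀)) hε hδ hP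
      (fun t => by rw [kdvField_neg]; exact (hshift t₀ t).neg)
      (fun t => neg_mem_kdvRegion (hγm _)) (by simpa using h)
    simpa [kdvMap_neg, kdvPotential, kdvKinetic] using this

end StepIdentity

/-! ### Taylor coefficients of analytic families of functions on phase space -/

section AnalyticFamily

variable {G H : ℝ → ℝ × ℝ → ℝ} {δ : ℝ} {z : ℝ × ℝ}

theorem hasFDerivAt_of_uncurry (hG : DifferentiableAt ℝ (Function.uncurry G) (δ, z)) :
    HasFDerivAt (G δ) ((fderiv ℝ (Function.uncurry G) (δ, z)).comp
      (ContinuousLinearMap.inr ℝ ℝ (ℝ × ℝ))) z :=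
  hG.hasFDerivAt.comp (g := Function.uncurry G) z (hasFDerivAt_prodMk_right δ z)

theorem fderiv_apply_of_uncurry (hG : DifferentiableAt ℝ (Function.uncurry G) (δ, z))
    (v : ℝ × ℝ) : fderiv ℝ (G δ) z v = fderiv ℝ (Function.uncurry G) (δ, z) (0, v) := by
  rw [(hasFDerivAt_of_uncurry hG).fderiv]
  simp

theorem hasDerivAt_of_uncurry (hG : DifferentiableAt ℝ (Function.uncurry G) (δ, z)) :
    HasDerivAt (fun δ => G δ z) (fderiv ℝ (Function.uncurry G) (δ, z) (1, 0)) δ := by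
  have h := hG.hasFDerivAt.comp_hasDerivAt δ ((hasDerivAt_id δ).prodMk (hasDerivAt_const δ z))
  exact h

theorem AnalyticAt.fderiv_apply {x v : ℝ × ℝ × ℝ} {f : ℝ × ℝ × ℝ → ℝ} (hf : AnalyticAt ℝ f x) :
    AnalyticAt ℝ (fun x => fderiv ℝ f x v) x :=
  AnalyticAt.fun_comp ((ContinuousLinearMap.apply ℝ ℝ v).analyticAt _) hf.fderiv

theorem AnalyticAt.eventually_differentiableAt {x : ℝ × ℝ × ℝ} {f : ℝ × ℝ × ℝ → ℝ}
    (hf : AnalyticAt ℝ f x) : ∀ᶠ y in 𝓝 x, DifferentiableAt ℝ f y :=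
  hf.eventually_analyticAt.mono fun _ h => h.differentiableAt

theorem AnalyticAt.uncurry_fderiv (hG : AnalyticAt ℝ (Function.uncurry G) (δ, z)) (v : ℝ × ℝ) :
    AnalyticAt ℝ (Function.uncurry fun δ z => fderiv ℝ (G δ) z v) (δ, z) := by
  refine (hG.fderiv_apply (v := (0, v))).congr ?_
  filter_upwards [hG.eventually_differentiableAt] with x hx
  exact (fderiv_apply_of_uncurry (δ := x.1) (z := x.2) hx v).symm

theorem AnalyticAt.uncurry_deriv (hG : AnalyticAt ℝ (Function.uncurry G) (δ, z)) :
    AnalyticAt ℝ (Function.uncurry fun δ z => deriv (fun δ => G δ z) δ) (δ, z) := by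
  refine (hG.fderiv_apply (v := (1, 0))).congr ?_
  filter_upwards [hG.eventually_differentiableAt] with x hx
  exact (hasDerivAt_of_uncurry (δ := x.1) (z := x.2) hx).deriv.symm

theorem AnalyticAt.uncurry_right (hG : AnalyticAt ℝ (Function.uncurry G) (δ, z)) :
    AnalyticAt ℝ (G δ) z :=
  AnalyticAt.fun_comp_of_eq (g := Function.uncurry G) (f := fun z => (δ, z)) hG
    (analyticAt_const.prod analyticAt_id) rfl

theorem AnalyticAt.uncurry_left (hG : AnalyticAt ℝ (Function.uncurry G) (δ, z)) :
    AnalyticAt ℝ (fun δ => G δ z) δ :=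
  AnalyticAt.fun_comp_of_eq (g := Function.uncurry G) (f := fun δ => (δ, z)) hG
    (analyticAt_id.prod analyticAt_const) rfl

theorem AnalyticAt.uncurry_poissonBracket (hG : AnalyticAt ℝ (Function.uncurry G) (δ, z))
    (hH : AnalyticAt ℝ (Function.uncurry H) (δ, z)) :
    AnalyticAt ℝ (Function.uncurry fun δ => poissonBracket (G δ) (H δ)) (δ, z) :=
  ((hG.uncurry_fderiv (1, 0)).mul (hH.uncurry_fderiv (0, 1))).sub
    ((hG.uncurry_fderiv (0, 1)).mul (hH.uncurry_fderiv (1, 0)))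

theorem deriv_fderiv_apply (hG : AnalyticAt ℝ (Function.uncurry G) (δ, z)) (v : ℝ × ℝ) :
    deriv (fun δ => fderiv ℝ (G δ) z v) δ = fderiv ℝ (fun z => deriv (fun δ => G δ z) δ) z v := by
  have hd := hG.eventually_differentiableAt
  have hd2 : DifferentiableAt ℝ (fderiv ℝ (Function.uncurry G)) (δ, z) := hG.fderiv.differentiableAt
  have h1 : (fun δ => fderiv ℝ (G δ) z v) =ᶠ[𝓝 δ]
      fun δ => fderiv ℝ (Function.uncurry G) (δ, z) (0, v) := by
    have hc : Tendsto (fun δ : ℝ => (δ, z)) (𝓝 δ) (𝓝 (δ, z)) :=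
      Continuous.tendsto (by fun_prop) _
    filter_upwards [hc.eventually hd] with x hx using fderiv_apply_of_uncurry hx v
  have h2 : (fun z => deriv (fun δ => G δ z) δ) =ᶠ[𝓝 z]
      fun z => fderiv ℝ (Function.uncurry G) (δ, z) (1, 0) := by
    have hc : Tendsto (fun z : ℝ × ℝ => (δ, z)) (𝓝 z) (𝓝 (δ, z)) :=
      Continuous.tendsto (by fun_prop) _
    filter_upwards [hc.eventually hd] with x hx using (hasDerivAt_of_uncurry hx).deriv
  rw [h1.deriv_eq, h2.fderiv_eq]
  have e1 : HasDerivAt (fun δ => fderiv ℝ (Function.uncurry G) (δ, z) (0, v))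
      (fderiv ℝ (fderiv ℝ (Function.uncurry G)) (δ, z) (1, 0) (0, v)) δ := by
    have h3 := hd2.hasFDerivAt.comp_hasDerivAt δ ((hasDerivAt_id δ).prodMk (hasDerivAt_const δ z))
    exact h3.clm_apply (hasDerivAt_const δ ((0 : ℝ), v)) |>.congr_deriv (by simp)
  have e2 : fderiv ℝ (fun z => fderiv ℝ (Function.uncurry G) (δ, z) (1, 0)) z v
      = fderiv ℝ (fderiv ℝ (Function.uncurry G)) (δ, z) (0, v) (1, 0) := by
    have h3 := hd2.hasFDerivAt.comp z (hasFDerivAt_prodMk_right δ z)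
    have h4 := h3.clm_apply (hasFDerivAt_const ((1 : ℝ), (0 : ℝ × ℝ)) z)
    change fderiv ℝ (fun y => ((fderiv ℝ (Function.uncurry G) ∘ fun z => (δ, z)) y) (1, 0)) z v = _
    rw [h4.fderiv]
    simp
  rw [e1.deriv, e2]
  have hs : IsSymmSndFDerivAt ℝ (Function.uncurry G) (δ, z) :=
    (hG.contDiffAt (n := 2)).isSymmSndFDerivAt (by simp)
  exact hs _ _

theorem iteratedDeriv_fderiv_apply (hG : AnalyticAt ℝ (Function.uncurry G) (δ, z)) (v : ℝ × ℝ)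
    (n : ℕ) : iteratedDeriv n (fun δ => fderiv ℝ (G δ) z v) δ
      = fderiv ℝ (fun z => iteratedDeriv n (fun δ => G δ z) δ) z v := by
  induction n generalizing G with
  | zero => simp
  | succ n ih =>
    simp only [iteratedDeriv_succ']
    rw [← ih (G := fun δ z => deriv (fun δ => G δ z) δ) hG.uncurry_deriv]
    refine Filter.EventuallyEq.iteratedDeriv_eq n ?_
    have hc : Tendsto (fun δ : ℝ => (δ, z)) (𝓝 δ) (𝓝 (δ, z)) :=
      Continuous.tendsto (by fun_prop) _
    filter_upwards [hc.eventually hG.eventually_analyticAt] with x hx using deriv_fderiv_apply hx v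

theorem analyticAt_iteratedDeriv (hG : AnalyticAt ℝ (Function.uncurry G) (δ, z)) (n : ℕ) :
    AnalyticAt ℝ (fun z => iteratedDeriv n (fun δ => G δ z) δ) z := by
  induction n generalizing G with
  | zero => simpa using hG.uncurry_right
  | succ n ih =>
    simp only [iteratedDeriv_succ']
    exact ih (G := fun δ z => deriv (fun δ => G δ z) δ) hG.uncurry_deriv

end AnalyticFamily

noncomputable section

/-- The `n`-th Taylor coefficient at `δ = 0` of a family `G δ` of functions on phase space. -/
def familyCoeff (G : ℝ → ℝ × ℝ → ℝ) (n : ℕ) (z : ℝ × ℝ) : ℝ :=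
  iteratedDeriv n (fun δ => G δ z) 0 / (n.factorial : ℝ)

end

section Coefficients

variable {G H : ℝ → ℝ × ℝ → ℝ} {z : ℝ × ℝ}

theorem iteratedDeriv_mul_div_factorial {f g : ℝ → ℝ} {x : ℝ} (hf : AnalyticAt ℝ f x)
    (hg : AnalyticAt ℝ g x) (n : ℕ) :
    iteratedDeriv n (fun x => f x * g x) x / (n.factorial : ℝ)
      = ∑ p ∈ Finset.HasAntidiagonal.antidiagonal n, iteratedDeriv p.1 f x / (p.1.factorial : ℝ)
        * (iteratedDeriv p.2 g x / (p.2.factorial : ℝ)) := by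
  have h := iteratedDeriv_mul (n := n) hf.contDiffAt hg.contDiffAt
  change iteratedDeriv n (f * g) x / _ = _
  rw [h, Finset.sum_div, Finset.Nat.sum_antidiagonal_eq_sum_range_succ
    (fun i j => iteratedDeriv i f x / (i.factorial : ℝ) * (iteratedDeriv j g x / (j.factorial : ℝ)))]
  refine Finset.sum_congr rfl fun i hi => ?_
  have hi' : i ≤ n := Nat.lt_succ_iff.1 (Finset.mem_range.1 hi)
  rw [Nat.cast_choose ℝ hi']
  have h1 : (n.factorial : ℝ) ≠ 0 := by positivity
  have h2 : (i.factorial : ℝ) ≠ 0 := by positivity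
  have h3 : ((n - i).factorial : ℝ) ≠ 0 := by positivity
  field_simp

theorem iteratedDeriv_fderiv_div_factorial (hG : AnalyticAt ℝ (Function.uncurry G) (0, z))
    (v : ℝ × ℝ) (n : ℕ) :
    iteratedDeriv n (fun δ => fderiv ℝ (G δ) z v) 0 / (n.factorial : ℝ)
      = fderiv ℝ (familyCoeff G n) z v := by
  have h : familyCoeff G n
      = fun z => iteratedDeriv n (fun δ => G δ z) 0 * (n.factorial : ℝ)⁻¹ := rfl
  rw [iteratedDeriv_fderiv_apply hG, h,
    fderiv_mul_const (analyticAt_iteratedDeriv hG n).differentiableAt]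
  simp [div_eq_mul_inv, mul_comm]

theorem analyticAt_familyCoeff (hG : AnalyticAt ℝ (Function.uncurry G) (0, z)) (n : ℕ) :
    AnalyticAt ℝ (familyCoeff G n) z :=
  (analyticAt_iteratedDeriv hG n).div_const

theorem familyCoeff_poissonBracket (hG : AnalyticAt ℝ (Function.uncurry G) (0, z))
    (hH : AnalyticAt ℝ (Function.uncurry H) (0, z)) (n : ℕ) :
    familyCoeff (fun δ => poissonBracket (G δ) (H δ)) n z
      = ∑ p ∈ Finset.HasAntidiagonal.antidiagonal n,
        poissonBracket (familyCoeff G p.2) (familyCoeff H p.1) z := by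
  have hG' := fun v => (hG.uncurry_fderiv v).uncurry_left
  have hH' := fun v => (hH.uncurry_fderiv v).uncurry_left
  have h1 : ∀ v w, AnalyticAt ℝ (fun δ => fderiv ℝ (H δ) z v * fderiv ℝ (G δ) z w) 0 :=
    fun v w => (hH' v).mul (hG' w)
  have h2 : familyCoeff (fun δ => poissonBracket (G δ) (H δ)) n z
      = iteratedDeriv n ((fun δ => fderiv ℝ (H δ) z (0, 1) * fderiv ℝ (G δ) z (1, 0))
        - fun δ => fderiv ℝ (H δ) z (1, 0) * fderiv ℝ (G δ) z (0, 1)) 0 / (n.factorial : ℝ) := by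
    unfold familyCoeff
    congr 2
    funext δ
    simp only [poissonBracket, Pi.sub_apply]
    ring
  rw [h2, iteratedDeriv_sub (h1 _ _).contDiffAt (h1 _ _).contDiffAt, sub_div,
    iteratedDeriv_mul_div_factorial (hH' _) (hG' _), iteratedDeriv_mul_div_factorial (hH' _) (hG' _),
    ← Finset.sum_sub_distrib]
  refine Finset.sum_congr rfl fun p _ => ?_
  simp only [iteratedDeriv_fderiv_div_factorial hG, iteratedDeriv_fderiv_div_factorial hH,
    poissonBracket]
  ring

theorem familyCoeff_deriv (n : ℕ) :
    familyCoeff (fun δ z => deriv (fun δ => G δ z) δ) n z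
      = ((n : ℝ) + 1) * familyCoeff G (n + 1) z := by
  unfold familyCoeff
  rw [iteratedDeriv_succ', Nat.factorial_succ]
  push_cast
  field_simp

theorem familyCoeff_const (F : ℝ × ℝ → ℝ) (n : ℕ) :
    familyCoeff (fun _ => F) n z = if n = 0 then F z else 0 := by
  unfold familyCoeff
  rw [iteratedDeriv_const]
  split_ifs with h
  · simp [h]
  · simp

end Coefficients

section Remainder

/-- An analytic function that is `O(x ^ n)` has vanishing derivatives of all orders below `n`. -/
theorem AnalyticAt.iteratedDeriv_eq_zero_of_isBigO {f : ℝ → ℝ} (hf : AnalyticAt ℝ f 0) {n : ℕ}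
    (hO : f =O[𝓝 0] fun x : ℝ => x ^ n) : ∀ i < n, iteratedDeriv i f 0 = 0 := by
  rw [← natCast_le_analyticOrderAt_iff_iteratedDeriv_eq_zero hf]
  by_contra hlt
  rw [not_le] at hlt
  obtain ⟨m, hm⟩ := ENat.ne_top_iff_exists.1 hlt.ne_top
  rw [← hm, Nat.cast_lt] at hlt
  obtain ⟨g, hg, hg0, hfg⟩ := hf.analyticOrderAt_eq_natCast.1 hm.symm
  obtain ⟨C, hC⟩ := hO.bound
  have h1 : ∀ᶠ x : ℝ in 𝓝[≠] 0, |g x| ≤ C * |x| := by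
    filter_upwards [hC.filter_mono nhdsWithin_le_nhds, hfg.filter_mono nhdsWithin_le_nhds,
      self_mem_nhdsWithin, nhdsWithin_le_nhds (Metric.ball_mem_nhds (0 : ℝ) one_pos)]
      with x h1 h2 h3 h4
    rw [h2] at h1
    have hx : 0 < |x| := abs_pos.2 h3
    have hx1 : |x| ≤ 1 := by
      rw [mem_ball_zero_iff, Real.norm_eq_abs] at h4
      exact h4.le
    simp only [sub_zero, smul_eq_mul, norm_mul, norm_pow, Real.norm_eq_abs] at h1
    have h5 : |x| ^ n = |x| ^ m * (|x| * |x| ^ (n - m - 1)) := by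
      rw [← pow_succ', ← pow_add]
      congr 1
      omega
    have hC0 : 0 ≤ C := by
      by_contra hneg
      have : 0 ≤ |x| ^ m * |g x| := by positivity
      nlinarith [pow_pos hx n]
    rw [h5] at h1
    have h6 : |x| ^ m * |g x| ≤ |x| ^ m * (C * (|x| * |x| ^ (n - m - 1))) := by linarith
    refine (le_of_mul_le_mul_left h6 (by positivity)).trans ?_
    have h7 : |x| ^ (n - m - 1) ≤ 1 := pow_le_one₀ hx.le hx1
    have h8 : 0 ≤ C * |x| := by positivity
    nlinarith
  have h2 : Tendsto (fun x : ℝ => |g x|) (𝓝[≠] 0) (𝓝 |g 0|) :=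
    (hg.continuousAt.abs).tendsto.mono_left nhdsWithin_le_nhds
  have h3 : Tendsto (fun x : ℝ => C * |x|) (𝓝[≠] 0) (𝓝 (C * |(0 : ℝ)|)) :=
    (Continuous.tendsto (by fun_prop) 0).mono_left nhdsWithin_le_nhds
  have h4 := le_of_tendsto_of_tendsto h2 h3 h1
  simp only [abs_zero, mul_zero] at h4
  exact hg0 (abs_nonpos_iff.1 h4)

/-- Taylor's formula on `[0, 1]` for a chain of successive derivatives. -/
theorem abs_sub_taylor_le {N : ℕ} {M : ℝ} : ∀ {u : ℕ → ℝ → ℝ},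
    (∀ k ≤ N, ∀ s ∈ Icc (0 : ℝ) 1, HasDerivWithinAt (u k) (u (k + 1) s) (Icc 0 1) s) →
    (∀ s ∈ Icc (0 : ℝ) 1, |u (N + 1) s| ≤ M) → ∀ s ∈ Icc (0 : ℝ) 1,
    |u 0 s - ∑ k ∈ Finset.range (N + 1), u k 0 * s ^ k / (k.factorial : ℝ)| ≤ M := by
  have key : ∀ {φ φ' : ℝ → ℝ}, (∀ s ∈ Icc (0 : ℝ) 1, HasDerivWithinAt φ (φ' s) (Icc 0 1) s) →
      (∀ s ∈ Icc (0 : ℝ) 1, |φ' s| ≤ M) → φ 0 = 0 → ∀ s ∈ Icc (0 : ℝ) 1, |φ s| ≤ M := by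
    intro φ φ' h1 h2 h0 s hs
    have hM : 0 ≤ M := (abs_nonneg _).trans (h2 0 (by simp))
    have := (convex_Icc (0 : ℝ) 1).norm_image_sub_le_of_norm_hasDerivWithin_le (x := 0) (y := s)
      h1 h2 (by simp) hs
    rw [h0, sub_zero, sub_zero, Real.norm_eq_abs, Real.norm_eq_abs, abs_of_nonneg hs.1] at this
    exact this.trans (mul_le_of_le_one_right hM hs.2)
  induction N with
  | zero =>
    intro u hu hM s hs
    refine key (φ := fun s => u 0 s - ∑ k ∈ Finset.range (0 + 1), u k 0 * s ^ k / (k.factorial : ℝ))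
      (φ' := u 1) (fun s hs => ?_) hM (by simp) s hs
    simpa using (hu 0 le_rfl s hs).sub_const (u 0 0)
  | succ N ih =>
    intro u hu hM s hs
    refine key (φ := fun s =>
        u 0 s - ∑ k ∈ Finset.range (N + 1 + 1), u k 0 * s ^ k / (k.factorial : ℝ))
      (φ' := fun s => u 1 s - ∑ k ∈ Finset.range (N + 1), u (k + 1) 0 * s ^ k / (k.factorial : ℝ))
      (fun s hs => ?_)
      (ih (u := fun k => u (k + 1)) (fun k hk => hu (k + 1) (by omega)) hM) ?_ s hs
    · refine (hu 0 (by omega) s hs).sub ?_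
      have h1 : HasDerivAt (fun s : ℝ => (∑ k ∈ Finset.range (N + 1),
          u (k + 1) 0 * s ^ (k + 1) / ((k + 1).factorial : ℝ)) + u 0 0)
          (∑ k ∈ Finset.range (N + 1), u (k + 1) 0 * s ^ k / (k.factorial : ℝ)) s := by
        refine (HasDerivAt.fun_sum fun k _ => ?_).add_const _
        refine (((hasDerivAt_pow (k + 1) s).const_mul (u (k + 1) 0)).div_const _).congr_deriv ?_
        rw [Nat.factorial_succ]
        push_cast
        have : ((k.factorial : ℝ)) ≠ 0 := by positivity
        field_simp
      refine h1.hasDerivWithinAt.congr_of_eventuallyEq ?_ ?_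
      · refine Eventually.of_forall fun s => ?_
        simp [Finset.sum_range_succ' _ (N + 1)]
      · simp [Finset.sum_range_succ' _ (N + 1)]
    · simp [Finset.sum_range_succ' _ (N + 1)]

/-- The version of `abs_sub_taylor_le` for the integral over `[0, 1]`. -/
theorem abs_integral_sub_taylor_le {N : ℕ} {M : ℝ} {u : ℕ → ℝ → ℝ}
    (hu : ∀ k ≤ N, ∀ s ∈ Icc (0 : ℝ) 1, HasDerivWithinAt (u k) (u (k + 1) s) (Icc 0 1) s)
    (hM : ∀ s ∈ Icc (0 : ℝ) 1, |u (N + 1) s| ≤ M) :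
    |(∫ s in (0 : ℝ)..1, u 0 s)
      - ∑ k ∈ Finset.range (N + 1), u k 0 / ((k + 1).factorial : ℝ)| ≤ M := by
  have hc : ContinuousOn (u 0) (Icc 0 1) := fun s hs => (hu 0 (by omega) s hs).continuousWithinAt
  have hcp : Continuous fun t : ℝ => u 0 (projIcc 0 1 zero_le_one t) :=
    hc.comp_continuous (by fun_prop) fun t => (projIcc (0 : ℝ) 1 zero_le_one t).2
  set v : ℕ → ℝ → ℝ := fun k => Nat.casesOn k
    (fun s => ∫ t in (0 : ℝ)..s, u 0 (projIcc 0 1 zero_le_one t)) u with hv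
  have h := abs_sub_taylor_le (N := N + 1) (u := v) (M := M) (fun k hk s hs => ?_) hM 1 (by simp)
  · have h1 : v 0 1 = ∫ s in (0 : ℝ)..1, u 0 s := by
      refine intervalIntegral.integral_congr fun s hs => ?_
      rw [uIcc_of_le zero_le_one] at hs
      simp only [projIcc_of_mem _ hs]
    have h2 : v 0 0 = 0 := intervalIntegral.integral_same
    rw [Finset.sum_range_succ', h1, h2] at h
    simpa [hv] using h
  · cases k with
    | zero =>
      refine ((hcp.integral_hasStrictDerivAt 0 s).hasDerivAt.congr_deriv ?_).hasDerivWithinAt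
      simp only [projIcc_of_mem _ hs]
      rfl
    | succ k => exact hu k (by omega) s hs

end Remainder

/-! ### The Poisson algebra of analytic functions and the series of Taylor coefficients -/

noncomputable section

/-- The functions that are analytic on `Q`, normalised to vanish outside `Q`. -/
def analyticFunctions (Q : Set (ℝ × ℝ)) : Submodule ℝ (ℝ × ℝ → ℝ) where
  carrier := {F | AnalyticOnNhd ℝ F Q ∧ ∀ z ∉ Q, F z = 0}
  add_mem' hF hG := ⟨hF.1.add hG.1, fun z hz => by simp [hF.2 z hz, hG.2 z hz]⟩
  zero_mem' := ⟨analyticOnNhd_const, fun _ _ => rfl⟩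
  smul_mem' c F hF := ⟨fun z hz => analyticAt_const.smul (hF.1 z hz), fun z hz => by simp [hF.2 z hz]⟩

end

section PoissonAlgebra

variable {Q : Set (ℝ × ℝ)} {F G F' G' : ℝ × ℝ → ℝ} {z : ℝ × ℝ}

theorem mem_analyticFunctions :
    F ∈ analyticFunctions Q ↔ AnalyticOnNhd ℝ F Q ∧ ∀ z ∉ Q, F z = 0 := Iff.rfl

theorem poissonBracket_congr (hQ : IsOpen Q) (hF : EqOn F F' Q) (hG : EqOn G G' Q) :
    EqOn (poissonBracket F G) (poissonBracket F' G') Q := fun z hz => by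
  have h1 : F =ᶠ[𝓝 z] F' := hF.eventuallyEq_of_mem (hQ.mem_nhds hz)
  have h2 : G =ᶠ[𝓝 z] G' := hG.eventuallyEq_of_mem (hQ.mem_nhds hz)
  simp only [poissonBracket, h1.fderiv_eq, h2.fderiv_eq]

theorem AnalyticOnNhd.poissonBracket (hF : AnalyticOnNhd ℝ F Q) (hG : AnalyticOnNhd ℝ G Q) :
    AnalyticOnNhd ℝ (poissonBracket F G) Q := fun z hz => by
  have h : ∀ {F : ℝ × ℝ → ℝ}, AnalyticAt ℝ F z → ∀ v, AnalyticAt ℝ (fun z => fderiv ℝ F z v) z :=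
    fun hF v => AnalyticAt.fun_comp ((ContinuousLinearMap.apply ℝ ℝ v).analyticAt _) hF.fderiv
  exact ((h (hF z hz) _).mul (h (hG z hz) _)).sub ((h (hF z hz) _).mul (h (hG z hz) _))

theorem AnalyticOnNhd.indicator_mem (hQ : IsOpen Q) (hF : AnalyticOnNhd ℝ F Q) :
    Q.indicator F ∈ analyticFunctions Q :=
  mem_analyticFunctions.2 ⟨hF.congr hQ fun _ hz => (indicator_of_mem hz F).symm, fun _ hz => indicator_of_notMem hz F⟩

theorem poissonBracket_add_left (hF : DifferentiableAt ℝ F z) (hF' : DifferentiableAt ℝ F' z) :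
    poissonBracket (F + F') G z = poissonBracket F G z + poissonBracket F' G z := by
  simp only [poissonBracket, fderiv_add hF hF', add_apply]
  ring

theorem poissonBracket_smul_left (c : ℝ) : poissonBracket (c • F) G z = c * poissonBracket F G z := by
  simp only [poissonBracket, fderiv_const_smul_field, Pi.smul_apply, smul_apply, smul_eq_mul]
  ring

theorem poissonBracket_swap : poissonBracket F G z = -poissonBracket G F z := by
  simp only [poissonBracket]
  ring

theorem poissonBracket_add_right (hG : DifferentiableAt ℝ G z) (hG' : DifferentiableAt ℝ G' z) :
    poissonBracket F (G + G') z = poissonBracket F G z + poissonBracket F G' z := by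
  rw [poissonBracket_swap, poissonBracket_add_left hG hG', poissonBracket_swap (F := G),
    poissonBracket_swap (F := G')]
  ring

theorem poissonBracket_smul_right (c : ℝ) :
    poissonBracket F (c • G) z = c * poissonBracket F G z := by
  rw [poissonBracket_swap, poissonBracket_smul_left, poissonBracket_swap (F := G)]
  ring

theorem analyticFunctions_ext {F G : analyticFunctions Q} (h : EqOn F.1 G.1 Q) : F = G := by
  ext z
  by_cases hz : z ∈ Q
  · exact h hz
  · rw [(mem_analyticFunctions.1 F.2).2 z hz, (mem_analyticFunctions.1 G.2).2 z hz]

theorem analyticFunctions_differentiableAt (F : analyticFunctions Q) (hz : z ∈ Q) :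
    DifferentiableAt ℝ F.1 z := ((mem_analyticFunctions.1 F.2).1 z hz).differentiableAt

end PoissonAlgebra

noncomputable section

/-- The bracket `[F, G] = {G, F}` on the functions that are analytic on `Q`. -/
def analyticBracket {Q : Set (ℝ × ℝ)} (hQ : IsOpen Q) :
    analyticFunctions Q →ₗ[ℝ] analyticFunctions Q →ₗ[ℝ] analyticFunctions Q :=
  LinearMap.mk₂ ℝ
    (fun F G => ⟨Q.indicator (poissonBracket G.1 F.1), ((mem_analyticFunctions.1 G.2).1.poissonBracket
      (mem_analyticFunctions.1 F.2).1).indicator_mem hQ⟩)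
    (fun F F' G => analyticFunctions_ext fun z hz => by
      simpa [hz] using poissonBracket_add_right (analyticFunctions_differentiableAt F hz)
        (analyticFunctions_differentiableAt F' hz))
    (fun c F G => analyticFunctions_ext fun z hz => by
      simpa [hz] using poissonBracket_smul_right c)
    (fun F G G' => analyticFunctions_ext fun z hz => by
      simpa [hz] using poissonBracket_add_left (analyticFunctions_differentiableAt G hz)
        (analyticFunctions_differentiableAt G' hz))
    (fun c F G => analyticFunctions_ext fun z hz => by
      simpa [hz] using poissonBracket_smul_left c)

/-- The sequence of Taylor coefficients at `δ = 0` of a family of functions that is analytic on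
`{0} × Q`. -/
def familySeries {Q : Set (ℝ × ℝ)} (hQ : IsOpen Q) (G : ℝ → ℝ × ℝ → ℝ)
    (hG : ∀ z ∈ Q, AnalyticAt ℝ (Function.uncurry G) (0, z)) (n : ℕ) : analyticFunctions Q :=
  ⟨Q.indicator (familyCoeff G n),
    AnalyticOnNhd.indicator_mem hQ fun z hz => analyticAt_familyCoeff (hG z hz) n⟩

end

section FormalSeries

variable {Q : Set (ℝ × ℝ)} {G H : ℝ → ℝ × ℝ → ℝ} {z : ℝ × ℝ}

theorem analyticBracket_apply (hQ : IsOpen Q) (F G : analyticFunctions Q) (hz : z ∈ Q) :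
    (analyticBracket hQ F G).1 z = poissonBracket G.1 F.1 z := by
  simp [analyticBracket, hz]

theorem analyticBracket_swap (hQ : IsOpen Q) (F G : analyticFunctions Q) :
    analyticBracket hQ F G = -analyticBracket hQ G F :=
  analyticFunctions_ext fun z hz => by
    have := analyticBracket_apply hQ G F hz
    rw [analyticBracket_apply hQ F G hz, poissonBracket_swap, ← this]
    rfl

theorem familySeries_apply (hQ : IsOpen Q)
    (hG : ∀ z ∈ Q, AnalyticAt ℝ (Function.uncurry G) (0, z)) (n : ℕ) (hz : z ∈ Q) :
    (familySeries hQ G hG n).1 z = familyCoeff G n z := indicator_of_mem hz _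

theorem eqOn_foldr {R : ℕ → ℝ × ℝ → ℝ} {n : ℕ} (br : (ℝ × ℝ → ℝ) → (ℝ × ℝ → ℝ) → ℝ × ℝ → ℝ)
    (hQ : IsOpen Q) (hbr : br = fun F G => poissonBracket G F) {Z : ℕ → analyticFunctions Q}
    {l : List ℕ} (hl : ∀ k ∈ l, k ≤ n) (hZ : ∀ k ≤ n, EqOn (Z k).1 (R k) Q)
    {W : analyticFunctions Q} {W' : ℝ × ℝ → ℝ} (hW : EqOn W.1 W' Q) :
    EqOn (l.foldr (fun k W => analyticBracket hQ (Z k) W) W).1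
      (l.foldr (fun k W => br (R k) W) W') Q := by
  subst hbr
  induction l with
  | nil => simpa using hW
  | cons k l ih =>
    have h1 := ih fun j hj => hl j (List.mem_cons_of_mem k hj)
    intro z hz
    rw [List.foldr_cons, List.foldr_cons, analyticBracket_apply hQ _ _ hz]
    exact poissonBracket_congr hQ h1 (hZ k (hl k List.mem_cons_self)) hz

/-- The terms of the Baker-Campbell-Hausdorff series computed in the Poisson algebra of functions on
`Q` are restrictions of those computed from functions on the whole phase space. -/
theorem eqOn_bchTerm_yoshidaTerm (hQ : IsOpen Q) {X Y : analyticFunctions Q} {T V : ℝ × ℝ → ℝ}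
    (hX : EqOn X.1 V Q) (hY : EqOn Y.1 T Q) (n : ℕ) :
    EqOn (bchTerm (fun F G => analyticBracket hQ F G) X Y n).1 (yoshidaTerm T V n) Q := by
  unfold yoshidaTerm
  induction n using Nat.strong_induction_on with
  | _ n ih =>
    match n, ih with
    | 0, _ =>
      intro z _
      simp [bchTerm]
    | 1, _ =>
      intro z hz
      simp [bchTerm, hX hz, hY hz]
    | n + 2, ih =>
      have hXY : EqOn (X - Y).1 (V - T) Q := fun z hz => by simp [hX hz, hY hz]
      have hXY' : EqOn (X + Y).1 (V + T) Q := fun z hz => by simp [hX hz, hY hz]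
      intro z hz
      rw [bchTerm, bchTerm]
      have h1 : (analyticBracket hQ (X - Y)
          (bchTerm (fun F G => analyticBracket hQ F G) X Y (n + 1))).1 z
          = poissonBracket (bchTerm (fun F G => poissonBracket G F) V T (n + 1)) (V - T) z := by
        rw [analyticBracket_apply hQ _ _ hz]
        exact poissonBracket_congr hQ (ih (n + 1) (by omega)) hXY hz
      have h2 : ∀ c : Composition (n + 1), (c.blocks.attach.foldr (fun k W => analyticBracket hQ
            (bchTerm (fun F G => analyticBracket hQ F G) X Y k.1) W) (X + Y)).1 z
          = c.blocks.attach.foldr (fun k W =>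
            poissonBracket W (bchTerm (fun F G => poissonBracket G F) V T k.1)) (V + T) z := by
        intro c
        rw [List.foldr_attach (l := c.blocks) (f := fun k W => analyticBracket hQ
            (bchTerm (fun F G => analyticBracket hQ F G) X Y k) W),
          List.foldr_attach (l := c.blocks) (f := fun k W =>
            poissonBracket W (bchTerm (fun F G => poissonBracket G F) V T k))]
        exact eqOn_foldr (n := n + 1) (fun F G => poissonBracket G F) hQ rfl
          (fun k hk => c.blocks_le hk) (fun k hk => ih k (by omega)) hXY' hz
      simp only [Submodule.coe_smul, Submodule.coe_add, Submodule.coe_sum, Pi.smul_apply,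
        Pi.add_apply, Finset.sum_apply, smul_eq_mul, h1]
      congr 2
      refine Finset.sum_congr rfl fun c _ => ?_
      split_ifs with hc
      · simp only [Submodule.coe_smul, Pi.smul_apply, smul_eq_mul, h2]
      · rfl

theorem formalAd_familySeries (hQ : IsOpen Q)
    (hG : ∀ z ∈ Q, AnalyticAt ℝ (Function.uncurry G) (0, z))
    (hH : ∀ z ∈ Q, AnalyticAt ℝ (Function.uncurry H) (0, z)) :
    formalAd (analyticBracket hQ) (familySeries hQ H hH) (familySeries hQ G hG)
      = familySeries hQ (fun δ => poissonBracket (G δ) (H δ))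
        (fun z hz => (hG z hz).uncurry_poissonBracket (hH z hz)) := by
  funext n
  refine analyticFunctions_ext fun z hz => ?_
  rw [familySeries_apply _ _ _ hz, familyCoeff_poissonBracket (hG z hz) (hH z hz), formalAd_apply,
    Submodule.coe_sum, Finset.sum_apply]
  refine Finset.sum_congr rfl fun p _ => ?_
  rw [analyticBracket_apply _ _ _ hz]
  exact poissonBracket_congr hQ (fun z hz => familySeries_apply hQ hG _ hz)
    (fun z hz => familySeries_apply hQ hH _ hz) hz

end FormalSeries

noncomputable section

/-- The `k`-fold bracket `{…{{G, H}, H}, …, H}` of two families of functions. -/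
def iteratedBracket (H : ℝ → ℝ × ℝ → ℝ) : ℕ → (ℝ → ℝ × ℝ → ℝ) → ℝ → ℝ × ℝ → ℝ
  | 0, G => G
  | k + 1, G => fun δ => poissonBracket (iteratedBracket H k G δ) (H δ)

end

section IteratedBracket

variable {Q : Set (ℝ × ℝ)} {G H : ℝ → ℝ × ℝ → ℝ} {z : ℝ × ℝ}

theorem AnalyticAt.uncurry_iteratedBracket {δ : ℝ} (hG : AnalyticAt ℝ (Function.uncurry G) (δ, z))
    (hH : AnalyticAt ℝ (Function.uncurry H) (δ, z)) (k : ℕ) :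
    AnalyticAt ℝ (Function.uncurry (iteratedBracket H k G)) (δ, z) := by
  induction k with
  | zero => exact hG
  | succ k ih => exact ih.uncurry_poissonBracket hH

theorem formalAd_pow_familySeries (hQ : IsOpen Q)
    (hG : ∀ z ∈ Q, AnalyticAt ℝ (Function.uncurry G) (0, z))
    (hH : ∀ z ∈ Q, AnalyticAt ℝ (Function.uncurry H) (0, z)) (k : ℕ) :
    (formalAd (analyticBracket hQ) (familySeries hQ H hH) ^ k) (familySeries hQ G hG)
      = familySeries hQ (iteratedBracket H k G)
        (fun z hz => (hG z hz).uncurry_iteratedBracket (hH z hz) k) := by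
  induction k with
  | zero => rfl
  | succ k ih =>
    rw [pow_succ', Module.End.mul_apply, ih, formalAd_familySeries]
    rfl

theorem iteratedBracket_mul (k : ℕ) (δ : ℝ) (z : ℝ × ℝ) :
    iteratedBracket (fun δ z => δ * H δ z) k G δ z = δ ^ k * iteratedBracket H k G δ z := by
  induction k generalizing z with
  | zero => simp [iteratedBracket]
  | succ k ih =>
    have h1 : iteratedBracket (fun δ z => δ * H δ z) k G δ = δ ^ k • iteratedBracket H k G δ :=
      funext ih
    have h2 : (fun z => δ * H δ z) = δ • H δ := rfl
    simp only [iteratedBracket]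
    rw [h1, h2, poissonBracket_smul_left, poissonBracket_smul_right]
    ring

theorem hasDerivWithinAt_comp_of_hamiltonian {F K : ℝ × ℝ → ℝ} {c : ℝ → ℝ × ℝ} {s : ℝ} {S : Set ℝ}
    (hF : DifferentiableAt ℝ F (c s))
    (hc : HasDerivWithinAt c (fderiv ℝ K (c s) (0, 1), -fderiv ℝ K (c s) (1, 0)) S s) :
    HasDerivWithinAt (fun s => F (c s)) (poissonBracket F K (c s)) S s := by
  refine (hF.hasFDerivAt.comp_hasDerivWithinAt s hc).congr_deriv ?_
  have h : ((fderiv ℝ K (c s) (0, 1), -fderiv ℝ K (c s) (1, 0)) : ℝ × ℝ)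
      = fderiv ℝ K (c s) (0, 1) • ((1, 0) : ℝ × ℝ) - fderiv ℝ K (c s) (1, 0) • ((0, 1) : ℝ × ℝ) := by
    ext <;> simp
  rw [h, map_sub, map_smul, map_smul, poissonBracket]
  simp only [smul_eq_mul]
  ring

/-- A property that holds near `(0, z)` holds, for small `δ`, at all points at distance `O(δ)` from
`z`, such as those of a trajectory piece of a Hamiltonian of order `δ`. -/
theorem eventually_of_dist_le {p : ℝ × ℝ × ℝ → Prop} (hp : ∀ᶠ x in 𝓝 ((0 : ℝ), z), p x) (C : ℝ) :
    ∀ᶠ δ : ℝ in 𝓝 0, ∀ z', dist z' z ≤ C * |δ| → p (δ, z') := by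
  obtain ⟨r, hr, hball⟩ := Metric.eventually_nhds_iff.1 hp
  have h1 : ∀ᶠ δ : ℝ in 𝓝 0, |δ| < r :=
    (continuous_abs.tendsto 0).eventually_lt_const (by simpa using hr)
  have h2 : ∀ᶠ δ : ℝ in 𝓝 0, C * |δ| < r :=
    ((continuous_const.mul continuous_abs).tendsto 0).eventually_lt_const (by simpa using hr)
  filter_upwards [h1, h2] with δ h1 h2 z' hz'
  refine hball ?_
  rw [Prod.dist_eq, Real.dist_eq, sub_zero]
  exact max_lt h1 (hz'.trans_lt h2)

/-- The iterated brackets with a family of order `δ` give a chain of successive derivatives along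
short pieces of Hamiltonian trajectories, with the expected bound for the last one. -/
theorem eventually_iteratedBracket_chain (hG : AnalyticAt ℝ (Function.uncurry G) (0, z))
    (hH : AnalyticAt ℝ (Function.uncurry H) (0, z)) (N : ℕ) (C : ℝ) :
    ∃ M, ∀ᶠ δ : ℝ in 𝓝 0, ∀ c : ℝ → ℝ × ℝ, (∀ s ∈ Icc (0 : ℝ) 1, dist (c s) z ≤ C * |δ|) →
      (∀ s ∈ Icc (0 : ℝ) 1, HasDerivWithinAt c (fderiv ℝ (fun z => δ * H δ z) (c s) (0, 1),
        -fderiv ℝ (fun z => δ * H δ z) (c s) (1, 0)) (Icc 0 1) s) →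
      (∀ k ≤ N, ∀ s ∈ Icc (0 : ℝ) 1, HasDerivWithinAt
        (fun s => iteratedBracket (fun δ z => δ * H δ z) k G δ (c s))
        (iteratedBracket (fun δ z => δ * H δ z) (k + 1) G δ (c s)) (Icc 0 1) s) ∧
      ∀ s ∈ Icc (0 : ℝ) 1, |iteratedBracket (fun δ z => δ * H δ z) (N + 1) G δ (c s)|
        ≤ M * |δ| ^ (N + 1) := by
  have hδH : AnalyticAt ℝ (Function.uncurry fun δ z => δ * H δ z) (0, z) := analyticAt_fst.mul hH
  have h1 : ∀ᶠ x in 𝓝 ((0 : ℝ), z), ∀ k ∈ Iic N, DifferentiableAt ℝ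
      (Function.uncurry (iteratedBracket (fun δ z => δ * H δ z) k G)) x :=
    (eventually_all_finite (finite_Iic N)).2 fun k _ =>
      (hG.uncurry_iteratedBracket hδH k).eventually_differentiableAt
  have h2 := (hG.uncurry_iteratedBracket hH (N + 1)).continuousAt.abs.eventually_lt_const
    (lt_add_one _)
  refine ⟨|Function.uncurry (iteratedBracket H (N + 1) G) (0, z)| + 1, ?_⟩
  filter_upwards [eventually_of_dist_le (h1.and h2) C] with δ hδ c hcz hc
  refine ⟨fun k hk s hs => ?_, fun s hs => ?_⟩
  · refine hasDerivWithinAt_comp_of_hamiltonian ?_ (hc s hs)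
    exact (hasFDerivAt_of_uncurry ((hδ _ (hcz s hs)).1 k hk)).differentiableAt
  · rw [iteratedBracket_mul, abs_mul, abs_pow, mul_comm]
    gcongr
    exact (hδ _ (hcz s hs)).2.le

/-- If the average of `∂h/∂δ` along the trajectories of `h(δ, ·)` during unit time is the sum of a
function `V` at the initial point and a function `T` at the final point, then the Taylor
coefficients of `h` are the terms of the Baker-Campbell-Hausdorff series of `V` and `T`. -/
theorem yoshidaTerm_eq_familyCoeff (hQ : IsOpen Q)
    (hH : ∀ z ∈ Q, AnalyticAt ℝ (Function.uncurry H) (0, z)) {T V : ℝ × ℝ → ℝ}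
    (hT : AnalyticOnNhd ℝ T Q) (hV : AnalyticOnNhd ℝ V Q)
    (hE : ∀ z ∈ Q, ∃ C : ℝ, ∀ᶠ δ : ℝ in 𝓝 0, ∃ c : ℝ → ℝ × ℝ, c 0 = z ∧
      (∀ s ∈ Icc (0 : ℝ) 1, dist (c s) z ≤ C * |δ|) ∧
      (∀ s ∈ Icc (0 : ℝ) 1, HasDerivWithinAt c (fderiv ℝ (fun z => δ * H δ z) (c s) (0, 1),
        -fderiv ℝ (fun z => δ * H δ z) (c s) (1, 0)) (Icc 0 1) s) ∧
      V z + T (c 1) = ∫ s in (0 : ℝ)..1, deriv (fun δ => δ * H δ (c s)) δ)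
    (n : ℕ) (hz : z ∈ Q) :
    yoshidaTerm T V n z = familyCoeff (fun δ z => δ * H δ z) n z := by
  set h : ℝ → ℝ × ℝ → ℝ := fun δ z => δ * H δ z with hh
  set h' : ℝ → ℝ × ℝ → ℝ := fun δ z => deriv (fun δ => h δ z) δ with hh'
  have hha : ∀ z ∈ Q, AnalyticAt ℝ (Function.uncurry h) (0, z) := fun z hz =>
    analyticAt_fst.mul (hH z hz)
  have hha' : ∀ z ∈ Q, AnalyticAt ℝ (Function.uncurry h') (0, z) := fun z hz =>
    (hha z hz).uncurry_deriv
  have hconst : ∀ {F : ℝ × ℝ → ℝ}, AnalyticOnNhd ℝ F Q →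
      ∀ z ∈ Q, AnalyticAt ℝ (Function.uncurry fun _ : ℝ => F) (0, z) := fun {F} hF z hz =>
    AnalyticAt.fun_comp_of_eq (f := fun x : ℝ × ℝ × ℝ => x.2) (hF z hz) analyticAt_snd rfl
  -- the identity between the Taylor coefficients at a point
  have key : ∀ n, ∀ z ∈ Q,
      ∑ k ∈ Finset.range (n + 1), ((k + 1).factorial : ℝ)⁻¹
          * familyCoeff (iteratedBracket h k h') n z
        = (if n = 0 then V z else 0) + ∑ k ∈ Finset.range (n + 1), ((k.factorial : ℝ))⁻¹
          * familyCoeff (iteratedBracket h k fun _ => T) n z := by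
    intro n z hz
    obtain ⟨C, hC⟩ := hE z hz
    obtain ⟨M₁, hM₁⟩ := eventually_iteratedBracket_chain (hha' z hz) (hH z hz) n C
    obtain ⟨M₂, hM₂⟩ := eventually_iteratedBracket_chain (hconst hT z hz) (hH z hz) n C
    have ha₁ : ∀ k, AnalyticAt ℝ (fun δ => ((k + 1).factorial : ℝ)⁻¹
        * iteratedBracket h k h' δ z) 0 := fun k =>
      analyticAt_const.mul ((hha' z hz).uncurry_iteratedBracket (hha z hz) k).uncurry_left
    have ha₂ : ∀ k, AnalyticAt ℝ (fun δ => ((k.factorial : ℝ))⁻¹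
        * iteratedBracket h k (fun _ => T) δ z) 0 := fun k =>
      analyticAt_const.mul ((hconst hT z hz).uncurry_iteratedBracket (hha z hz) k).uncurry_left
    have hs₁ := (Finset.range (n + 1)).analyticAt_fun_sum fun k _ => ha₁ k
    have hs₂ := (Finset.range (n + 1)).analyticAt_fun_sum fun k _ => ha₂ k
    have hO : (fun δ => (∑ k ∈ Finset.range (n + 1), ((k + 1).factorial : ℝ)⁻¹
          * iteratedBracket h k h' δ z) - (V z + ∑ k ∈ Finset.range (n + 1), ((k.factorial : ℝ))⁻¹
          * iteratedBracket h k (fun _ => T) δ z)) =O[𝓝 0] fun δ : ℝ => δ ^ (n + 1) := by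
      refine IsBigO.of_bound (M₁ + M₂) ?_
      filter_upwards [hC, hM₁, hM₂] with δ ⟨c, hc0, hcz, hc, hcE⟩ h1 h2
      obtain ⟨h1a, h1b⟩ := h1 c hcz hc
      obtain ⟨h2a, h2b⟩ := h2 c hcz hc
      have e1 := abs_integral_sub_taylor_le
        (u := fun k s => iteratedBracket h k h' δ (c s)) h1a h1b
      have e2 := abs_sub_taylor_le
        (u := fun k s => iteratedBracket h k (fun _ => T) δ (c s)) h2a h2b 1 (by simp)
      simp only [hc0, one_pow, mul_one] at e1 e2
      have e3 : (∫ s in (0 : ℝ)..1, iteratedBracket h 0 h' δ (c s)) = V z + T (c 1) := hcE.symm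
      have e4 : iteratedBracket h 0 (fun _ => T) δ (c 1) = T (c 1) := rfl
      rw [e3] at e1
      rw [e4] at e2
      simp only [div_eq_inv_mul] at e1 e2
      rw [norm_pow, Real.norm_eq_abs, Real.norm_eq_abs, add_mul]
      rw [abs_le] at e1 e2 ⊢
      constructor <;> linarith [e1.1, e1.2, e2.1, e2.2]
    have hzero := AnalyticAt.iteratedDeriv_eq_zero_of_isBigO
      (hs₁.sub (analyticAt_const.add hs₂)) hO n (Nat.lt_succ_self n)
    have hsub := iteratedDeriv_fun_sub (n := n) hs₁.contDiffAt
      ((analyticAt_const (v := V z)).add hs₂).contDiffAt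
    have hadd := iteratedDeriv_fun_add (n := n) (analyticAt_const (v := V z)).contDiffAt
      hs₂.contDiffAt
    have hsum₁ := iteratedDeriv_fun_sum (n := n) (I := Finset.range (n + 1))
      fun k _ => (ha₁ k).contDiffAt
    have hsum₂ := iteratedDeriv_fun_sum (n := n) (I := Finset.range (n + 1))
      fun k _ => (ha₂ k).contDiffAt
    have htot : (∑ k ∈ Finset.range (n + 1), ((k + 1).factorial : ℝ)⁻¹
          * iteratedDeriv n (fun δ => iteratedBracket h k h' δ z) 0)
        = (if n = 0 then V z else 0) + ∑ k ∈ Finset.range (n + 1), ((k.factorial : ℝ))⁻¹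
          * iteratedDeriv n (fun δ => iteratedBracket h k (fun _ => T) δ z) 0 := by
      have h0 := hzero
      erw [hsub, hadd, hsum₁, hsum₂] at h0
      simp only [iteratedDeriv_const_mul_field, iteratedDeriv_const] at h0
      linarith
    have hn : (n.factorial : ℝ) ≠ 0 := by positivity
    have hV0 : (if n = 0 then V z else 0) = (if n = 0 then V z else 0) / (n.factorial : ℝ) := by
      split_ifs with h0 <;> simp [h0]
    rw [hV0]
    simp only [familyCoeff, mul_div_assoc']
    rw [← Finset.sum_div, ← Finset.sum_div, ← add_div, htot]
  have hmain := eq_bchTerm_of_formal_ode (br := analyticBracket hQ) (h := familySeries hQ h hha)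
    (analyticBracket_swap hQ) (familySeries hQ (fun _ => V) (hconst hV) 0)
    (familySeries hQ (fun _ => T) (hconst hT) 0)
    (analyticFunctions_ext fun z hz => by
      rw [familySeries_apply hQ hha 0 hz]
      simp [familyCoeff, hh]) (fun n => ?_) n
  · rw [← familySeries_apply hQ hha n hz, hmain]
    refine (eqOn_bchTerm_yoshidaTerm hQ (fun z hz => ?_) (fun z hz => ?_) n hz).symm
    · rw [familySeries_apply hQ _ 0 hz, familyCoeff_const, if_pos rfl]
    · rw [familySeries_apply hQ _ 0 hz, familyCoeff_const, if_pos rfl]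
  · have e1 : (fun m : ℕ => ((m : ℝ) + 1) • familySeries hQ h hha (m + 1)) = familySeries hQ h' hha' := by
      funext m
      refine analyticFunctions_ext fun z hz => ?_
      rw [familySeries_apply hQ hha' m hz, familyCoeff_deriv, Submodule.coe_smul, Pi.smul_apply,
        familySeries_apply hQ hha _ hz, smul_eq_mul]
    have e2 : ∀ {F : ℝ × ℝ → ℝ} (hF : AnalyticOnNhd ℝ F Q),
        (Pi.single 0 (familySeries hQ (fun _ => F) (hconst hF) 0) : ℕ → analyticFunctions Q)
          = familySeries hQ (fun _ => F) (hconst hF) := fun {F} hF => by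
      funext m
      refine analyticFunctions_ext fun z hz => ?_
      rcases Nat.eq_zero_or_pos m with rfl | hm
      · rw [Pi.single_eq_same]
      · rw [Pi.single_eq_of_ne hm.ne', familySeries_apply hQ _ m hz, familyCoeff_const,
          if_neg hm.ne']
        rfl
    rw [e1, e2 hT, e2 hV]
    simp only [formalAd_pow_familySeries]
    refine analyticFunctions_ext fun z hz => ?_
    simp only [Submodule.coe_sum, Submodule.coe_add, Submodule.coe_smul, Finset.sum_apply,
      Pi.add_apply, Pi.smul_apply, smul_eq_mul, familySeries_apply hQ _ _ hz, familyCoeff_const]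
    exact key n z hz

end IteratedBracket

/-! ### The Baker-Campbell-Hausdorff series of the map -/

section KdvSeries

variable {ε δ : ℝ} {z : ℝ × ℝ}

theorem isOpen_kdvSquare : IsOpen {z : ℝ × ℝ | |z.1| < ε ∧ |z.2| < ε} :=
  IsOpen.inter (s := {z : ℝ × ℝ | |z.1| < ε}) (t := {z : ℝ × ℝ | |z.2| < ε})
    (isOpen_lt (by fun_prop) continuous_const) (isOpen_lt (by fun_prop) continuous_const)

theorem kdvSquare_pos (hz : |z.1| < ε ∧ |z.2| < ε) : 0 < ε ^ 2 - z.1 ^ 2 ∧ 0 < ε ^ 2 - z.2 ^ 2 := by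
  have h1 := sq_lt_sq' (neg_lt_of_abs_lt hz.1) (lt_of_abs_lt hz.1)
  have h2 := sq_lt_sq' (neg_lt_of_abs_lt hz.2) (lt_of_abs_lt hz.2)
  exact ⟨by linarith, by linarith⟩

theorem kdvInvariant_add_pow_four (z : ℝ × ℝ) : kdvInvariant ε δ z + ε ^ 4
    = (ε ^ 2 - z.1 ^ 2) * (ε ^ 2 - z.2 ^ 2) - 2 * ε * δ * z.1 * z.2 := by
  simp only [kdvInvariant]
  ring

theorem eventually_mem_kdvRegion (hz : |z.1| < ε ∧ |z.2| < ε) :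
    ∀ᶠ δ : ℝ in 𝓝 0, 2 * δ ^ 2 < ε ^ 2 ∧ z ∈ kdvRegion ε δ := by
  have hε : 0 < ε := (abs_nonneg _).trans_lt hz.1
  obtain ⟨h1, h2⟩ := kdvSquare_pos hz
  have h3 := kdvInvariant_add_pow_four (ε := ε) (δ := 0) z
  have h4 : 0 < kdvInvariant ε 0 z + ε ^ 4 := by
    rw [h3]
    have := mul_pos h1 h2
    linarith
  have c1 : Continuous fun δ : ℝ => 2 * δ ^ 2 := by fun_prop
  have c2 : Continuous fun δ : ℝ => ε * (ε - |δ|) := by fun_prop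
  have c3 : Continuous fun δ : ℝ => kdvThreshold ε δ := by
    unfold kdvThreshold
    fun_prop
  have c4 : Continuous fun δ : ℝ => kdvInvariant ε δ z := by
    unfold kdvInvariant
    fun_prop
  have e1 := (c1.tendsto 0).eventually_lt_const (u := ε ^ 2) (by simpa using pow_pos hε 2)
  have e2 := (c2.tendsto 0).eventually_const_lt (u := z.1 ^ 2) (by simp; nlinarith)
  have e3 := (c2.tendsto 0).eventually_const_lt (u := z.2 ^ 2) (by simp; nlinarith)
  have e4 := (c3.tendsto 0).eventually_lt (c4.tendsto 0) (by
    simp only [kdvThreshold]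
    simp
    nlinarith)
  filter_upwards [e1, e2, e3, e4] with δ e1 e2 e3 e4 using ⟨e1, e2, e3, e4⟩

theorem kdvAdmissible_zero_of_square (hz : |z.1| < ε ∧ |z.2| < ε) :
    KdvAdmissible ε 0 (kdvInvariant ε 0 z) := by
  have hε : 0 < ε := (abs_nonneg _).trans_lt hz.1
  obtain ⟨h1, h2⟩ := (eventually_mem_kdvRegion hz).self_of_nhds
  exact kdvAdmissible_kdvInvariant hε h1 h2

theorem analyticAt_uncurry_kdvEta (hε : 0 < ε) (h : KdvAdmissible ε δ (kdvInvariant ε δ z)) :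
    AnalyticAt ℝ (Function.uncurry fun δ z => kdvEta ε δ (kdvInvariant ε δ z)) (δ, z) := by
  refine AnalyticAt.fun_comp_of_eq (g := fun x : ℝ × ℝ => kdvEta ε x.1 x.2)
    (f := fun x : ℝ × ℝ × ℝ => (x.1, kdvInvariant ε x.1 x.2)) (analyticAt_kdvEta hε h)
    (analyticAt_fst.prod ?_) rfl
  have hI : ContDiff ℝ ⊤ fun x : ℝ × ℝ × ℝ => kdvInvariant ε x.1 x.2 := by
    unfold kdvInvariant
    fun_prop
  exact hI.contDiffAt.analyticAt

theorem analyticOnNhd_kdvPotential :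
    AnalyticOnNhd ℝ (kdvPotential ε) {z : ℝ × ℝ | |z.1| < ε ∧ |z.2| < ε} := fun z hz => by
  have h1 : AnalyticAt ℝ (fun z : ℝ × ℝ => ε ^ 2 - z.1 ^ 2) z :=
    analyticAt_const.sub (analyticAt_fst.pow 2)
  exact analyticAt_const.mul (AnalyticAt.fun_comp_of_eq (analyticAt_log (kdvSquare_pos hz).1) h1 rfl)

theorem analyticOnNhd_kdvKinetic :
    AnalyticOnNhd ℝ (kdvKinetic ε) {z : ℝ × ℝ | |z.1| < ε ∧ |z.2| < ε} := fun z hz => by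
  have h1 : AnalyticAt ℝ (fun z : ℝ × ℝ => ε ^ 2 - z.2 ^ 2) z :=
    analyticAt_const.sub (analyticAt_snd.pow 2)
  exact analyticAt_const.mul (AnalyticAt.fun_comp_of_eq (analyticAt_log (kdvSquare_pos hz).2) h1 rfl)

/-- The total derivative with respect to the step size and the value of the invariant. -/
theorem KdvAdmissible.hasFDerivAt_mul_kdvEta {P D : ℝ} (hε : 0 < ε) (h : KdvAdmissible ε δ P)
    (hD : HasDerivAt (fun δ => δ * kdvEta ε δ P) D δ) :
    HasFDerivAt (fun x : ℝ × ℝ => x.1 * kdvEta ε x.1 x.2)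
      (D • ContinuousLinearMap.fst ℝ ℝ ℝ
        + scaledFrequency ε δ P • ContinuousLinearMap.snd ℝ ℝ ℝ) (δ, P) := by
  have ha : AnalyticAt ℝ (fun x : ℝ × ℝ => x.1 * kdvEta ε x.1 x.2) (δ, P) :=
    analyticAt_fst.mul (analyticAt_kdvEta hε h)
  have hd := ha.differentiableAt.hasFDerivAt
  refine hd.congr_fderiv ?_
  have e1 : HasDerivAt (fun δ => δ * kdvEta ε δ P) _ δ := hd.comp_hasDerivAt
    (f := fun δ => (δ, P)) δ ((hasDerivAt_id δ).prodMk (hasDerivAt_const δ P))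
  have e2 : HasDerivAt (fun P => δ * kdvEta ε δ P) _ P := hd.comp_hasDerivAt
    (f := fun P => (δ, P)) P ((hasDerivAt_const P δ).prodMk (hasDerivAt_id P))
  have h1 := e1.unique hD
  have h2 := e2.unique (h.hasDerivAt_kdvEta hε)
  ext
  · simpa using h1
  · simpa using h2

/-- The frequency is of the order of the step size. -/
theorem eventually_abs_scaledFrequency_le {P : ℝ} (hε : 0 < ε) (h : KdvAdmissible ε 0 P) :
    ∃ C, ∀ᶠ x : ℝ × ℝ in 𝓝 (0, P), KdvAdmissible ε x.1 x.2 →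
      |scaledFrequency ε x.1 x.2| ≤ C * |x.1| := by
  have ha := analyticAt_kdvEta hε h
  have hb := ha.fderiv.continuousAt.norm.eventually_lt_const (lt_add_one _)
  refine ⟨‖fderiv ℝ (fun x : ℝ × ℝ => kdvEta ε x.1 x.2) (0, P)‖ + 1, ?_⟩
  filter_upwards [hb, ha.eventually_analyticAt] with x hx hxa hadm
  have h1 : HasDerivAt (fun P => kdvEta ε x.1 P)
      (fderiv ℝ (fun x : ℝ × ℝ => kdvEta ε x.1 x.2) x (0, 1)) x.2 :=
    hxa.differentiableAt.hasFDerivAt.comp_hasDerivAt (f := fun P => (x.1, P)) x.2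
      ((hasDerivAt_const x.2 x.1).prodMk (hasDerivAt_id x.2))
  have h2 := (h1.const_mul x.1).unique (hadm.hasDerivAt_kdvEta hε)
  rw [← h2, abs_mul, mul_comm]
  gcongr
  refine ((fderiv ℝ (fun x : ℝ × ℝ => kdvEta ε x.1 x.2) x).le_opNorm (0, 1)).trans ?_
  simpa [Prod.norm_def] using hx.le

theorem norm_kdvField_le (hε : 0 < ε) (hδ : |δ| < ε) (hz : |z.1| ≤ ε ∧ |z.2| ≤ ε) :
    ‖kdvField ε δ z‖ ≤ 6 * ε ^ 3 := by
  have key : ∀ a b : ℝ, |a| ≤ ε → |b| ≤ ε →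
      |2 * b * a ^ 2 - 2 * ε ^ 2 * b - 2 * ε * δ * a| ≤ 6 * ε ^ 3 := by
    intro a b ha hb
    have h1 : |2 * b * a ^ 2 - 2 * ε ^ 2 * b - 2 * ε * δ * a|
        ≤ |2 * b * a ^ 2| + |2 * ε ^ 2 * b| + |2 * ε * δ * a| :=
      (abs_sub _ _).trans (add_le_add_left (abs_sub _ _) _)
    refine h1.trans ?_
    simp only [abs_mul, abs_pow, abs_two, abs_of_pos hε]
    have e1 : 2 * |b| * |a| ^ 2 ≤ 2 * ε * ε ^ 2 := by gcongr
    have e2 : 2 * ε ^ 2 * |b| ≤ 2 * ε ^ 2 * ε := by gcongr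
    have e3 : 2 * ε * |δ| * |a| ≤ 2 * ε * ε * ε := by gcongr
    nlinarith
  rw [Prod.norm_def]
  refine max_le (key z.1 z.2 hz.1 hz.2) ?_
  simp only [kdvField, norm_neg]
  exact key z.2 z.1 hz.2 hz.1

/-- The terms of the Baker-Campbell-Hausdorff series of the map are the Taylor coefficients of the
closed form. -/
theorem yoshidaTerm_kdv (hz : |z.1| < ε ∧ |z.2| < ε) (n : ℕ) :
    yoshidaTerm (kdvKinetic ε) (kdvPotential ε) n z
      = familyCoeff (fun δ z => δ * kdvEta ε δ (kdvInvariant ε δ z)) n z := by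
  have hε : 0 < ε := (abs_nonneg _).trans_lt hz.1
  refine yoshidaTerm_eq_familyCoeff (Q := {z : ℝ × ℝ | |z.1| < ε ∧ |z.2| < ε})
    (H := fun δ z => kdvEta ε δ (kdvInvariant ε δ z)) isOpen_kdvSquare
    (fun z hz => analyticAt_uncurry_kdvEta hε (kdvAdmissible_zero_of_square hz))
    analyticOnNhd_kdvKinetic analyticOnNhd_kdvPotential (fun z hz => ?_) n hz
  obtain ⟨C, hC⟩ := eventually_abs_scaledFrequency_le hε (kdvAdmissible_zero_of_square hz)
  refine ⟨6 * ε ^ 3 * C, ?_⟩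
  have hcont : Tendsto (fun δ : ℝ => (δ, kdvInvariant ε δ z)) (𝓝 0) (𝓝 (0, kdvInvariant ε 0 z)) := by
    refine Continuous.tendsto (f := fun δ : ℝ => (δ, kdvInvariant ε δ z)) ?_ 0
    unfold kdvInvariant
    fun_prop
  filter_upwards [eventually_mem_kdvRegion hz, hcont.eventually hC] with δ hδz hν
  obtain ⟨hδ, hzΩ⟩ := hδz
  have hadm := kdvAdmissible_kdvInvariant hε hδ hzΩ
  have hν := hν hadm
  obtain ⟨γ, rfl, hγ, hγm⟩ := exists_kdvOrbit hε hzΩ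
  have hI := kdvInvariant_comp_eq (k := fun _ => 1) (fun t => by simpa using hγ t)
  have hD := hasDerivAt_mul_kdvEta_orbit hε hδ hγ hγm
  have hmap := kdvMap_orbit hε hδ hγ hγm 0
  set P := kdvInvariant ε δ (γ 0) with hP
  set ν := scaledFrequency ε δ P with hνdef
  have hc : ∀ s, HasDerivAt (fun s => γ (ν * s)) (ν • kdvField ε δ (γ (ν * s))) s := by
    intro s
    have := (hγ (ν * s)).scomp s ((hasDerivAt_id s).const_mul ν)
    simpa [Function.comp_def] using this
  have hγc : Continuous γ := continuous_iff_continuousAt.2 fun t => (hγ t).continuousAt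
  refine ⟨fun s => γ (ν * s), by simp, fun s hs => ?_, fun s _ => ?_, ?_⟩
  · have hb : ∀ t, ‖kdvField ε δ (γ t)‖ ≤ 6 * ε ^ 3 := fun t => by
      have h1 := kdvRegion_sub_sq_pos hε (hγm t)
      exact norm_kdvField_le hε (abs_lt_of_two_mul_sq_lt hε hδ)
        ⟨abs_le_of_sq_le_sq (by linarith [h1.1]) hε.le, abs_le_of_sq_le_sq (by linarith [h1.2]) hε.le⟩
    have h1 := convex_univ.norm_image_sub_le_of_norm_hasDerivWithin_le (x := 0) (y := ν * s)
      (fun t _ => (hγ t).hasDerivWithinAt) (fun t _ => hb t) (mem_univ _) (mem_univ _)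
    rw [dist_eq_norm, mul_assoc]
    refine h1.trans ?_
    gcongr
    rw [sub_zero, norm_mul, Real.norm_eq_abs, Real.norm_eq_abs, abs_of_nonneg hs.1]
    exact (mul_le_of_le_one_right (abs_nonneg _) hs.2).trans hν
  · have h1 : kdvInvariant ε δ (γ (ν * s)) = P := hI _ 0
    have h2 := hadm.hasDerivAt_kdvEta hε
    rw [← h1] at h2
    rw [hamiltonianField_comp_kdvInvariant h2, h1]
    exact (hc s).hasDerivWithinAt
  · have hder : ∀ s, deriv (fun δ => δ * kdvEta ε δ (kdvInvariant ε δ (γ (ν * s)))) δ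
        = kdvPotential ε (γ 0) + kdvKinetic ε (kdvMap ε δ (γ 0))
          + 2 * ε * (∫ σ in (0 : ℝ)..ν, (γ σ).1 * (γ σ).2)
          - 2 * ε * (ν * ((γ (ν * s)).1 * (γ (ν * s)).2)) := by
      intro s
      have h1 : kdvInvariant ε δ (γ (ν * s)) = P := hI _ 0
      have h2 : HasDerivAt (fun δ => kdvInvariant ε δ (γ (ν * s)))
          (-2 * ε * ((γ (ν * s)).1 * (γ (ν * s)).2)) δ := by
        have h3 := ((((hasDerivAt_id δ).const_mul (2 * ε)).mul_const (γ (ν * s)).2).mul_const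
          (γ (ν * s)).1).const_sub ((γ (ν * s)).2 ^ 2 * (γ (ν * s)).1 ^ 2
            - ε ^ 2 * ((γ (ν * s)).2 ^ 2 + (γ (ν * s)).1 ^ 2))
        exact h3.congr_deriv (by ring)
      have h4 := hadm.hasFDerivAt_mul_kdvEta hε hD
      have h5 := HasFDerivAt.comp_hasDerivAt_of_eq (f := fun δ => (δ, kdvInvariant ε δ (γ (ν * s)))) δ
        h4 ((hasDerivAt_id δ).prodMk h2) (by simp [h1])
      have h6 := h5.deriv
      simp only [Function.comp_def] at h6
      rw [h6]
      simp
      ring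
    simp_rw [hder]
    have hint : ∫ s in (0 : ℝ)..1, ν * ((γ (ν * s)).1 * (γ (ν * s)).2)
        = ∫ σ in (0 : ℝ)..ν, (γ σ).1 * (γ σ).2 := by
      rw [intervalIntegral.integral_const_mul,
        intervalIntegral.mul_integral_comp_mul_left (f := fun σ => (γ σ).1 * (γ σ).2), mul_zero,
        mul_one]
    rw [intervalIntegral.integral_sub (by simp) (Continuous.intervalIntegrable (by fun_prop) _ _),
      intervalIntegral.integral_const_mul, hint, hmap]
    simp

/-- For small step sizes the Baker-Campbell-Hausdorff series converges to the closed form. -/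
theorem hasSum_yoshidaTerm_kdv (hz : |z.1| < ε ∧ |z.2| < ε) :
    ∃ r > 0, ∀ δ : ℝ, |δ| < r → z ∈ kdvRegion ε δ ∧
      HasSum (fun n : ℕ => δ ^ n * yoshidaTerm (kdvKinetic ε) (kdvPotential ε) n z)
        (kdvClosedForm ε δ (kdvInvariant ε δ z)) := by
  have hε : 0 < ε := (abs_nonneg _).trans_lt hz.1
  have ha : AnalyticAt ℝ (fun δ => δ * kdvEta ε δ (kdvInvariant ε δ z)) 0 :=
    analyticAt_id.mul (analyticAt_uncurry_kdvEta hε (kdvAdmissible_zero_of_square hz)).uncurry_left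
  have hs := hasFPowerSeriesAt_iff.1 ha.hasFPowerSeriesAt
  obtain ⟨r, hr, hball⟩ := Metric.eventually_nhds_iff.1 ((eventually_mem_kdvRegion hz).and hs)
  refine ⟨r, hr, fun δ hδ => ?_⟩
  obtain ⟨⟨hδ2, hzΩ⟩, hsum⟩ := hball (y := δ) (by simpa using hδ)
  refine ⟨hzΩ, ?_⟩
  rw [kdvClosedForm_eq hε hδ2 ⟨hzΩ.2.2, kdvInvariant_nonpos_of_mem hε hzΩ⟩]
  rw [zero_add] at hsum
  have hterm : (fun n : ℕ => δ ^ n * yoshidaTerm (kdvKinetic ε) (kdvPotential ε) n z)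
      = fun n => δ ^ n • (FormalMultilinearSeries.ofScalars ℝ fun n =>
        iteratedDeriv n (fun δ => δ * kdvEta ε δ (kdvInvariant ε δ z)) 0 / n.factorial).coeff n := by
    funext n
    rw [yoshidaTerm_kdv hz, smul_eq_mul, familyCoeff, FormalMultilinearSeries.coeff_ofScalars]
  rw [hterm]
  exact hsum

end KdvSeries

/-! ### The expansion of the closed form in powers of the step size -/

noncomputable section

/-- The terms up to the order `δ⁶` of the closed form, as a function of the step size and the value
of the invariant. -/
def kdvExpansion (ε δ P : ℝ) : ℝ :=
  δ * ε * Real.log (P + ε ^ 4) + 2 * δ ^ 3 * ε ^ 3 * P / (3 * (P + ε ^ 4) ^ 2)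
    - 4 * δ ^ 5 * ε ^ 5 * P * (P - 2 * ε ^ 4) / (15 * (P + ε ^ 4) ^ 4)

/-- The terms up to the order `δ⁶` of the frequency. -/
def frequencyExpansion (ε δ P : ℝ) : ℝ :=
  δ * ε / (P + ε ^ 4) + 2 * δ ^ 3 * ε ^ 3 * (ε ^ 4 - P) / (3 * (P + ε ^ 4) ^ 3)
    + 8 * δ ^ 5 * ε ^ 5 * (P ^ 2 - 4 * ε ^ 4 * P + ε ^ 8) / (15 * (P + ε ^ 4) ^ 5)

end

section Expansion

variable {ε δ P : ℝ}

theorem hasDerivAt_kdvExpansion (hS : P + ε ^ 4 ≠ 0) :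
    HasDerivAt (kdvExpansion ε δ) (frequencyExpansion ε δ P) P := by
  have h0 : HasDerivAt (fun P => P + ε ^ 4) 1 P := (hasDerivAt_id P).add_const _
  have h1 := (h0.log hS).const_mul (δ * ε)
  have h2 := ((hasDerivAt_id P).const_mul (2 * δ ^ 3 * ε ^ 3)).div ((h0.pow 2).const_mul 3)
    (mul_ne_zero three_ne_zero (pow_ne_zero 2 hS))
  have h3 := (((hasDerivAt_id P).const_mul (4 * δ ^ 5 * ε ^ 5)).mul
    ((hasDerivAt_id P).sub_const (2 * ε ^ 4))).div ((h0.pow 4).const_mul 15)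
    (mul_ne_zero (by norm_num) (pow_ne_zero 4 hS))
  refine HasDerivAt.congr_deriv (f := kdvExpansion ε δ) ((h1.add h2).sub h3) ?_
  simp only [frequencyExpansion, Pi.pow_apply, Pi.mul_apply, id_eq]
  field_simp
  ring

theorem abs_inv_sqrt_one_add_sub_le {x : ℝ} (hx : |x| ≤ 1 / 2) :
    |1 / √(1 + x) - (1 - x / 2 + 3 * x ^ 2 / 8)| ≤ 2 * |x| ^ 3 := by
  obtain ⟨h1, h2⟩ := abs_le.1 hx
  have hs0 : 0 < √(1 + x) := Real.sqrt_pos.2 (by linarith)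
  have hs2 : √(1 + x) ^ 2 = 1 + x := Real.sq_sqrt (by linarith)
  have hs : 1 / 2 ≤ √(1 + x) := Real.le_sqrt_of_sq_le (by linarith)
  set s := √(1 + x)
  set r := 1 - x / 2 + 3 * x ^ 2 / 8 with hr
  have hr0 : 0 < r := by nlinarith
  have e1 : (r * s - 1) * (r * s + 1) = x ^ 3 * (5 / 8 - 15 / 64 * x + 9 / 64 * x ^ 2) := by
    have : (r * s - 1) * (r * s + 1) = r ^ 2 * s ^ 2 - 1 := by ring
    rw [this, hs2, hr]
    ring
  have h3 : |5 / 8 - 15 / 64 * x + 9 / 64 * x ^ 2| ≤ 1 := by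
    rw [abs_le]
    constructor <;> nlinarith
  have h4 : |r * s - 1| ≤ |x| ^ 3 := by
    have h5 : |r * s - 1| * (r * s + 1) ≤ |x| ^ 3 := by
      have h6 : 0 < r * s + 1 := by positivity
      rw [← abs_of_pos h6, ← abs_mul, e1, abs_mul, abs_pow]
      exact mul_le_of_le_one_right (by positivity) h3
    have h7 : 0 ≤ |r * s - 1| * (r * s) := by positivity
    nlinarith
  have e2 : 1 / s - r = -(r * s - 1) / s := by
    field_simp
    ring
  rw [e2, abs_div, abs_neg, abs_of_pos hs0, div_le_iff₀ hs0]
  have : 0 ≤ |x| ^ 3 := by positivity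
  nlinarith

theorem eventually_kdvAdmissible {P₁ : ℝ} (hε : 0 < ε) (hP₁ : -ε ^ 4 < P₁) :
    ∀ᶠ δ : ℝ in 𝓝 0, ∀ P ∈ Icc P₁ 0, KdvAdmissible ε δ P := by
  have hc : Continuous fun δ : ℝ => 2 * ε ^ 2 * δ ^ 2 * (ε ^ 4 - P₁) := by fun_prop
  have h := (hc.tendsto 0).eventually_lt_const (u := (ε ^ 4 + P₁) ^ 2) (by
    have : 0 < ε ^ 4 + P₁ := by linarith
    simp only [ne_eq, OfNat.ofNat_ne_zero, not_false_eq_true, zero_pow, mul_zero, zero_mul]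
    positivity)
  filter_upwards [h] with δ hδ P hP
  refine ⟨hP₁.trans_le hP.1, hP.2, ?_⟩
  have h1 : 2 * ε ^ 2 * δ ^ 2 * (ε ^ 4 - P) ≤ 2 * ε ^ 2 * δ ^ 2 * (ε ^ 4 - P₁) := by
    have := hP.1
    gcongr
  have h2 : (ε ^ 4 + P₁) ^ 2 ≤ (ε ^ 4 + P) ^ 2 := by
    have h3 : 0 ≤ ε ^ 4 + P₁ := by linarith
    have := hP.1
    gcongr
  linarith

theorem integral_quadratic_sq (a b c : ℝ) :
    ∫ u in (0 : ℝ)..1, (a + b * u ^ 2 + c * u ^ 4) = a + b / 3 + c / 5 := by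
  rw [intervalIntegral.integral_add (Continuous.intervalIntegrable (by fun_prop) _ _)
    (Continuous.intervalIntegrable (by fun_prop) _ _),
    intervalIntegral.integral_add (Continuous.intervalIntegrable (by fun_prop) _ _)
    (Continuous.intervalIntegrable (by fun_prop) _ _)]
  simp [integral_pow]
  ring

/-- The expansion of the frequency, uniformly on compact ranges of the invariant. It is obtained by
expanding the integrand in powers of `δ²`, where the rescaled radicand is `ε² (1 + O(δ²))`. -/
theorem eventually_abs_scaledFrequency_sub_le {P₁ : ℝ} (hε : 0 < ε) (hP₁ : -ε ^ 4 < P₁) :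
    ∃ C, ∀ᶠ δ : ℝ in 𝓝 0, ∀ P ∈ Icc P₁ 0,
      |scaledFrequency ε δ P - frequencyExpansion ε δ P| ≤ C * |δ| ^ 7 := by
  have hS₁ : 0 < ε ^ 4 + P₁ := by linarith
  -- polynomial expressions in `δ, P, u` and `η = 2 ε² / (ε⁴ + P)`
  set y₀ : ℝ → ℝ → ℝ → ℝ := fun P u η => η ^ 2 * u ^ 2 * (P - ε ^ 4) / ε ^ 2 with hy₀
  set y₁ : ℝ → ℝ → ℝ → ℝ := fun P u η => η ^ 2 * u ^ 2 - P * η ^ 4 * u ^ 4 with hy₁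
  set Y : ℝ → ℝ → ℝ → ℝ → ℝ := fun δ P u η => y₀ P u η + δ ^ 2 * y₁ P u η with hY
  set R : ℝ → ℝ → ℝ → ℝ → ℝ := fun δ P u η =>
    3 / 8 * (2 * y₀ P u η * y₁ P u η + δ ^ 2 * y₁ P u η ^ 2) with hR
  have hcomp : IsCompact (Icc (-1 : ℝ) 1 ×ˢ Icc P₁ 0 ×ˢ Icc (0 : ℝ) 1
      ×ˢ Icc 0 (2 * ε ^ 2 / (ε ^ 4 + P₁))) :=
    isCompact_Icc.prod (isCompact_Icc.prod (isCompact_Icc.prod isCompact_Icc))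
  obtain ⟨K, hK⟩ := hcomp.exists_bound_of_continuousOn
    (f := fun x : ℝ × ℝ × ℝ × ℝ => Y x.1 x.2.1 x.2.2.1 x.2.2.2)
    (Continuous.continuousOn (by simp only [hY, hy₀, hy₁]; fun_prop))
  obtain ⟨M, hM⟩ := hcomp.exists_bound_of_continuousOn
    (f := fun x : ℝ × ℝ × ℝ × ℝ => x.2.2.2 / (2 * ε) * (2 * |Y x.1 x.2.1 x.2.2.1 x.2.2.2| ^ 3
      + |R x.1 x.2.1 x.2.2.1 x.2.2.2|))
    (Continuous.continuousOn (by simp only [hY, hR, hy₀, hy₁]; fun_prop))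
  refine ⟨M, ?_⟩
  have hsmall : ∀ᶠ δ : ℝ in 𝓝 0, δ ^ 2 * K < 1 / 2 := by
    have hc : Continuous fun δ : ℝ => δ ^ 2 * K := by fun_prop
    exact (hc.tendsto 0).eventually_lt_const (by simp)
  have hone : ∀ᶠ δ : ℝ in 𝓝 0, δ ∈ Icc (-1 : ℝ) 1 := Icc_mem_nhds (by norm_num) (by norm_num)
  filter_upwards [eventually_kdvAdmissible hε hP₁, hsmall, hone] with δ hadm hδK hδ P hP
  have h := hadm P hP
  have hS := h.pos
  set η := 2 * ε ^ 2 / (ε ^ 4 + P) with hη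
  have hη0 : 0 ≤ η := by positivity
  have hηm : η ∈ Icc 0 (2 * ε ^ 2 / (ε ^ 4 + P₁)) := by
    refine ⟨hη0, ?_⟩
    have := hP.1
    rw [hη]
    gcongr
  have he : scaledEndpoint ε δ P = δ * η := by
    rw [scaledEndpoint, hη]
    ring
  set q : ℝ → ℝ := fun u =>
    1 - δ ^ 2 * y₀ P u η / 2 + δ ^ 4 * (-y₁ P u η / 2 + 3 * y₀ P u η ^ 2 / 8) with hq
  have hqint : ∫ u in (0 : ℝ)..1, δ * η / (2 * ε) * q u = frequencyExpansion ε δ P := by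
    have e1 : ∀ u, δ * η / (2 * ε) * q u = δ * η / (2 * ε)
        + δ * η / (2 * ε) * (-δ ^ 2 * (η ^ 2 * (P - ε ^ 4) / ε ^ 2) / 2 - δ ^ 4 * η ^ 2 / 2) * u ^ 2
        + δ * η / (2 * ε) * (δ ^ 4 * (P * η ^ 4 / 2 + 3 * (η ^ 2 * (P - ε ^ 4) / ε ^ 2) ^ 2 / 8))
          * u ^ 4 := by
      intro u
      simp only [hq, hy₀, hy₁]
      ring
    simp_rw [e1]
    have hS' : P + ε ^ 4 ≠ 0 := by
      rw [add_comm]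
      exact hS.ne'
    rw [integral_quadratic_sq, frequencyExpansion, hη, add_comm (ε ^ 4) P]
    field_simp
    ring
  have hbound : ∀ u ∈ uIoc (0 : ℝ) 1, ‖scaledEndpoint ε δ P
        / (2 * √(scaledQuartic ε δ P (scaledEndpoint ε δ P * u))) - δ * η / (2 * ε) * q u‖
      ≤ M * |δ| ^ 7 := by
    intro u hu
    have hu : u ∈ Icc (0 : ℝ) 1 := by
      rw [uIoc_of_le zero_le_one] at hu
      exact ⟨hu.1.le, hu.2⟩
    have hx : scaledQuartic ε δ P (scaledEndpoint ε δ P * u)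
        = ε ^ 2 * (1 + δ ^ 2 * Y δ P u η) := by
      rw [he]
      simp only [scaledQuartic, hY, hy₀, hy₁]
      field_simp
      ring
    have hYK := hK (δ, P, u, η) ⟨hδ, hP, hu, hηm⟩
    have hMb := hM (δ, P, u, η) ⟨hδ, hP, hu, hηm⟩
    simp only at hYK hMb
    rw [Real.norm_eq_abs] at hYK hMb
    have hx2 : |δ ^ 2 * Y δ P u η| ≤ 1 / 2 := by
      rw [abs_mul, abs_of_nonneg (sq_nonneg δ)]
      exact (mul_le_mul_of_nonneg_left hYK (sq_nonneg δ)).trans hδK.le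
    have h1 := abs_inv_sqrt_one_add_sub_le hx2
    have h2 : 1 - δ ^ 2 * Y δ P u η / 2 + 3 * (δ ^ 2 * Y δ P u η) ^ 2 / 8
        = q u + δ ^ 6 * R δ P u η := by
      simp only [hq, hR, hY]
      ring
    rw [h2] at h1
    have h3 : |1 / √(1 + δ ^ 2 * Y δ P u η) - q u|
        ≤ |δ| ^ 6 * (2 * |Y δ P u η| ^ 3 + |R δ P u η|) := by
      have h4 : 1 / √(1 + δ ^ 2 * Y δ P u η) - q u
          = (1 / √(1 + δ ^ 2 * Y δ P u η) - (q u + δ ^ 6 * R δ P u η)) + δ ^ 6 * R δ P u η := by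
        ring
      rw [h4]
      refine (abs_add_le _ _).trans ((add_le_add_left h1 _).trans (le_of_eq ?_))
      rw [abs_mul, abs_mul, abs_pow, abs_pow]
      ring
    have h5 : scaledEndpoint ε δ P / (2 * √(scaledQuartic ε δ P (scaledEndpoint ε δ P * u)))
          - δ * η / (2 * ε) * q u
        = δ * (η / (2 * ε)) * (1 / √(1 + δ ^ 2 * Y δ P u η) - q u) := by
      rw [hx, Real.sqrt_mul (sq_nonneg ε), Real.sqrt_sq hε.le, he]
      have hpos : 0 < 1 + δ ^ 2 * Y δ P u η := by linarith [(abs_le.1 hx2).1]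
      have := (Real.sqrt_pos.2 hpos).ne'
      field_simp
    rw [h5, Real.norm_eq_abs, abs_mul, abs_mul, abs_of_nonneg (show 0 ≤ η / (2 * ε) by positivity)]
    have h6 : 0 ≤ |δ| * (η / (2 * ε)) := by positivity
    refine (mul_le_mul_of_nonneg_left h3 h6).trans ?_
    have h7 := (le_abs_self _).trans hMb
    have h8 : 0 ≤ |δ| ^ 7 := by positivity
    calc |δ| * (η / (2 * ε)) * (|δ| ^ 6 * (2 * |Y δ P u η| ^ 3 + |R δ P u η|))
        = η / (2 * ε) * (2 * |Y δ P u η| ^ 3 + |R δ P u η|) * |δ| ^ 7 := by ring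
      _ ≤ M * |δ| ^ 7 := mul_le_mul_of_nonneg_right h7 h8
  have hi1 : IntervalIntegrable (fun u => scaledEndpoint ε δ P
      / (2 * √(scaledQuartic ε δ P (scaledEndpoint ε δ P * u)))) MeasureTheory.volume 0 1 := by
    refine ContinuousOn.intervalIntegrable ?_
    rw [uIcc_of_le zero_le_one]
    exact h.continuousOn_speed hε
  have hi2 : IntervalIntegrable (fun u => δ * η / (2 * ε) * q u) MeasureTheory.volume 0 1 := by
    refine Continuous.intervalIntegrable ?_ _ _
    simp only [hq, hy₀, hy₁]
    fun_prop
  rw [← hqint, scaledFrequency, ← intervalIntegral.integral_sub hi1 hi2, ← Real.norm_eq_abs]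
  simpa using intervalIntegral.norm_integral_le_of_norm_le_const hbound

/-- The expansion of the closed form, uniformly on compact ranges of the invariant: it holds at
`P = 0`, and the derivatives of both sides are close. -/
theorem eventually_abs_kdvEta_sub_le {P₁ : ℝ} (hε : 0 < ε) (hP₁ : -ε ^ 4 < P₁) :
    ∃ C, ∀ᶠ δ : ℝ in 𝓝 0, ∀ P ∈ Icc P₁ 0,
      |δ * kdvEta ε δ P - kdvExpansion ε δ P| ≤ C * |δ| ^ 7 := by
  obtain ⟨C, hC⟩ := eventually_abs_scaledFrequency_sub_le hε hP₁
  refine ⟨C * |P₁|, ?_⟩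
  filter_upwards [hC, eventually_kdvAdmissible hε hP₁] with δ hδ hadm P hP
  have hd : ∀ x ∈ Icc P₁ 0, HasDerivWithinAt (fun P => δ * kdvEta ε δ P - kdvExpansion ε δ P)
      (scaledFrequency ε δ x - frequencyExpansion ε δ x) (Icc P₁ 0) x := fun x hx =>
    (((hadm x hx).hasDerivAt_kdvEta hε).sub (hasDerivAt_kdvExpansion
      (by rw [add_comm]; exact (hadm x hx).pos.ne'))).hasDerivWithinAt
  have h := (convex_Icc P₁ 0).norm_image_sub_le_of_norm_hasDerivWithin_le hd hδ
    (right_mem_Icc.2 (hP.1.trans hP.2)) hP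
  have h0 : δ * kdvEta ε δ 0 - kdvExpansion ε δ 0 = 0 := by
    rw [kdvEta_zero, kdvExpansion, zero_add, Real.log_pow]
    push_cast
    ring
  rw [h0, sub_zero, sub_zero, Real.norm_eq_abs, Real.norm_eq_abs] at h
  have hC0 : 0 ≤ C * |δ| ^ 7 := (abs_nonneg _).trans (hδ P hP)
  have h1 : |P| ≤ |P₁| := by
    rw [abs_of_nonpos hP.2, abs_of_nonpos (hP.1.trans hP.2)]
    linarith [hP.1]
  calc _ ≤ C * |δ| ^ 7 * |P| := h
    _ ≤ C * |δ| ^ 7 * |P₁| := mul_le_mul_of_nonneg_left h1 hC0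
    _ = _ := by ring

theorem isBigO_kdvClosedForm_sub (hε : 0 < ε) (hP : P ∈ Ioo (-ε ^ 4) 0) :
    (fun δ : ℝ => kdvClosedForm ε δ P - (δ * ε * Real.log (P + ε ^ 4)
      + 2 * δ ^ 3 * ε ^ 3 * P / (3 * (P + ε ^ 4) ^ 2)
      - 4 * δ ^ 5 * ε ^ 5 * P * (P - 2 * ε ^ 4) / (15 * (P + ε ^ 4) ^ 4)))
      =O[𝓝 0] fun δ : ℝ => δ ^ 7 := by
  obtain ⟨C, hC⟩ := eventually_abs_kdvEta_sub_le hε hP.1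
  have hc : Continuous fun δ : ℝ => 2 * δ ^ 2 := by fun_prop
  have hδ := (hc.tendsto 0).eventually_lt_const (u := ε ^ 2) (by simpa using pow_pos hε 2)
  refine IsBigO.of_bound C ?_
  filter_upwards [hC, eventually_kdvAdmissible hε hP.1, hδ] with δ h1 h2 h3
  have h4 := h2 P (left_mem_Icc.2 hP.2.le)
  rw [kdvClosedForm_eq hε h3 ⟨kdvThreshold_lt_of_lt_sq hε hP.1 h4.2.2, hP.2.le⟩, norm_pow,
    Real.norm_eq_abs, Real.norm_eq_abs]
  exact h1 P (left_mem_Icc.2 hP.2.le)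

theorem AnalyticAt.iteratedDeriv_div_factorial_eq_of_isBigO {f : ℝ → ℝ} (hf : AnalyticAt ℝ f 0)
    {N : ℕ} {a : ℕ → ℝ}
    (hO : (fun x => f x - ∑ k ∈ Finset.range N, a k * x ^ k) =O[𝓝 0] fun x : ℝ => x ^ N)
    {n : ℕ} (hn : n < N) : iteratedDeriv n f 0 / (n.factorial : ℝ) = a n := by
  have hk : ∀ k, AnalyticAt ℝ (fun x : ℝ => a k * x ^ k) 0 := fun k =>
    analyticAt_const.mul (analyticAt_id.pow k)
  have hs := (Finset.range N).analyticAt_fun_sum fun k _ => hk k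
  have h0 := AnalyticAt.iteratedDeriv_eq_zero_of_isBigO (hf.sub hs) hO n hn
  have h1 := iteratedDeriv_fun_sub (n := n) hf.contDiffAt hs.contDiffAt
  have h2 := iteratedDeriv_fun_sum (n := n) (I := Finset.range N) fun k _ => (hk k).contDiffAt
  have h3 : iteratedDeriv n f 0 - ∑ k ∈ Finset.range N, a k * (k.descFactorial n * 0 ^ (k - n)) = 0 := by
    erw [h1, h2] at h0
    simpa only [iteratedDeriv_const_mul_field, iteratedDeriv_pow] using h0
  rw [Finset.sum_eq_single_of_mem n (Finset.mem_range.2 hn)] at h3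
  · rw [Nat.descFactorial_self, Nat.sub_self, pow_zero, mul_one] at h3
    rw [sub_eq_zero.1 h3]
    field_simp
  · intro k _ hkn
    rcases lt_or_gt_of_ne hkn with h | h
    · simp [Nat.descFactorial_eq_zero_iff_lt.2 h]
    · simp [(Nat.sub_pos_of_lt h).ne']

theorem isBigO_log_sub {A b : ℝ} (hA : 0 < A) :
    (fun δ : ℝ => Real.log (A - b * δ) - (Real.log A - b / A * δ - (b / A) ^ 2 / 2 * δ ^ 2
      - (b / A) ^ 3 / 3 * δ ^ 3)) =O[𝓝 0] fun δ : ℝ => δ ^ 4 := by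
  have hc : Continuous fun δ : ℝ => |b / A * δ| := by fun_prop
  have h := (hc.tendsto 0).eventually_lt_const (u := 1 / 2) (by simp)
  refine IsBigO.of_bound (2 * |b / A| ^ 4) ?_
  filter_upwards [h] with δ hδ
  have h1 := Real.abs_log_sub_add_sum_range_le (hδ.trans (by norm_num)) 3
  have hpos : 0 < 1 - b / A * δ := by linarith [(abs_lt.1 hδ).2]
  have h2 : Real.log (A - b * δ) = Real.log A + Real.log (1 - b / A * δ) := by
    rw [← Real.log_mul hA.ne' hpos.ne']
    congr 1
    field_simp
  rw [h2, norm_pow, Real.norm_eq_abs, Real.norm_eq_abs, mul_assoc, ← mul_pow, ← abs_mul]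
  have h3 : Real.log A + Real.log (1 - b / A * δ) - (Real.log A - b / A * δ - (b / A) ^ 2 / 2 * δ ^ 2
      - (b / A) ^ 3 / 3 * δ ^ 3) = (∑ i ∈ Finset.range 3, (b / A * δ) ^ (i + 1) / ((i : ℝ) + 1))
        + Real.log (1 - b / A * δ) := by
    simp only [Finset.sum_range_succ, Finset.sum_range_zero]
    push_cast
    ring
  rw [h3]
  refine h1.trans ?_
  rw [div_le_iff₀ (by linarith)]
  have h4 : 0 ≤ |b / A * δ| ^ 4 := by positivity
  norm_num only at h4 ⊢
  nlinarith

theorem isBigO_mul_of_continuousAt {c : ℝ → ℝ} (hc : ContinuousAt c 0) (n : ℕ) :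
    (fun δ : ℝ => δ ^ n * c δ) =O[𝓝 0] fun δ : ℝ => δ ^ n := by
  simpa using (isBigO_refl (fun δ : ℝ => δ ^ n) (𝓝 0)).mul (hc.tendsto.isBigO_one ℝ)

theorem isBigO_rational_sub {A b N : ℝ} (hA : 0 < A) :
    (fun δ : ℝ => (N - b * δ) / (A - b * δ) ^ 2 - (N / A ^ 2 + (2 * b * N / A ^ 3 - b / A ^ 2) * δ))
      =O[𝓝 0] fun δ : ℝ => δ ^ 2 := by
  have hc : ContinuousAt (fun δ : ℝ => -(N / A ^ 2 * b ^ 2 - 2 * A * b * (2 * b * N / A ^ 3 - b / A ^ 2)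
      + δ * (2 * b * N / A ^ 3 - b / A ^ 2) * b ^ 2) / (A - b * δ) ^ 2) 0 :=
    ContinuousAt.div (by fun_prop) (by fun_prop) (by simpa using hA.ne')
  refine (isBigO_mul_of_continuousAt hc 2).congr' ?_ EventuallyEq.rfl
  have h : ∀ᶠ δ : ℝ in 𝓝 0, A - b * δ ≠ 0 :=
    ContinuousAt.eventually_ne (by fun_prop) (by simpa using hA.ne')
  filter_upwards [h] with δ hδ
  have hδ2 : (A - b * δ) ^ 2 ≠ 0 := pow_ne_zero 2 hδ
  rw [mul_div_assoc', div_eq_iff hδ2, sub_mul, div_mul_cancel₀ _ hδ2]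
  field_simp
  ring

/-- The first Taylor coefficients in `δ` of the closed form at a fixed point of phase space. The
coefficients come from the expansions of `log (A - b δ)` and of `P / (P + ε⁴)²`, where
`P + ε⁴ = A - b δ`. -/
theorem yoshidaTerm_kdv_eq {z : ℝ × ℝ} (hz : |z.1| < ε ∧ |z.2| < ε) {A b : ℝ}
    (hA : A = (ε ^ 2 - z.1 ^ 2) * (ε ^ 2 - z.2 ^ 2)) (hb : b = 2 * ε * z.1 * z.2) {n : ℕ}
    (hn : n < 5) :
    yoshidaTerm (kdvKinetic ε) (kdvPotential ε) n z
      = [0, ε * Real.log A, -ε * (b / A),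
          -ε * ((b / A) ^ 2 / 2) + 2 * ε ^ 3 / 3 * ((A - ε ^ 4) / A ^ 2),
          -ε * ((b / A) ^ 3 / 3)
            + 2 * ε ^ 3 / 3 * (2 * b * (A - ε ^ 4) / A ^ 3 - b / A ^ 2)].getD n 0 := by
  have hε : 0 < ε := (abs_nonneg _).trans_lt hz.1
  have hA0 : 0 < A := by
    rw [hA]
    exact mul_pos (kdvSquare_pos hz).1 (kdvSquare_pos hz).2
  have hI : ∀ δ, kdvInvariant ε δ z = A - ε ^ 4 - b * δ := fun δ => by
    have := kdvInvariant_add_pow_four (ε := ε) (δ := δ) z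
    rw [hA, hb]
    linarith
  have hadm := kdvAdmissible_zero_of_square hz
  have ha : AnalyticAt ℝ (fun δ => δ * kdvEta ε δ (kdvInvariant ε δ z)) 0 :=
    analyticAt_id.mul (analyticAt_uncurry_kdvEta hε hadm).uncurry_left
  rw [yoshidaTerm_kdv hz, familyCoeff]
  refine ha.iteratedDeriv_div_factorial_eq_of_isBigO (N := 5)
    (a := fun n => [0, ε * Real.log A, -ε * (b / A),
          -ε * ((b / A) ^ 2 / 2) + 2 * ε ^ 3 / 3 * ((A - ε ^ 4) / A ^ 2),
          -ε * ((b / A) ^ 3 / 3)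
            + 2 * ε ^ 3 / 3 * (2 * b * (A - ε ^ 4) / A ^ 3 - b / A ^ 2)].getD n 0) ?_ hn
  have hP₁ : -ε ^ 4 < A / 2 - ε ^ 4 := by linarith
  obtain ⟨C, hC⟩ := eventually_abs_kdvEta_sub_le hε hP₁
  have hmem : ∀ᶠ δ : ℝ in 𝓝 0, kdvInvariant ε δ z ∈ Icc (A / 2 - ε ^ 4) 0 := by
    have hc : Continuous fun δ : ℝ => A - ε ^ 4 - b * δ := by fun_prop
    have h1 := (hc.tendsto 0).eventually_const_lt (u := A / 2 - ε ^ 4) (by simp; linarith)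
    filter_upwards [h1, eventually_mem_kdvRegion hz] with δ h1 h2
    exact ⟨by rw [hI]; exact h1.le, kdvInvariant_nonpos_of_mem hε h2.2⟩
  have o1 : (fun δ => δ * kdvEta ε δ (kdvInvariant ε δ z)
      - kdvExpansion ε δ (kdvInvariant ε δ z)) =O[𝓝 0] fun δ : ℝ => δ ^ 5 := by
    have h7 : (fun δ : ℝ => δ ^ 7) =O[𝓝 0] fun δ : ℝ => δ ^ 5 := by
      have := isBigO_mul_of_continuousAt (c := fun δ : ℝ => δ ^ 2) (by fun_prop) 5
      refine this.congr_left fun δ => by ring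
    refine (IsBigO.of_bound C ?_).trans h7
    filter_upwards [hC, hmem] with δ h1 h2
    rw [norm_pow, Real.norm_eq_abs, Real.norm_eq_abs]
    exact h1 _ h2
  have o2 := ((isBigO_refl (fun δ : ℝ => δ ^ 1) (𝓝 0)).mul
    (isBigO_log_sub (b := b) hA0)).const_mul_left ε
  have o3 := ((isBigO_refl (fun δ : ℝ => δ ^ 3) (𝓝 0)).mul
    (isBigO_rational_sub (b := b) (N := A - ε ^ 4) hA0)).const_mul_left (2 * ε ^ 3 / 3)
  simp only [← pow_add] at o2 o3
  have hc4 : ContinuousAt (fun δ : ℝ => 4 * ε ^ 5 * (A - ε ^ 4 - b * δ)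
      * (A - ε ^ 4 - b * δ - 2 * ε ^ 4) / (15 * (A - b * δ) ^ 4)) 0 :=
    ContinuousAt.div (by fun_prop) (by fun_prop) (by simpa using hA0.ne')
  have o4 := isBigO_mul_of_continuousAt hc4 5
  refine (((o1.add o2).add o3).sub o4).congr_left fun δ => ?_
  simp only [kdvExpansion, hI, Finset.sum_range_succ, Finset.sum_range_zero,
    show A - ε ^ 4 - b * δ + ε ^ 4 = A - b * δ by ring]
  generalize A - b * δ = S
  simp
  ring

end Expansion

/-! ### The map, its modified Hamiltonians and their Baker-Campbell-Hausdorff series -/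

theorem mainTheorem1 :
    -- symplecticity, discrete Hamilton equations and invariance, wherever the map is defined
    (∀ ε δ : ℝ, ∀ z ∈ kdvDomain ε δ,
      (∃ A : ℝ × ℝ →L[ℝ] ℝ × ℝ, HasFDerivAt (kdvMap ε δ) A z ∧
        ∀ u v : ℝ × ℝ, symplecticForm (A u) (A v) = symplecticForm u v) ∧
      HasDerivAt (fun x => kdvDiscreteHamiltonian ε δ (x, (kdvMap ε δ z).2))
        (-((kdvMap ε δ z).2 - z.2)) z.1 ∧
      HasDerivAt (fun y => kdvDiscreteHamiltonian ε δ (z.1, y))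
        ((kdvMap ε δ z).1 - z.1) (kdvMap ε δ z).2 ∧
      kdvInvariant ε δ (kdvMap ε δ z) = kdvInvariant ε δ z) ∧
    -- the closed form of the modified Hamiltonian
    (∀ ε δ : ℝ, 0 < ε → 2 * δ ^ 2 < ε ^ 2 →
      (∀ P ∈ Ioo (kdvThreshold ε δ) 0,
        -- the integrand of the frequency is `∂p/∂P` along the level curve `I = P`, on the arc
        -- from `q = 0` to its image under the map
        (∀ x ∈ uIcc 0 (kdvEndpoint ε δ P),
          0 < kdvQuartic ε δ P x ∧
          kdvInvariant ε δ (x, kdvBranch ε δ x P) = P ∧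
          HasDerivAt (fun P' => kdvBranch ε δ x P') (1 / (2 * √(kdvQuartic ε δ P x))) P) ∧
        kdvMap ε δ (0, kdvBranch ε δ 0 P)
          = (kdvEndpoint ε δ P, kdvBranch ε δ (kdvEndpoint ε δ P) P) ∧
        HasDerivAt (kdvClosedForm ε δ) (kdvFrequency ε δ P) P) ∧
      -- one step of the map is the flow of the invariant for the time `ν(I)`
      (∀ z ∈ kdvRegion ε δ, z ≠ 0 → kdvInvariant ε δ z ∈ Ioo (kdvThreshold ε δ) 0 ∧
        ∃ γ : ℝ → ℝ × ℝ, IsHamiltonianTrajectory (kdvInvariant ε δ) γ ∧ γ 0 = z ∧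
          (∀ t, γ t ∈ kdvRegion ε δ) ∧
          γ (kdvFrequency ε δ (kdvInvariant ε δ z)) = kdvMap ε δ z) ∧
      -- every antiderivative of the frequency is a modified Hamiltonian away from the origin
      (∀ K : ℝ → ℝ,
        (∀ P ∈ Ioo (kdvThreshold ε δ) 0, HasDerivAt K (kdvFrequency ε δ P) P) →
        IsModifiedHamiltonian (kdvMap ε δ) (kdvRegion ε δ \ {0})
          (fun z => K (kdvInvariant ε δ z))) ∧
      -- the normalised antiderivative is a modified Hamiltonian on the whole region
      IsModifiedHamiltonian (kdvMap ε δ) (kdvRegion ε δ)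
        (fun z => kdvClosedForm ε δ (kdvInvariant ε δ z))) ∧
    -- the expansions in powers of `δ`
    (∀ ε : ℝ, 0 < ε →
      (∀ P ∈ Ioo (-ε ^ 4) 0,
        (fun δ : ℝ => kdvClosedForm ε δ P -
          (δ * ε * Real.log (P + ε ^ 4)
            + 2 * δ ^ 3 * ε ^ 3 * P / (3 * (P + ε ^ 4) ^ 2)
            - 4 * δ ^ 5 * ε ^ 5 * P * (P - 2 * ε ^ 4) / (15 * (P + ε ^ 4) ^ 4)))
          =O[𝓝 0] (fun δ : ℝ => δ ^ 7)) ∧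
      (∀ q p : ℝ, |q| < ε → |p| < ε →
        -- for fixed `(q, p)` the BCH series converges to the closed form for small `δ`
        (∃ r > 0, ∀ δ : ℝ, |δ| < r → (q, p) ∈ kdvRegion ε δ ∧
          HasSum (fun n : ℕ => δ ^ n * yoshidaTerm (kdvKinetic ε) (kdvPotential ε) n (q, p))
            (kdvClosedForm ε δ (kdvInvariant ε δ (q, p)))) ∧
        -- the first four terms of the BCH series
        yoshidaTerm (kdvKinetic ε) (kdvPotential ε) 1 (q, p)
          = ε * Real.log (ε ^ 2 - p ^ 2) + ε * Real.log (ε ^ 2 - q ^ 2) ∧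
        yoshidaTerm (kdvKinetic ε) (kdvPotential ε) 2 (q, p)
          = -(2 * ε ^ 2 * p * q / ((ε ^ 2 - p ^ 2) * (ε ^ 2 - q ^ 2))) ∧
        yoshidaTerm (kdvKinetic ε) (kdvPotential ε) 3 (q, p)
          = -(2 * ε ^ 3 * (ε ^ 2 * p ^ 2 + ε ^ 2 * q ^ 2 + 2 * p ^ 2 * q ^ 2)
              / (3 * (ε ^ 2 - p ^ 2) ^ 2 * (ε ^ 2 - q ^ 2) ^ 2)) ∧
        yoshidaTerm (kdvKinetic ε) (kdvPotential ε) 4 (q, p)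
          = -(4 * ε ^ 4 * p * q * (ε ^ 2 + p ^ 2) * (ε ^ 2 + q ^ 2)
              / (3 * (ε ^ 2 - p ^ 2) ^ 3 * (ε ^ 2 - q ^ 2) ^ 3)))) := by
  refine ⟨fun ε δ z hz => kdvMap_isSymplectic_discreteHamilton hz,
    fun ε δ hε hδ => ⟨fun P hP => ?_, fun z hz h0 => kdvMap_eq_flow hε hδ hz h0,
      fun K hK => isModifiedHamiltonian_of_hasDerivAt hε hδ hK,
      isModifiedHamiltonian_kdvClosedForm hε hδ⟩,
    fun ε hε => ⟨fun P hP => isBigO_kdvClosedForm_sub hε hP, fun q p hq hp => ?_⟩⟩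
  · have h := kdvAdmissible_of_mem hε hδ ⟨hP.1, hP.2.le⟩
    refine ⟨fun x hx => ?_, kdvMap_branch_zero hε h, hasDerivAt_kdvClosedForm hε hδ hP⟩
    obtain ⟨h1, h2⟩ := h.arc hε hP.2 hx
    exact ⟨h1, kdvInvariant_kdvBranch h1.le h2, hasDerivAt_kdvBranch h1 h2⟩
  · have hz : |(q, p).1| < ε ∧ |(q, p).2| < ε := ⟨hq, hp⟩
    obtain ⟨hq0, hp0⟩ := kdvSquare_pos hz
    have hH : ∀ n < 5, _ := fun n hn => yoshidaTerm_kdv_eq hz rfl rfl hn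
    simp only at hq0 hp0 hH
    refine ⟨hasSum_yoshidaTerm_kdv hz, ?_, ?_, ?_, ?_⟩
    · rw [hH 1 (by norm_num)]
      simp only [List.getD_cons_succ, List.getD_cons_zero]
      rw [Real.log_mul hq0.ne' hp0.ne']
      ring
    · rw [hH 2 (by norm_num)]
      simp only [List.getD_cons_succ, List.getD_cons_zero]
      field_simp
    · rw [hH 3 (by norm_num)]
      simp only [List.getD_cons_succ, List.getD_cons_zero]
      field_simp
      ring
    · rw [hH 4 (by norm_num)]
      simp only [List.getD_cons_succ, List.getD_cons_zero]
      field_simp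
      ring
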